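/- **Notation.** Let $h(x)=-x\log_2x-(1-x)\log_2(1-x)$ and $p\ast D=p(1-D)+D(1-p)$; $d_H$ is Hamming distance and $w_H$ Hamming weight. An RS/BLBC code of length $N$ is the binary linear code $\{\psi^*(\phi(v)) : v\in \mathcal C\}$, where: $\mathcal C=\mathcal C(n,k)$, $1\le k<n=2^m-1$, is the Reed–Solomon code over $\mathbb F_{2^m}$ whose generator polynomial $g$ has $n-k$ consecutive powers of a primitive element as its roots; $\phi:\mathbb F_{2^m}^n\to\mathbb F_2^{nm}$ is an $\mathbb F_2$-linear bijection; and $\psi^*(u_1,\dots,u_l)=(u_1G,\dots,u_lG)$ encodes each of $l$ equal groups of bits ($1\le l\le n$, $l\mid nm$) by an injective generator matrix $G$ of a binary linear block code of length $N/l$. Its dimension is $K=km$. If $k_2<k$ and the same $n$, $\phi$, $\psi^*$ and first root are used, $\mathcal C(n,k_2)\subset \mathcal C(n,k)$ has generator polynomial $gf$, and $\mathcal C_{eq2}\subset \mathcal C_{eq}$ denote the resulting nested RS/BLBC codes, of dimensions $K_2=k_2m$ and $K=km$; put $K_1=(k-k_2)m$. *Source encoding via list decoding* at distortion $D$: given $\mathbf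 W\in\mathbb F_2^N$, list all $\mathbf c\in\mathcal C_{eq}$ with $d_H(\mathbf c,\mathbf W)\le DN$ and choose one closest to $\mathbf W$; an encoding error is declared if the list is empty. The source $\mathbf W$ is symmetric Bernoulli (uniform on $\mathbb F_2^N$); the decoder has side information $\mathbf Y=\mathbf W+\mathbf S$ with $\mathbf S$ i.i.d. Bernoulli($p$), independent of $\mathbf W$. *The scheme.* The encoder quantizes $\mathbf W$ to $\mathbf c=\psi^*(\phi(v))\in\mathcal C_{eq}$ and stores the $K_1$ bits of $i_1=(v\bmod gf)/g$ (the zero message after an encoding error). The decoder forms $\mathbf c_1=\psi^*(\phi(i_1g))$, applies a channel decoder of $\mathcal C_{eq2}$ to $\mathbf c_1+\mathbf Y$ to obtain $\mathbf c_2$, and outputs $\hat{\mathbf W}=\mathbf c_1+\mathbf c_2$. Codes $\mathcal C_i$ of lengths $N_i\to\infty$ *achieve capacity on the BSC($q$)* if their rates tend to $1-h(q)$ and there are decoders whose average error probabilities tend to $0$. **Proposition.** (1) For every $0<D<1/2$ there is a sequence of RS/BLBC codes $\mathcal C_{eq}$ with $N\to\infty$ and $K/N\to1-h(D)$ such that the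 encoding error probability at distortion $D$ tends to $0$, the expected list size is at most polynomial in $N$, and for every $D'<D$ every Hamming ball of radius $D'N$ contains at most polynomially many (in $N$) codewords. (2) Let $0<p<1/2$, $0<D<1/2$, and let any sequence of RS/BLBC codes $\mathcal C_{eq2}$ be given that achieves capacity on the BSC($p\ast D$) and whose outer length leaves room for a code of rate $1-h(D)$, i.e. $\liminf nm/N>1-h(D)$. Then, with the same outer length, primitive element, first root and $\phi$, there are $k$ with $k_2<k<n$ (for all large indices), inner codes for which every codeword of $\mathcal C(n,k_2)$ has the same encoding as before (so that $\mathcal C_{eq2}$ is unchanged), and channel decoders of $\mathcal C_{eq2}$, such that for the nested codes $\mathcal C_{eq2}\subset\mathcal C_{eq}$: $K/N\to1-h(D)$; the encoding error probability at distortion $D$ tends to $0$, with polynomial expected list size; the compression rate $K_1/N$ tends to $h(p\ast D)-h(D)$; and, with probability tending to $1$, no encoding error is declared, $\hat{\mathbf W}=\mathbf c$, and $d_H(\mathbf W,\hat{\mathbf W})\le DN$. Moreover, for every $\theta\in[0,1]$, there are $T$ such that time sharing with the point $(p,0)$ ($T$ further source bits, for which nothing is stored, are reconstructed by their side information) has rate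 $K_1/(N+T)\to\theta\,(h(p\ast D)-h(D))$ and, for every $\varepsilon>0$, distortion at most $\theta D+(1-\theta)p+\varepsilon$ with probability tending to $1$. (3) The points in (2) exhaust the Wyner–Ziv rate-distortion bound $R_{WZ}(\cdot,p)=\text{l.c.e.}\{h(p\ast D)-h(D),\,(p,0)\}$, the lower convex envelope of the curve $D\mapsto h(p\ast D)-h(D)$, $0\le D\le p$, and the point $(p,0)$: for all $0<p<1/2$ and $0<d\le p$ there are $D\in(0,p)$ and $\theta\in[0,1]$ with $d=\theta D+(1-\theta)p$ and $R_{WZ}(d,p)=\theta\,(h(p\ast D)-h(D))$. -/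

import Mathlib

open Filter Topology

noncomputable section

/-- Binary words of length `N`. -/
abbrev BVec (N : ℕ) : Type := Fin N → ZMod 2

/-- Binary entropy function, in bits. -/
def h2 (x : ℝ) : ℝ := Real.binEntropy x / Real.log 2

/-- Binary convolution `p ∗ D = p (1 - D) + D (1 - p)`. -/
def bconv (p D : ℝ) : ℝ := p * (1 - D) + D * (1 - p)

/-- The polynomial `∑ j, x j X ^ j` with coefficient vector `x`. -/
def vecPoly {F : Type} [Field F] (r : ℕ) : (Fin r → F) →ₗ[F] Polynomial F :=
  ∑ j : Fin r, (Polynomial.monomial (j : ℕ)).comp (LinearMap.proj j)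

/-! ### Reed-Solomon outer codes, binary inner codes, concatenation -/

/-- Data of the nested cyclic (primitive) Reed-Solomon codes of length `n = 2 ^ m - 1` over the
field with `2 ^ m` elements: a primitive element, the exponent of the first root of the generator
polynomials, and the linear bijection `φ` to binary words of length `n * m`. -/
structure OuterRS where
  m : ℕ
  α : GaloisField 2 m
  primitive : orderOf α = 2 ^ m - 1
  b : ℕ
  φ : (Fin (2 ^ m - 1) → GaloisField 2 m) ≃ₗ[ZMod 2] BVec ((2 ^ m - 1) * m)

namespace OuterRS

/-- Length of the outer code. -/
abbrev n (O : OuterRS) : ℕ := 2 ^ O.m - 1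

/-- Alphabet of the outer code. -/
abbrev F (O : OuterRS) : Type := GaloisField 2 O.m

/-- Generator polynomial of the Reed-Solomon code of dimension `k`; it has the `n - k`
consecutive roots `α ^ b, …, α ^ (b + n - k - 1)`.  For `k₂ ≤ k` it divides `O.gen k₂`. -/
def gen (O : OuterRS) (k : ℕ) : Polynomial O.F :=
  ∏ j ∈ Finset.range (O.n - k), (Polynomial.X - Polynomial.C (O.α ^ (O.b + j)))

/-- The Reed-Solomon code of dimension `k`: the words whose polynomial is a multiple of the
generator polynomial. -/
def rsCode (O : OuterRS) (k : ℕ) : Submodule O.F (Fin O.n → O.F) :=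
  ((Ideal.span {O.gen k}).restrictScalars O.F).comap (vecPoly O.n)

end OuterRS

/-- A binary linear block code with injective generator matrix `G`, used to encode a binary word
of length `M`, cut into `l` consecutive groups of equal length (`l ≤ n`), to a word of length
`N`. -/
structure InnerBLBC (n M N : ℕ) where
  l : ℕ
  s : ℕ
  t : ℕ
  one_le_l : 1 ≤ l
  l_le : l ≤ n
  hs : l * s = M
  ht : l * t = N
  G : Matrix (Fin s) (Fin t) (ZMod 2)
  inj : Function.Injective (fun u : Fin s → ZMod 2 => Matrix.vecMul u G)

/-- The map `ψ* (u₁, …, u_l) = (u₁ G, …, u_l G)`. -/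
def InnerBLBC.psiStar {n M N : ℕ} (I : InnerBLBC n M N) : BVec M →ₗ[ZMod 2] BVec N :=
  LinearMap.pi fun j : Fin N =>
    (LinearMap.proj (finProdFinEquiv.symm (Fin.cast I.ht.symm j)).2) ∘ₗ
      (Matrix.vecMulLinear I.G) ∘ₗ
        (LinearMap.funLeft (ZMod 2) (ZMod 2) fun a : Fin I.s =>
          Fin.cast I.hs (finProdFinEquiv ((finProdFinEquiv.symm (Fin.cast I.ht.symm j)).1, a)))

/-- Inner codes that fit the outer code `O` and produce binary words of length `N`. -/
abbrev OuterRS.Inner (O : OuterRS) (N : ℕ) : Type := InnerBLBC O.n (O.n * O.m) N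

/-- The concatenation map `v ↦ ψ* (φ v)`. -/
def concat (O : OuterRS) {N : ℕ} (I : O.Inner N) : (Fin O.n → O.F) →ₗ[ZMod 2] BVec N :=
  I.psiStar ∘ₗ O.φ.toLinearMap

/-- The concatenated binary code `{ψ* (φ v) | v in the Reed-Solomon code of dimension k}`. -/
def concatCode (O : OuterRS) {N : ℕ} (I : O.Inner N) (k : ℕ) : Submodule (ZMod 2) (BVec N) :=
  ((O.rsCode k).restrictScalars (ZMod 2)).map (concat O I)

/-! ### The binary symmetric channel -/

/-- Probability of the noise word `z` when its entries are i.i.d. Bernoulli(`q`). -/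
def bern (q : ℝ) {N : ℕ} (z : BVec N) : ℝ := ∏ j, if z j = 0 then 1 - q else q

open Classical in
/-- Average error probability of the decoder `dec` for the code `C` on the BSC(`q`). -/
def bscError (q : ℝ) {N : ℕ} (C : Submodule (ZMod 2) (BVec N)) (dec : BVec N → BVec N) : ℝ :=
  (∑ c : C, ∑ z : BVec N, bern q z * (if dec (c + z) = c then 0 else 1)) / (Nat.card C : ℝ)

/-- The codes `C i`, of lengths tending to infinity, achieve the capacity `1 - h(q)` of the
BSC(`q`). -/
def AchievesCapacityBSC (q : ℝ) (N : ℕ → ℕ) (C : ∀ i, Submodule (ZMod 2) (BVec (N i))) : Prop :=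
  Tendsto N atTop atTop ∧
  Tendsto (fun i => (Module.finrank (ZMod 2) (C i) : ℝ) / N i) atTop (𝓝 (1 - h2 q)) ∧
  ∃ dec : ∀ i, BVec (N i) → BVec (N i),
    Tendsto (fun i => bscError q (C i) (dec i)) atTop (𝓝 0)

/-! ### Source encoding by list decoding -/

open Classical in
/-- The list of all codewords at Hamming distance at most `D N` from `w`. -/
def listDecode {N : ℕ} (C : Submodule (ZMod 2) (BVec N)) (D : ℝ) (w : BVec N) :
    Finset (BVec N) :=
  Finset.univ.filter fun c => c ∈ C ∧ (hammingDist c w : ℝ) ≤ D * N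

open Classical in
/-- The source encoder: a codeword of the list closest to `w`; an error (`none`) is declared when
the list is empty. -/
def quantize {N : ℕ} (C : Submodule (ZMod 2) (BVec N)) (D : ℝ) (w : BVec N) :
    Option (BVec N) :=
  if h : (listDecode C D w).Nonempty then
    some (Classical.choose
      (Finset.exists_min_image (listDecode C D w) (fun c => hammingDist c w) h))
  else none

open Classical in
/-- Probability that source encoding fails for a uniformly distributed source word. -/
def encodingError {N : ℕ} (C : Submodule (ZMod 2) (BVec N)) (D : ℝ) : ℝ :=
  (∑ w : BVec N, if quantize C D w = none then (1 : ℝ) else 0) / 2 ^ N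

/-- Expected size of the list for a uniformly distributed source word. -/
def meanListSize {N : ℕ} (C : Submodule (ZMod 2) (BVec N)) (D : ℝ) : ℝ :=
  (∑ w : BVec N, ((listDecode C D w).card : ℝ)) / 2 ^ N

/-! ### The scheme with decoder side information -/

/-- The encoder: `w` is quantized to `c = ψ* (φ v)` with `v` in the Reed-Solomon code of
dimension `k`, and the `k - k₂` coefficients of `i₁ = (v mod (g f)) / g` are stored, where `g` and
`g f` are the generator polynomials of the codes of dimension `k` and `k₂`.  If an encoder error
is declared, the zero message is stored. -/
def wzEncode (O : OuterRS) {N : ℕ} (I : O.Inner N) (k₂ k : ℕ) (D : ℝ) (w : BVec N) :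
    Fin (k - k₂) → O.F :=
  fun j =>
    ((vecPoly O.n (Function.invFun (concat O I)
      ((quantize (concatCode O I k) D w).getD 0)) %ₘ O.gen k₂) /ₘ O.gen k).coeff j

/-- The codeword `c₁ = ψ* (φ v₁)`, `v₁ = i₁ g`, that belongs to a stored message `i₁`. -/
def messageWord (O : OuterRS) {N : ℕ} (I : O.Inner N) (k₂ k : ℕ) (x : Fin (k - k₂) → O.F) :
    BVec N :=
  concat O I fun j => (vecPoly (k - k₂) x * O.gen k).coeff j

/-- The decoder: from the message and the side information `y` it forms `c₁ + y`, recovers `c₂`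
with the channel decoder `dec`, and outputs `c₁ + c₂`. -/
def wzDecode (O : OuterRS) {N : ℕ} (I : O.Inner N) (k₂ k : ℕ) (dec : BVec N → BVec N)
    (x : Fin (k - k₂) → O.F) (y : BVec N) : BVec N :=
  messageWord O I k₂ k x + dec (messageWord O I k₂ k x + y)

/-- The reconstruction of the source word `w` when the side information is `y = w + s`. -/
def wzReconstruct (O : OuterRS) {N : ℕ} (I : O.Inner N) (k₂ k : ℕ) (D : ℝ)
    (dec : BVec N → BVec N) (w s : BVec N) : BVec N :=
  wzDecode O I k₂ k dec (wzEncode O I k₂ k D w) (w + s)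

open Classical in
/-- Probability of the event `E w s` for `w` uniform and `s` i.i.d. Bernoulli(`p`), independent. -/
def sourceProb (p : ℝ) {N : ℕ} (E : BVec N → BVec N → Prop) : ℝ :=
  ∑ w : BVec N, ∑ s : BVec N, (1 / 2 ^ N) * bern p s * (if E w s then 1 else 0)

/-- Time sharing with the point `(p, 0)`: the first `N` source bits are reconstructed by
`rec w s`, the next `T` bits by their side information (nothing is stored for them, and the
reconstruction differs from the source in the noise `s'`).  Probability that the total number of
wrong bits exceeds `δ (N + T)`. -/
def timeSharedExcess (p : ℝ) {N : ℕ} (rec : BVec N → BVec N → BVec N) (T : ℕ) (δ : ℝ) : ℝ :=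
  ∑ s' : BVec T, bern p s' *
    sourceProb p fun w s : BVec N =>
      δ * ((N : ℝ) + T) < (hammingDist w (rec w s) : ℝ) + (hammingNorm s' : ℝ)

/-- The rate-distortion bound `l.c.e. {h(p ∗ D) - h(D), (p, 0)}` at distortion `d`. -/
def rateWZ (p d : ℝ) : ℝ :=
  sInf {r : ℝ | (d, r) ∈ convexHull ℝ
    ((fun D : ℝ => (D, h2 (bconv p D) - h2 D)) '' Set.Icc 0 p ∪ {((p, 0) : ℝ × ℝ)})}

end

noncomputable section

/-! ### Binary words and Bernoulli noise -/

lemma sum_zmod_two {R : Type*} [AddCommMonoid R] (f : ZMod 2 → R) : ∑ b, f b = f 0 + f 1 :=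
  Fin.sum_univ_two f

lemma sum_prod_word {R : Type*} [CommSemiring R] {N : ℕ} (f : Fin N → ZMod 2 → R) :
    ∑ z : BVec N, ∏ j, f j (z j) = ∏ j, (f j 0 + f j 1) := by
  have h : ∀ j, f j 0 + f j 1 = ∑ b ∈ (Finset.univ : Finset (ZMod 2)), f j b := fun j => by
    exact (sum_zmod_two (f j)).symm
  simp_rw [h]
  rw [Finset.prod_univ_sum, Fintype.piFinset_univ]

lemma zmod_two_eq_one {b : ZMod 2} (h : b ≠ 0) : b = 1 := by
  revert b; decide

lemma hammingNorm_eq_sum {N : ℕ} (z : BVec N) :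
    hammingNorm z = ∑ j, if z j = 0 then 0 else 1 := by
  simp [hammingNorm, Finset.card_filter, ite_not]

lemma hammingNorm_le {N : ℕ} (z : BVec N) : hammingNorm z ≤ N := by
  simpa using hammingNorm_le_card_fintype (x := z)

lemma bern_eq (q : ℝ) {N : ℕ} (z : BVec N) :
    bern q z = q ^ hammingNorm z * (1 - q) ^ (N - hammingNorm z) := by
  have h1 : (Finset.univ.filter fun j => z j = 0).card = N - hammingNorm z := by
    have := Finset.card_filter_add_card_filter_not (s := (Finset.univ : Finset (Fin N)))
      (fun j => z j = 0)
    simp only [Finset.card_univ, Fintype.card_fin] at this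
    unfold hammingNorm
    simp only [ne_eq]
    omega
  rw [bern, Finset.prod_ite, Finset.prod_const, Finset.prod_const, h1, mul_comm]
  rfl

lemma bern_nonneg {q : ℝ} (h0 : 0 ≤ q) (h1 : q ≤ 1) {N : ℕ} (z : BVec N) : 0 ≤ bern q z :=
  Finset.prod_nonneg fun j _ => by split_ifs <;> linarith

lemma sum_bern (q : ℝ) (N : ℕ) : ∑ z : BVec N, bern q z = 1 := by
  have := sum_prod_word (N := N) (fun _ b => if b = 0 then 1 - q else q)
  simp only [bern]
  rw [this]
  simp

/-- Convolution of Bernoulli noise words. -/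
lemma bern_conv (p D : ℝ) {N : ℕ} (z : BVec N) :
    ∑ t : BVec N, bern D t * bern p (z + t) = bern (bconv p D) z := by
  simp only [bern, ← Finset.prod_mul_distrib, Pi.add_apply]
  have := sum_prod_word (N := N) (fun j b => (if b = 0 then 1 - D else D) *
    (if z j + b = 0 then 1 - p else p))
  rw [this]
  refine Finset.prod_congr rfl fun j _ => ?_
  have h11 : (1 : ZMod 2) + 1 = 0 := by decide
  by_cases h : z j = 0
  · simp [h, bconv]; ring
  · rw [zmod_two_eq_one h]
    simp [bconv, h11]; ring

lemma sum_bern_conv (p D : ℝ) {N : ℕ} (F : BVec N → ℝ) :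
    ∑ t : BVec N, bern D t * ∑ s : BVec N, bern p s * F (t + s) =
      ∑ z : BVec N, bern (bconv p D) z * F z := by
  have h : ∀ t : BVec N, ∑ s : BVec N, bern p s * F (t + s) = ∑ z, bern p (z + t) * F z := by
    intro t
    refine Fintype.sum_equiv (Equiv.addLeft t) _ _ fun s => ?_
    simp only [Equiv.coe_addLeft]
    congr 2
    rw [add_right_comm, ← ZModModule.sub_eq_add t t, sub_self, zero_add]
  simp_rw [h, Finset.mul_sum]
  rw [Finset.sum_comm]
  refine Finset.sum_congr rfl fun z _ => ?_
  rw [← bern_conv, Finset.sum_mul]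
  exact Finset.sum_congr rfl fun t _ => by ring

lemma sum_word_succ {N : ℕ} (F : BVec (N + 1) → ℝ) :
    ∑ z, F z = ∑ z : BVec N, F (Fin.cons 0 z) + ∑ z : BVec N, F (Fin.cons 1 z) := by
  rw [← (Fin.consEquiv fun _ : Fin (N + 1) => ZMod 2).sum_comp, Fintype.sum_prod_type]
  exact sum_zmod_two fun b => ∑ z : BVec N, F (Fin.cons b z)

lemma hammingNorm_cons_zero {N : ℕ} (z : BVec N) :
    hammingNorm (Fin.cons 0 z : BVec (N + 1)) = hammingNorm z := by
  rw [hammingNorm_eq_sum, hammingNorm_eq_sum, Fin.sum_univ_succ]; simp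

lemma hammingNorm_cons_one {N : ℕ} (z : BVec N) :
    hammingNorm (Fin.cons 1 z : BVec (N + 1)) = hammingNorm z + 1 := by
  rw [hammingNorm_eq_sum, hammingNorm_eq_sum, Fin.sum_univ_succ]; simp [add_comm]

/-- Recursion for expectations of functions of the weight. -/
lemma sum_bern_weight_succ (q : ℝ) (N : ℕ) (f : ℕ → ℝ) :
    ∑ z : BVec (N + 1), bern q z * f (hammingNorm z) =
      (1 - q) * ∑ z : BVec N, bern q z * f (hammingNorm z) +
        q * ∑ z : BVec N, bern q z * f (hammingNorm z + 1) := by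
  rw [sum_word_succ, Finset.mul_sum, Finset.mul_sum]
  simp only [hammingNorm_cons_zero, hammingNorm_cons_one, bern, Fin.prod_univ_succ, Fin.cons_zero,
    Fin.cons_succ]
  simp [mul_assoc]

lemma bern_mean (q : ℝ) (N : ℕ) :
    ∑ z : BVec N, bern q z * ((hammingNorm z : ℝ) - q * N) = 0 := by
  induction N with
  | zero => simp [hammingNorm]
  | succ N ih =>
    have h := sum_bern_weight_succ q N (fun k => (k : ℝ) - q * (N + 1 : ℕ))
    rw [h]
    have h1 : ∀ c : ℝ, ∑ z : BVec N, bern q z * (((hammingNorm z : ℝ) - q * N) + c) = c := by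
      intro c
      simp_rw [mul_add, Finset.sum_add_distrib, ih, ← Finset.sum_mul, sum_bern]; ring
    have e1 := h1 (-q)
    have e2 := h1 (1 - q)
    rw [show ∑ z : BVec N, bern q z * ((hammingNorm z : ℝ) - q * (N + 1 : ℕ)) = -q by
      rw [← e1]; refine Finset.sum_congr rfl fun z _ => ?_; push_cast; ring,
      show ∑ z : BVec N, bern q z * (((hammingNorm z + 1 : ℕ) : ℝ) - q * (N + 1 : ℕ)) = 1 - q by
      rw [← e2]; refine Finset.sum_congr rfl fun z _ => ?_; push_cast; ring]
    ring

lemma bern_variance (q : ℝ) (N : ℕ) :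
    ∑ z : BVec N, bern q z * ((hammingNorm z : ℝ) - q * N) ^ 2 = N * (q * (1 - q)) := by
  induction N with
  | zero => simp [hammingNorm]
  | succ N ih =>
    have h := sum_bern_weight_succ q N (fun k => ((k : ℝ) - q * (N + 1 : ℕ)) ^ 2)
    rw [h]
    have h1 : ∀ c : ℝ, ∑ z : BVec N, bern q z * (((hammingNorm z : ℝ) - q * N) + c) ^ 2 =
        N * (q * (1 - q)) + c ^ 2 := by
      intro c
      have : ∀ z : BVec N, bern q z * (((hammingNorm z : ℝ) - q * N) + c) ^ 2 =
        bern q z * ((hammingNorm z : ℝ) - q * N) ^ 2 +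
          2 * c * (bern q z * ((hammingNorm z : ℝ) - q * N)) + c ^ 2 * bern q z := fun z => by ring
      simp_rw [this, Finset.sum_add_distrib, ih, ← Finset.mul_sum, bern_mean, sum_bern]; ring
    have e1 := h1 (-q)
    have e2 := h1 (1 - q)
    rw [show ∑ z : BVec N, bern q z * ((hammingNorm z : ℝ) - q * (N + 1 : ℕ)) ^ 2 =
        N * (q * (1 - q)) + (-q) ^ 2 by
      rw [← e1]; refine Finset.sum_congr rfl fun z _ => ?_; push_cast; ring,
      show ∑ z : BVec N, bern q z * (((hammingNorm z + 1 : ℕ) : ℝ) - q * (N + 1 : ℕ)) ^ 2 =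
        N * (q * (1 - q)) + (1 - q) ^ 2 by
      rw [← e2]; refine Finset.sum_congr rfl fun z _ => ?_; push_cast; ring]
    push_cast
    ring

lemma bern_charFun (q t : ℝ) (N : ℕ) :
    ∑ z : BVec N, (bern q z : ℂ) * Complex.exp (t * hammingNorm z * Complex.I) =
      (1 - q + q * Complex.exp (t * Complex.I)) ^ N := by
  have h := sum_prod_word (N := N)
    (fun _ b => if b = 0 then (1 - q : ℂ) else q * Complex.exp (t * Complex.I))
  simp only [if_true, one_ne_zero, if_false, Finset.prod_const, Finset.card_univ,
    Fintype.card_fin] at h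
  rw [← h]
  refine Finset.sum_congr rfl fun z _ => ?_
  have : Complex.exp (t * hammingNorm z * Complex.I) =
      ∏ j, if z j = 0 then 1 else Complex.exp (t * Complex.I) := by
    rw [Finset.prod_ite, Finset.prod_const_one, one_mul, Finset.prod_const, ← Complex.exp_nat_mul]
    congr 1
    rw [show (Finset.univ.filter fun j => ¬ z j = 0).card = hammingNorm z from rfl]
    ring
  rw [this, bern, Complex.ofReal_prod, ← Finset.prod_mul_distrib]
  refine Finset.prod_congr rfl fun j _ => ?_
  split_ifs <;> simp

lemma bern_cos_le (q t : ℝ) (N : ℕ) :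
    ∑ z : BVec N, bern q z * Real.cos (t * ((hammingNorm z : ℝ) - q * N)) ≤
      ‖(1 - q + q * Complex.exp (t * Complex.I) : ℂ)‖ ^ N := by
  rw [← norm_pow, ← bern_charFun]
  have h : ∀ z : BVec N, bern q z * Real.cos (t * ((hammingNorm z : ℝ) - q * N)) =
      (Complex.exp ((-(t * q * N) : ℝ) * Complex.I) *
        ((bern q z : ℂ) * Complex.exp (t * hammingNorm z * Complex.I))).re := by
    intro z
    rw [mul_left_comm, ← Complex.exp_add, Complex.re_ofReal_mul, ← add_mul,
      show ((-(t * q * N) : ℝ) : ℂ) + t * hammingNorm z =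
        ((t * ((hammingNorm z : ℝ) - q * N) : ℝ) : ℂ) by push_cast; ring,
      Complex.exp_ofReal_mul_I_re]
  simp_rw [h]
  rw [← Complex.re_sum, ← Finset.mul_sum]
  refine (Complex.re_le_norm _).trans ?_
  rw [norm_mul, Complex.norm_exp_ofReal_mul_I, one_mul]

lemma norm_bernoulli_charFun_sq (q t : ℝ) :
    ‖(1 - q + q * Complex.exp (t * Complex.I) : ℂ)‖ ^ 2 =
      1 - 2 * (q * (1 - q)) * (1 - Real.cos t) := by
  rw [← Complex.normSq_eq_norm_sq, Complex.normSq_apply]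
  simp only [Complex.add_re, Complex.sub_re, Complex.one_re, Complex.ofReal_re,
    Complex.re_ofReal_mul, Complex.exp_ofReal_mul_I_re, Complex.add_im, Complex.sub_im,
    Complex.one_im, Complex.ofReal_im, Complex.im_ofReal_mul, Complex.exp_ofReal_mul_I_im]
  have := Real.sin_sq_add_cos_sq t
  linear_combination (q ^ 2) * this

lemma one_sub_cos_le_abs (y : ℝ) : 1 - Real.cos y ≤ |y| := by
  have h := Real.cos_two_mul (y / 2)
  rw [mul_div_cancel₀ y two_ne_zero] at h
  have h1 := Real.sin_sq_add_cos_sq (y / 2)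
  have h2 : |Real.sin (y / 2)| ≤ |y / 2| := Real.abs_sin_le_abs
  have h3 := Real.abs_sin_le_one (y / 2)
  have h4 : |y / 2| = |y| / 2 := by rw [abs_div]; norm_num
  have h5 := sq_abs (Real.sin (y / 2))
  nlinarith [abs_nonneg (Real.sin (y / 2))]

/-- The mean absolute deviation of a binomial variable is at least of order `√N`. -/
lemma bern_abs_deviation {q : ℝ} (h0 : 0 < q) (h1 : q < 1) :
    ∃ κ : ℝ, 0 < κ ∧ ∀ N : ℕ, 1 ≤ N →
      κ * √N ≤ ∑ z : BVec N, bern q z * |(hammingNorm z : ℝ) - q * N| := by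
  set a : ℝ := 2 * (q * (1 - q)) * (2 / Real.pi ^ 2) with ha
  have hq : 0 < q * (1 - q) := mul_pos h0 (by linarith)
  have hapos : 0 < a := by positivity
  refine ⟨1 - Real.exp (-a / 2), by
    have : Real.exp (-a / 2) < 1 := Real.exp_zero ▸ Real.exp_lt_exp.mpr (by linarith)
    linarith, fun N hN => ?_⟩
  have hN' : (1 : ℝ) ≤ N := by exact_mod_cast hN
  have hs : 1 ≤ √(N : ℝ) := Real.one_le_sqrt.mpr hN'
  have hspos : 0 < √(N : ℝ) := by linarith
  set t : ℝ := 1 / √(N : ℝ) with ht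
  have htpos : 0 < t := by positivity
  have ht1 : t ≤ 1 := by rw [ht, div_le_one hspos]; exact hs
  have ht2 : t ^ 2 = 1 / N := by rw [ht, div_pow, Real.sq_sqrt (by linarith), one_pow]
  have hcos : Real.cos t ≤ 1 - 2 / Real.pi ^ 2 * t ^ 2 :=
    Real.cos_le_one_sub_mul_cos_sq (by
      rw [abs_of_pos htpos]; linarith [Real.pi_gt_three])
  set φ : ℝ := ‖(1 - q + q * Complex.exp (t * Complex.I) : ℂ)‖ with hφ
  have hφ2 : φ ^ 2 ≤ Real.exp (-(a / N)) := by
    rw [hφ, norm_bernoulli_charFun_sq]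
    have : a / N ≤ 2 * (q * (1 - q)) * (1 - Real.cos t) := by
      calc a / N = 2 * (q * (1 - q)) * (2 / Real.pi ^ 2 * t ^ 2) := by rw [ha, ht2]; ring
        _ ≤ _ := by gcongr; linarith
    have := Real.add_one_le_exp (-(a / N))
    linarith
  have hφN : φ ^ N ≤ Real.exp (-a / 2) := by
    have : (φ ^ N) ^ 2 ≤ Real.exp (-a / 2) ^ 2 := by
      rw [← pow_mul, mul_comm, pow_mul]
      calc (φ ^ 2) ^ N ≤ Real.exp (-(a / N)) ^ N := by gcongr
        _ = Real.exp (-a / 2) ^ 2 := by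
          rw [← Real.exp_nat_mul, ← Real.exp_nat_mul]
          congr 1
          field_simp
          norm_num
    exact le_of_sq_le_sq this (Real.exp_pos _).le
  have hle := (bern_cos_le q t N).trans hφN
  have hsum : 1 - ∑ z : BVec N, bern q z * Real.cos (t * ((hammingNorm z : ℝ) - q * N)) ≤
      t * ∑ z : BVec N, bern q z * |(hammingNorm z : ℝ) - q * N| := by
    rw [← sum_bern q N, ← Finset.sum_sub_distrib, Finset.mul_sum]
    refine Finset.sum_le_sum fun z _ => ?_
    have := one_sub_cos_le_abs (t * ((hammingNorm z : ℝ) - q * N))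
    rw [abs_mul, abs_of_pos htpos] at this
    have hb := bern_nonneg h0.le h1.le z
    nlinarith
  have h3 : 1 - Real.exp (-a / 2) ≤
      t * ∑ z : BVec N, bern q z * |(hammingNorm z : ℝ) - q * N| := by linarith
  calc (1 - Real.exp (-a / 2)) * √N
      ≤ (t * ∑ z : BVec N, bern q z * |(hammingNorm z : ℝ) - q * N|) * √N := by gcongr
    _ = _ := by rw [ht]; field_simp

/-- A binomial variable exceeds its mean with probability bounded away from zero. -/
lemma bern_tail {q : ℝ} (h0 : 0 < q) (h1 : q < 1) :
    ∃ c : ℝ, 0 < c ∧ ∀ N : ℕ, 1 ≤ N →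
      c ≤ ∑ z : BVec N, bern q z * (if q * N ≤ hammingNorm z then 1 else 0) := by
  obtain ⟨κ, hκ, hdev⟩ := bern_abs_deviation h0 h1
  have hq : 0 < q * (1 - q) := mul_pos h0 (by linarith)
  refine ⟨(κ / 2) ^ 2 / (q * (1 - q)), by positivity, fun N hN => ?_⟩
  have hN' : (0 : ℝ) < N := by exact_mod_cast hN
  set X : BVec N → ℝ := fun z => (hammingNorm z : ℝ) - q * N with hX
  have hpos : ∑ z : BVec N, bern q z * max (X z) 0 = (∑ z : BVec N, bern q z * |X z|) / 2 := by
    have h2 : ∀ z : BVec N, bern q z * max (X z) 0 =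
        (bern q z * |X z|) / 2 + (bern q z * X z) / 2 := by
      intro z
      have : max (X z) 0 = (|X z| + X z) / 2 := by
        rcases le_total 0 (X z) with h | h
        · rw [max_eq_left h, abs_of_nonneg h]; ring
        · rw [max_eq_right h, abs_of_nonpos h]; ring
      rw [this]; ring
    simp_rw [h2, Finset.sum_add_distrib, ← Finset.sum_div]
    rw [show ∑ z : BVec N, bern q z * X z = 0 from bern_mean q N]
    ring
  have hcs := Finset.sum_sq_le_sum_mul_sum_of_sq_le_mul (Finset.univ : Finset (BVec N))
    (r := fun z => bern q z * max (X z) 0)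
    (f := fun z => bern q z * (if q * N ≤ hammingNorm z then (1 : ℝ) else 0))
    (g := fun z => bern q z * X z ^ 2)
    (fun z _ => mul_nonneg (bern_nonneg h0.le h1.le z) (by split_ifs <;> norm_num))
    (fun z _ => mul_nonneg (bern_nonneg h0.le h1.le z) (sq_nonneg _))
    (fun z _ => le_of_eq <| by
      by_cases h : q * N ≤ hammingNorm z
      · rw [if_pos h, max_eq_left (by simp only [hX]; linarith)]; ring
      · rw [if_neg h, max_eq_right (by simp only [hX]; linarith)]; ring)
  rw [hpos, show ∑ z : BVec N, bern q z * X z ^ 2 = _ from bern_variance q N] at hcs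
  have h5 := hdev N hN
  have h6 : (κ / 2) ^ 2 * N ≤ ((∑ z : BVec N, bern q z * |X z|) / 2) ^ 2 := by
    have : (κ / 2) ^ 2 * N = (κ * √N / 2) ^ 2 := by
      rw [div_pow, div_pow, mul_pow, Real.sq_sqrt hN'.le]; ring
    rw [this]
    gcongr
  rw [div_le_iff₀ hq]
  have h7 := h6.trans hcs
  have : (κ / 2) ^ 2 * N ≤ ((∑ z : BVec N, bern q z * (if q * N ≤ hammingNorm z then 1 else 0)) *
    (q * (1 - q))) * N := by linarith
  exact le_of_mul_le_mul_right this hN'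

/-! ### Averages over words of fixed weight -/

lemma hammingNorm_add_single {N : ℕ} {z : BVec N} {i : Fin N} (h : z i = 0) :
    hammingNorm (z + Pi.single i 1) = hammingNorm z + 1 := by
  rw [hammingNorm_eq_sum, hammingNorm_eq_sum, ← Finset.add_sum_erase _ _ (Finset.mem_univ i),
    ← Finset.add_sum_erase Finset.univ (fun j => if z j = 0 then 0 else 1) (Finset.mem_univ i)]
  have : ∀ j ∈ Finset.univ.erase i, (if (z + Pi.single i 1 : BVec N) j = 0 then 0 else 1) =
      if z j = 0 then 0 else 1 := by
    intro j hj
    rw [Pi.add_apply, Pi.single_eq_of_ne (Finset.ne_of_mem_erase hj), add_zero]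
  rw [Finset.sum_congr rfl this]
  simp [h, add_comm]

lemma add_single_add_single {N : ℕ} (z : BVec N) (i : Fin N) :
    z + Pi.single i 1 + Pi.single i 1 = z := by
  rw [add_assoc, ZModModule.add_self, add_zero]

lemma sum_flip_pairs {N : ℕ} (j : ℕ) (F : BVec N → Fin N → ℝ) :
    ∑ z : BVec N, ∑ i, (if hammingNorm z = j + 1 ∧ z i ≠ 0 then F z i else 0) =
      ∑ y : BVec N, ∑ i, (if hammingNorm y = j ∧ y i = 0 then F (y + Pi.single i 1) i else 0) := by
  rw [Finset.sum_comm, Finset.sum_comm (s := Finset.univ (α := BVec N))]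
  refine Finset.sum_congr rfl fun i _ => ?_
  refine Fintype.sum_equiv (Equiv.addRight (Pi.single i 1)) _ _ fun z => ?_
  simp only [Equiv.coe_addRight, add_single_add_single]
  have hz : (z + Pi.single i 1 : BVec N) i = z i + 1 := by simp
  refine if_congr ?_ rfl rfl
  by_cases h : z i = 0
  · simp [h]
  · have h1 : z i = 1 := zmod_two_eq_one h
    have h2 : (z + Pi.single i 1 : BVec N) i = 0 := by rw [hz, h1]; decide
    have h3 := hammingNorm_add_single h2
    rw [add_single_add_single] at h3
    rw [h3]
    simp [h, h2]

/-- The sum of `F` over the words of weight `j`. -/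
def levelSum {N : ℕ} (F : BVec N → ℝ) (j : ℕ) : ℝ :=
  ∑ z : BVec N, if hammingNorm z = j then F z else 0

/-- Functions that increase when a bit is switched on. -/
def BitMono {N : ℕ} (F : BVec N → ℝ) : Prop :=
  ∀ (z : BVec N) (i : Fin N), z i = 0 → F z ≤ F (z + Pi.single i 1)

lemma levelSum_eq_flip {N : ℕ} (F : BVec N → ℝ) (j : ℕ) :
    ((j + 1 : ℕ) : ℝ) * levelSum F (j + 1) =
      ∑ y : BVec N, ∑ i, (if hammingNorm y = j ∧ y i = 0 then F (y + Pi.single i 1) else 0) := by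
  rw [← sum_flip_pairs j (fun z _ => F z), levelSum, Finset.mul_sum]
  refine Finset.sum_congr rfl fun z _ => ?_
  by_cases h : hammingNorm z = j + 1
  · simp only [h, true_and, if_true]
    rw [← Finset.sum_filter, Finset.sum_const, nsmul_eq_mul]
    rw [show (Finset.univ.filter fun i => z i ≠ 0).card = j + 1 from h]
  · simp [h]

lemma levelSum_eq_flip' {N : ℕ} (F : BVec N → ℝ) (j : ℕ) :
    ((N : ℝ) - j) * levelSum F j =
      ∑ y : BVec N, ∑ i, (if hammingNorm y = j ∧ y i = 0 then F y else 0) := by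
  rw [levelSum, Finset.mul_sum]
  refine Finset.sum_congr rfl fun z _ => ?_
  by_cases h : hammingNorm z = j
  · simp only [h, true_and, if_true]
    rw [← Finset.sum_filter, Finset.sum_const, nsmul_eq_mul]
    have := Finset.card_filter_add_card_filter_not (s := (Finset.univ : Finset (Fin N)))
      (fun i => z i = 0)
    rw [show (Finset.univ.filter fun i => ¬ z i = 0).card = j from h] at this
    simp only [Finset.card_univ, Fintype.card_fin] at this
    have h2 : ((Finset.univ.filter fun i => z i = 0).card : ℝ) + j = N := by exact_mod_cast this
    rw [← h2]; ring
  · simp [h]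

/-- Number of words of weight `j`. -/
def levelCard (N j : ℕ) : ℝ := levelSum (N := N) (fun _ => 1) j

lemma levelCard_succ (N j : ℕ) :
    ((j + 1 : ℕ) : ℝ) * levelCard N (j + 1) = ((N : ℝ) - j) * levelCard N j := by
  rw [levelCard, levelCard, levelSum_eq_flip, levelSum_eq_flip']

lemma levelCard_nonneg (N j : ℕ) : 0 ≤ levelCard N j :=
  Finset.sum_nonneg fun z _ => by split_ifs <;> norm_num

lemma BitMono.levelSum_succ {N : ℕ} {F : BVec N → ℝ} (hF : BitMono F) (j : ℕ) :
    ((N : ℝ) - j) * levelSum F j ≤ ((j + 1 : ℕ) : ℝ) * levelSum F (j + 1) := by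
  rw [levelSum_eq_flip, levelSum_eq_flip']
  refine Finset.sum_le_sum fun y _ => Finset.sum_le_sum fun i _ => ?_
  split_ifs with h
  · exact hF y i h.2
  · exact le_rfl

lemma BitMono.levelSum_mul_le {N : ℕ} {F : BVec N → ℝ} (hF : BitMono F) {j j' : ℕ}
    (hjj : j ≤ j') (hj : j' ≤ N) :
    levelSum F j * levelCard N j' ≤ levelSum F j' * levelCard N j := by
  induction j', hjj using Nat.le_induction with
  | base => exact le_rfl
  | succ k hk ih =>
    have ih := ih (by omega)
    have h1 := hF.levelSum_succ k
    have h2 := levelCard_succ N k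
    have h3 := levelCard_nonneg N j
    have h4 : (0 : ℝ) ≤ (N : ℝ) - k := by
      have : (k : ℝ) ≤ N := by exact_mod_cast (by omega : k ≤ N)
      linarith
    have hk1 : (0 : ℝ) < ((k + 1 : ℕ) : ℝ) := by positivity
    refine le_of_mul_le_mul_left ?_ hk1
    calc ((k + 1 : ℕ) : ℝ) * (levelSum F j * levelCard N (k + 1))
        = ((N : ℝ) - k) * (levelSum F j * levelCard N k) := by
          rw [mul_left_comm, h2]; ring
      _ ≤ ((N : ℝ) - k) * (levelSum F k * levelCard N j) := by gcongr
      _ = (((N : ℝ) - k) * levelSum F k) * levelCard N j := by ring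
      _ ≤ (((k + 1 : ℕ) : ℝ) * levelSum F (k + 1)) * levelCard N j := by gcongr
      _ = _ := by ring

lemma sum_eq_sum_levelSum {N : ℕ} (f : ℕ → ℝ) (F : BVec N → ℝ) :
    ∑ z : BVec N, f (hammingNorm z) * F z = ∑ j ∈ Finset.range (N + 1), f j * levelSum F j := by
  simp_rw [levelSum, Finset.mul_sum]
  rw [Finset.sum_comm]
  refine Finset.sum_congr rfl fun z _ => ?_
  rw [Finset.sum_eq_single (hammingNorm z)]
  · simp
  · intro j _ hj; simp [hj.symm]
  · intro h
    exact absurd (Finset.mem_range.mpr (Nat.lt_succ_of_le (hammingNorm_le z))) h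

/-- If a bit-monotone function has a small mean under Bernoulli(`q`) noise, then it has small
averages over the words of each weight at most `q N`. -/
lemma BitMono.levelSum_le_of_mean {N : ℕ} {H : BVec N → ℝ} (hH : BitMono H)
    (hnn : ∀ z, 0 ≤ H z) {q : ℝ} (h0 : 0 ≤ q) (h1 : q ≤ 1) {c e : ℝ} (hc : 0 < c)
    (htail : c ≤ ∑ z : BVec N, bern q z * (if q * N ≤ hammingNorm z then 1 else 0))
    (hmean : ∑ z : BVec N, bern q z * H z ≤ e) {j : ℕ} (hj : (j : ℝ) ≤ q * N) :
    levelSum H j ≤ e / c * levelCard N j := by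
  set f : ℕ → ℝ := fun k => if q * N ≤ k then q ^ k * (1 - q) ^ (N - k) else 0 with hf
  have hfnn : ∀ k, 0 ≤ f k := fun k => by
    simp only [hf]; split_ifs
    · have : 0 ≤ 1 - q := by linarith
      positivity
    · exact le_rfl
  have hT : c ≤ ∑ k ∈ Finset.range (N + 1), f k * levelCard N k := by
    simp only [levelCard]
    rw [← sum_eq_sum_levelSum]
    refine htail.trans (le_of_eq (Finset.sum_congr rfl fun z _ => ?_))
    simp only [hf, bern_eq]; split_ifs <;> ring
  have hM : ∑ k ∈ Finset.range (N + 1), f k * levelSum H k ≤ e := by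
    rw [← sum_eq_sum_levelSum]
    refine le_trans (Finset.sum_le_sum fun z _ => ?_) hmean
    have hb := bern_nonneg h0 h1 z
    rw [bern_eq] at hb ⊢
    simp only [hf]; split_ifs
    · exact le_rfl
    · rw [zero_mul]; exact mul_nonneg hb (hnn z)
  have hS : 0 ≤ levelSum H j := Finset.sum_nonneg fun z _ => by
    split_ifs
    exacts [hnn z, le_rfl]
  rw [div_mul_eq_mul_div, le_div_iff₀ hc]
  calc levelSum H j * c ≤ levelSum H j * ∑ k ∈ Finset.range (N + 1), f k * levelCard N k := by
        gcongr
    _ = ∑ k ∈ Finset.range (N + 1), f k * (levelSum H j * levelCard N k) := by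
        rw [Finset.mul_sum]; exact Finset.sum_congr rfl fun k _ => by ring
    _ ≤ ∑ k ∈ Finset.range (N + 1), f k * (levelSum H k * levelCard N j) := by
        refine Finset.sum_le_sum fun k hk => ?_
        by_cases hqk : q * N ≤ k
        · have hjk : j ≤ k := by exact_mod_cast hj.trans hqk
          have := hH.levelSum_mul_le hjk (Nat.lt_succ_iff.mp (Finset.mem_range.mp hk))
          exact mul_le_mul_of_nonneg_left this (hfnn k)
        · simp [hf, hqk]
    _ = (∑ k ∈ Finset.range (N + 1), f k * levelSum H k) * levelCard N j := by
        rw [Finset.sum_mul]; exact Finset.sum_congr rfl fun k _ => by ring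
    _ ≤ e * levelCard N j := by
        gcongr
        exact levelCard_nonneg N j

/-! ### Hamming balls -/

/-- The sum of `F` over the words of weight at most `r`. -/
def ballSum {N : ℕ} (F : BVec N → ℝ) (r : ℕ) : ℝ :=
  ∑ z : BVec N, if hammingNorm z ≤ r then F z else 0

/-- The volume of a Hamming ball of radius `r`. -/
def ballCard (N r : ℕ) : ℝ := ballSum (N := N) (fun _ => 1) r

lemma ballSum_zero {N : ℕ} (F : BVec N → ℝ) : ballSum F 0 = levelSum F 0 := by
  simp [ballSum, levelSum]

lemma ballSum_succ {N : ℕ} (F : BVec N → ℝ) (r : ℕ) :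
    ballSum F (r + 1) = ballSum F r + levelSum F (r + 1) := by
  rw [ballSum, ballSum, levelSum, ← Finset.sum_add_distrib]
  refine Finset.sum_congr rfl fun z _ => ?_
  rcases lt_trichotomy (hammingNorm z) (r + 1) with h | h | h
  · rw [if_pos h.le, if_pos (Nat.lt_succ_iff.mp h), if_neg h.ne, add_zero]
  · rw [if_pos h.le, if_neg (by omega), if_pos h, zero_add]
  · rw [if_neg (by omega), if_neg (by omega), if_neg (by omega), zero_add]

lemma ballSum_le_of_level {N : ℕ} {F : BVec N → ℝ} {η : ℝ} {r : ℕ}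
    (h : ∀ j ≤ r, levelSum F j ≤ η * levelCard N j) : ballSum F r ≤ η * ballCard N r := by
  induction r with
  | zero => simpa [ballCard, ballSum_zero, levelCard] using h 0 le_rfl
  | succ r ih =>
    rw [ballCard, ballSum_succ, ballSum_succ, mul_add]
    exact add_le_add (ih fun j hj => h j (by omega)) (h (r + 1) le_rfl)

lemma ballCard_nonneg (N r : ℕ) : 0 ≤ ballCard N r :=
  Finset.sum_nonneg fun z _ => by split_ifs <;> norm_num

lemma ballCard_succ (N r : ℕ) : ballCard N (r + 1) = ballCard N r + levelCard N (r + 1) :=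
  ballSum_succ _ r

lemma ballCard_mono (N : ℕ) : Monotone (ballCard N) :=
  monotone_nat_of_le_succ fun r => by
    rw [ballCard_succ]; linarith [levelCard_nonneg N (r + 1)]

lemma levelCard_le_ballCard (N r : ℕ) : levelCard N r ≤ ballCard N r := by
  cases r with
  | zero => exact (ballSum_zero (N := N) _).ge
  | succ r => rw [ballCard_succ]; linarith [ballCard_nonneg N r]

lemma one_le_ballCard (N r : ℕ) : 1 ≤ ballCard N r := by
  refine le_trans ?_ (ballCard_mono N (Nat.zero_le r))
  rw [ballCard, ballSum]
  refine le_trans ?_ (Finset.single_le_sum (fun z _ => ?_) (Finset.mem_univ (0 : BVec N)))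
  · simp
  · split_ifs <;> norm_num

lemma card_word (N : ℕ) : Fintype.card (BVec N) = 2 ^ N := by
  simp [BVec, ZMod.card]

lemma ballCard_le (N r : ℕ) : ballCard N r ≤ 2 ^ N := by
  calc ballCard N r ≤ ∑ z : BVec N, (1 : ℝ) :=
        Finset.sum_le_sum fun z _ => by split_ifs <;> norm_num
    _ = 2 ^ N := by simp

lemma ballCard_succ_le {N r : ℕ} {x : ℝ} (hx : 0 < x) (hr : x * N ≤ r + 1) :
    ballCard N (r + 1) ≤ (1 + 1 / x) * ballCard N r := by
  have h := levelCard_succ N r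
  have h1 : x * levelCard N (r + 1) ≤ levelCard N r := by
    rcases Nat.eq_zero_or_pos N with hN | hN
    · have : levelCard N (r + 1) = 0 := by
        refine Finset.sum_eq_zero fun z _ => if_neg ?_
        have := hammingNorm_le z
        omega
      rw [this, mul_zero]; exact levelCard_nonneg _ _
    have hN' : (0 : ℝ) < N := by exact_mod_cast hN
    refine le_of_mul_le_mul_left ?_ hN'
    calc (N : ℝ) * (x * levelCard N (r + 1)) = (x * N) * levelCard N (r + 1) := by ring
      _ ≤ ((r + 1 : ℕ) : ℝ) * levelCard N (r + 1) := by
        push_cast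
        exact mul_le_mul_of_nonneg_right hr (levelCard_nonneg _ _)
      _ = ((N : ℝ) - r) * levelCard N r := h
      _ ≤ N * levelCard N r := by
        refine mul_le_mul_of_nonneg_right ?_ (levelCard_nonneg _ _)
        have : (0 : ℝ) ≤ r := by positivity
        linarith
  have h2 : levelCard N (r + 1) ≤ 1 / x * ballCard N r := by
    rw [one_div, ← div_eq_inv_mul, le_div_iff₀ hx, mul_comm]
    exact h1.trans (levelCard_le_ballCard N r)
  rw [ballCard_succ]; linarith

/-! ### Coset leaders -/

/-- A weight on words that refines the Hamming weight and separates words. -/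
def fineWeight {N : ℕ} (z : BVec N) : ℕ := ∑ i : Fin N, if z i = 0 then 0 else 2 ^ N + 2 ^ (i : ℕ)

lemma binary_value_eq {N : ℕ} (z : BVec N) :
    (∑ i : Fin N, if z i = 0 then 0 else 2 ^ (i : ℕ)) =
      ∑ k ∈ (Finset.univ.filter fun i => z i ≠ 0).map Fin.valEmbedding, 2 ^ k := by
  rw [Finset.sum_map, Finset.sum_filter]
  exact Finset.sum_congr rfl fun i _ => by by_cases h : z i = 0 <;> simp [h]

lemma binary_value_lt {N : ℕ} (z : BVec N) :
    (∑ i : Fin N, if z i = 0 then 0 else 2 ^ (i : ℕ)) < 2 ^ N := by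
  rw [binary_value_eq]
  refine Nat.geomSum_lt le_rfl fun k hk => ?_
  obtain ⟨i, -, rfl⟩ := Finset.mem_map.mp hk
  exact i.2

lemma fineWeight_eq {N : ℕ} (z : BVec N) :
    fineWeight z = 2 ^ N * hammingNorm z + ∑ i : Fin N, if z i = 0 then 0 else 2 ^ (i : ℕ) := by
  rw [fineWeight, hammingNorm_eq_sum, Finset.mul_sum, ← Finset.sum_add_distrib]
  exact Finset.sum_congr rfl fun i _ => by split_ifs <;> simp

lemma fineWeight_injective {N : ℕ} : Function.Injective (fineWeight (N := N)) := by
  intro z z' h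
  rw [fineWeight_eq, fineWeight_eq] at h
  have h1 := congrArg (· % 2 ^ N) h
  simp only [Nat.mul_add_mod, Nat.mod_eq_of_lt (binary_value_lt _)] at h1
  rw [binary_value_eq, binary_value_eq] at h1
  have h2 := Finset.map_injective _ (Finset.geomSum_injective le_rfl h1)
  funext i
  have h3 : (z i ≠ 0) ↔ (z' i ≠ 0) := by
    simpa using Finset.ext_iff.mp h2 i
  by_cases h : z i = 0
  · rw [h]; by_contra h4; exact h3.mpr (Ne.symm h4) h
  · rw [zmod_two_eq_one h, zmod_two_eq_one (h3.mp h)]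

lemma hammingNorm_le_of_fineWeight {N : ℕ} {z z' : BVec N} (h : fineWeight z ≤ fineWeight z') :
    hammingNorm z ≤ hammingNorm z' := by
  rw [fineWeight_eq, fineWeight_eq] at h
  have h1 := binary_value_lt z'
  by_contra hlt
  have : 2 ^ N * (hammingNorm z' + 1) ≤ 2 ^ N * hammingNorm z := Nat.mul_le_mul_left _ (by omega)
  rw [mul_add, mul_one] at this
  omega

lemma fineWeight_add_single {N : ℕ} {z : BVec N} {i : Fin N} (h : z i = 0) :
    fineWeight (z + Pi.single i 1) = fineWeight z + (2 ^ N + 2 ^ (i : ℕ)) := by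
  rw [fineWeight, fineWeight, ← Finset.add_sum_erase _ _ (Finset.mem_univ i),
    ← Finset.add_sum_erase Finset.univ (fun j => if z j = 0 then 0 else 2 ^ N + 2 ^ (j : ℕ))
      (Finset.mem_univ i)]
  have : ∀ j ∈ Finset.univ.erase i,
      (if (z + Pi.single i 1 : BVec N) j = 0 then 0 else 2 ^ N + 2 ^ (j : ℕ)) =
      if z j = 0 then 0 else 2 ^ N + 2 ^ (j : ℕ) := by
    intro j hj
    rw [Pi.add_apply, Pi.single_eq_of_ne (Finset.ne_of_mem_erase hj), add_zero]
  rw [Finset.sum_congr rfl this]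
  simp [h]
  omega

lemma fineWeight_add_single_le {N : ℕ} (z : BVec N) (i : Fin N) :
    fineWeight (z + Pi.single i 1) ≤ fineWeight z + (2 ^ N + 2 ^ (i : ℕ)) := by
  by_cases h : z i = 0
  · exact (fineWeight_add_single h).le
  · have h2 : (z + Pi.single i 1 : BVec N) i = 0 := by
      rw [Pi.add_apply, Pi.single_eq_same, zmod_two_eq_one h]; decide
    have h3 := fineWeight_add_single h2
    rw [add_single_add_single] at h3
    rw [h3]
    exact le_trans (Nat.le_add_right _ _) (Nat.le_add_right _ _)

/-- `z` is the lightest word of its coset of `C`. -/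
def IsLeader {N : ℕ} (C : Submodule (ZMod 2) (BVec N)) (z : BVec N) : Prop :=
  ∀ c ∈ C, c ≠ 0 → fineWeight z < fineWeight (z + c)

lemma IsLeader.eq {N : ℕ} {C : Submodule (ZMod 2) (BVec N)} {z c : BVec N} (hz : IsLeader C z)
    (hc : c ∈ C) (hzc : IsLeader C (z + c)) : c = 0 := by
  by_contra h
  have h1 := hz c hc h
  have h2 := hzc c hc h
  rw [add_assoc, ZModModule.add_self, add_zero] at h2
  omega

lemma exists_isLeader {N : ℕ} (C : Submodule (ZMod 2) (BVec N)) (y : BVec N) :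
    ∃ c ∈ C, IsLeader C (y + c) := by
  classical
  obtain ⟨c, hc, hmin⟩ := Finset.exists_min_image (Finset.univ.filter fun c => c ∈ C)
    (fun c => fineWeight (y + c)) ⟨0, by simp⟩
  simp only [Finset.mem_filter, Finset.mem_univ, true_and] at hc hmin
  refine ⟨c, hc, fun c' hc' hne => ?_⟩
  have h1 := hmin (c + c') (C.add_mem hc hc')
  rw [← add_assoc] at h1
  refine lt_of_le_of_ne h1 fun h => hne ?_
  simpa using fineWeight_injective h

lemma IsLeader.of_add_single {N : ℕ} {C : Submodule (ZMod 2) (BVec N)} {z : BVec N} {i : Fin N}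
    (hz : z i = 0) (h : IsLeader C (z + Pi.single i 1)) : IsLeader C z := by
  intro c hc hne
  have h1 := h c hc hne
  rw [fineWeight_add_single hz, add_right_comm] at h1
  have h2 := fineWeight_add_single_le (z + c) i
  omega

/-- The minimum distance decoder. -/
def leaderDecoder {N : ℕ} (C : Submodule (ZMod 2) (BVec N)) (y : BVec N) : BVec N :=
  (exists_isLeader C y).choose

lemma leaderDecoder_mem {N : ℕ} (C : Submodule (ZMod 2) (BVec N)) (y : BVec N) :
    leaderDecoder C y ∈ C := (exists_isLeader C y).choose_spec.1

lemma isLeader_add_leaderDecoder {N : ℕ} (C : Submodule (ZMod 2) (BVec N)) (y : BVec N) :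
    IsLeader C (y + leaderDecoder C y) := (exists_isLeader C y).choose_spec.2

lemma leaderDecoder_eq_iff {N : ℕ} {C : Submodule (ZMod 2) (BVec N)} {c : BVec N} (hc : c ∈ C)
    (z : BVec N) : leaderDecoder C (c + z) = c ↔ IsLeader C z := by
  have h1 := isLeader_add_leaderDecoder C (c + z)
  constructor
  · intro h
    rw [h, add_right_comm, ZModModule.add_self, zero_add] at h1
    exact h1
  · intro h
    have h2 : c + z + leaderDecoder C (c + z) = z + (c + leaderDecoder C (c + z)) := by abel
    rw [h2] at h1
    have h3 := h.eq (C.add_mem hc (leaderDecoder_mem C _)) h1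
    rw [← ZModModule.sub_eq_add, sub_eq_zero] at h3
    exact h3.symm

lemma fineWeight_leader_le {N : ℕ} {C : Submodule (ZMod 2) (BVec N)} {c : BVec N} (hc : c ∈ C)
    (y : BVec N) : fineWeight (y + leaderDecoder C y) ≤ fineWeight (y + c) := by
  have h := isLeader_add_leaderDecoder C y (leaderDecoder C y + c)
    (C.add_mem (leaderDecoder_mem C y) hc)
  rw [add_assoc y, ← add_assoc (leaderDecoder C y), ZModModule.add_self, zero_add] at h
  by_cases hne : leaderDecoder C y + c = 0
  · rw [← ZModModule.sub_eq_add, sub_eq_zero] at hne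
    rw [hne]
  · exact (h hne).le

lemma bern_anti {q : ℝ} (h0 : 0 ≤ q) (h1 : q ≤ 1 / 2) {N : ℕ} {z z' : BVec N}
    (h : hammingNorm z ≤ hammingNorm z') : bern q z' ≤ bern q z := by
  rw [bern_eq, bern_eq]
  have h2 := hammingNorm_le z'
  set a := hammingNorm z
  set b := hammingNorm z'
  have hq : 0 ≤ 1 - q := by linarith
  calc q ^ b * (1 - q) ^ (N - b) = q ^ a * (q ^ (b - a) * (1 - q) ^ (N - b)) := by
        rw [← mul_assoc, ← pow_add]; congr 2; omega
    _ ≤ q ^ a * ((1 - q) ^ (b - a) * (1 - q) ^ (N - b)) := by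
        gcongr; linarith
    _ = q ^ a * (1 - q) ^ (N - a) := by rw [← pow_add]; congr 2; omega

lemma sum_add_left {N : ℕ} (c : BVec N) (F : BVec N → ℝ) :
    ∑ z : BVec N, F (c + z) = ∑ y : BVec N, F y := Equiv.sum_comp (Equiv.addLeft c) F

open Classical in
/-- Summation over all words, grouped by cosets. -/
lemma sum_add_leaderDecoder {N : ℕ} (C : Submodule (ZMod 2) (BVec N)) (f : BVec N → ℝ) :
    ∑ y : BVec N, f (y + leaderDecoder C y) =
      Nat.card C * ∑ z : BVec N, f z * (if IsLeader C z then 1 else 0) := by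
  calc ∑ y : BVec N, f (y + leaderDecoder C y)
      = ∑ y : BVec N, ∑ c : C,
          f (y + (c : BVec N)) * (if leaderDecoder C y = c then 1 else 0) := by
        refine Finset.sum_congr rfl fun y _ => ?_
        rw [Finset.sum_eq_single ⟨leaderDecoder C y, leaderDecoder_mem C y⟩]
        · simp
        · intro c _ hc
          rw [if_neg, mul_zero]
          intro h; exact hc (Subtype.ext h.symm)
        · simp
    _ = ∑ c : C, ∑ z : BVec N, f z * (if IsLeader C z then 1 else 0) := by
        rw [Finset.sum_comm]
        refine Finset.sum_congr rfl fun c _ => ?_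
        rw [← sum_add_left c]
        refine Finset.sum_congr rfl fun z _ => ?_
        simp only [leaderDecoder_eq_iff c.2]
        rw [add_right_comm, ZModModule.add_self, zero_add]
    _ = _ := by
        rw [Finset.sum_const, Finset.card_univ, nsmul_eq_mul, Nat.card_eq_fintype_card]

open Classical in
/-- No decoder beats the coset leaders. -/
lemma sum_bern_not_isLeader_le {q : ℝ} (h0 : 0 ≤ q) (h1 : q ≤ 1 / 2) {N : ℕ}
    (C : Submodule (ZMod 2) (BVec N)) (dec : BVec N → BVec N) :
    ∑ z : BVec N, bern q z * (if IsLeader C z then 0 else 1) ≤ bscError q C dec := by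
  have hcard : (0 : ℝ) < Nat.card C := by exact_mod_cast Nat.card_pos
  have hcor : ∑ c : C, ∑ z : BVec N, bern q z * (if dec (c + z) = c then 1 else 0) ≤
      ∑ y : BVec N, bern q (y + leaderDecoder C y) := by
    calc ∑ c : C, ∑ z : BVec N, bern q z * (if dec (c + z) = c then 1 else 0)
        = ∑ c : C, ∑ y : BVec N, bern q (y + (c : BVec N)) * (if dec y = c then 1 else 0) := by
          refine Finset.sum_congr rfl fun c _ => ?_
          rw [← sum_add_left (c : BVec N) fun y =>
            bern q (y + (c : BVec N)) * (if dec y = c then 1 else 0)]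
          refine Finset.sum_congr rfl fun z _ => ?_
          rw [add_right_comm, ZModModule.add_self, zero_add]
      _ = ∑ y : BVec N, ∑ c : C, bern q (y + (c : BVec N)) * (if dec y = c then 1 else 0) :=
          Finset.sum_comm
      _ ≤ _ := by
          refine Finset.sum_le_sum fun y _ => ?_
          by_cases hy : dec y ∈ C
          · rw [Finset.sum_eq_single ⟨dec y, hy⟩]
            · simp only [if_true, mul_one]
              exact bern_anti h0 h1 (hammingNorm_le_of_fineWeight (fineWeight_leader_le hy y))
            · intro c _ hc
              rw [if_neg, mul_zero]
              intro h; exact hc (Subtype.ext h.symm)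
            · simp
          · rw [Finset.sum_eq_zero]
            · exact bern_nonneg h0 (by linarith) _
            · intro c _
              rw [if_neg, mul_zero]
              intro h; exact hy (h ▸ c.2)
  have hlead := sum_add_leaderDecoder C (bern q)
  have hsplit : ∀ (P : BVec N → Prop) [DecidablePred P], ∑ z : BVec N, bern q z * (if P z then 0 else 1) =
      1 - ∑ z : BVec N, bern q z * (if P z then 1 else 0) := by
    intro P _
    rw [eq_sub_iff_add_eq, ← Finset.sum_add_distrib]
    refine Eq.trans ?_ (sum_bern q N)
    exact Finset.sum_congr rfl fun z _ => by split_ifs <;> simp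
  rw [bscError, le_div_iff₀ hcard, hsplit]
  rw [Finset.sum_congr rfl fun (c : C) _ => hsplit fun z => dec ((c : BVec N) + z) = c]
  rw [Finset.sum_sub_distrib, Finset.sum_const, Finset.card_univ, nsmul_eq_mul,
    ← Nat.card_eq_fintype_card, sub_mul, one_mul, mul_one]
  rw [hlead, mul_comm] at hcor
  linarith

open Classical in
/-- Probability that the noise `t + s`, `s` i.i.d. Bernoulli(`p`), is not a coset leader. -/
def leaderFail (p : ℝ) {N : ℕ} (C : Submodule (ZMod 2) (BVec N)) (t : BVec N) : ℝ :=
  ∑ s : BVec N, bern p s * (if IsLeader C (t + s) then 0 else 1)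

lemma leaderFail_nonneg {p : ℝ} (h0 : 0 ≤ p) (h1 : p ≤ 1) {N : ℕ}
    (C : Submodule (ZMod 2) (BVec N)) (t : BVec N) : 0 ≤ leaderFail p C t :=
  Finset.sum_nonneg fun s _ => mul_nonneg (bern_nonneg h0 h1 s) (by split_ifs <;> norm_num)

lemma leaderFail_bitMono {p : ℝ} (h0 : 0 ≤ p) (h1 : p ≤ 1 / 2) {N : ℕ}
    (C : Submodule (ZMod 2) (BVec N)) : BitMono (leaderFail p C) := by
  classical
  intro t i ht
  set A : BVec N → ℝ := fun s => if IsLeader C (t + s) then 0 else 1 with hA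
  set e : BVec N := Pi.single i 1 with he
  have hmono : ∀ s : BVec N, s i = 0 → bern p (s + e) ≤ bern p s ∧ A s ≤ A (s + e) := by
    intro s hs
    refine ⟨bern_anti h0 h1 (by rw [hammingNorm_add_single hs]; omega), ?_⟩
    have hts : (t + s) i = 0 := by simp [ht, hs]
    simp only [hA, ← add_assoc]
    by_cases h : IsLeader C (t + s + e)
    · rw [if_pos h, if_pos (IsLeader.of_add_single hts h)]
    · rw [if_neg h]; split_ifs <;> norm_num
  have hpair : ∀ s : BVec N, 0 ≤ (bern p s - bern p (s + e)) * (A (s + e) - A s) := by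
    intro s
    by_cases hs : s i = 0
    · obtain ⟨h2, h3⟩ := hmono s hs
      exact mul_nonneg (by linarith) (by linarith)
    · have hs' : (s + e) i = 0 := by
        rw [Pi.add_apply, he, Pi.single_eq_same, zmod_two_eq_one hs]; decide
      obtain ⟨h2, h3⟩ := hmono (s + e) hs'
      rw [add_single_add_single] at h2 h3
      exact mul_nonneg_of_nonpos_of_nonpos (by linarith) (by linarith)
  have hsh : ∀ F : BVec N → ℝ, ∑ s : BVec N, F (s + e) = ∑ s : BVec N, F s := fun F =>
    Equiv.sum_comp (Equiv.addRight e) F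
  have e1 : leaderFail p C t = ∑ s, bern p s * A s := rfl
  have e2 : leaderFail p C (t + e) = ∑ s, bern p s * A (s + e) := by
    refine Finset.sum_congr rfl fun s _ => ?_
    simp only [hA]
    rw [add_assoc, add_comm e s]
  have e3 : ∑ s, bern p (s + e) * A s = ∑ s, bern p s * A (s + e) := by
    rw [← hsh]
    exact Finset.sum_congr rfl fun s _ => by rw [add_single_add_single]
  have e4 : ∑ s, bern p (s + e) * A (s + e) = ∑ s, bern p s * A s :=
    hsh fun s => bern p s * A s
  have h5 := Finset.sum_nonneg fun s (_ : s ∈ Finset.univ) => hpair s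
  have h6 : ∑ s, (bern p s - bern p (s + e)) * (A (s + e) - A s) =
      ∑ s, bern p s * A (s + e) - ∑ s, bern p s * A s - ∑ s, bern p (s + e) * A (s + e) +
        ∑ s, bern p (s + e) * A s := by
    rw [← Finset.sum_sub_distrib, ← Finset.sum_sub_distrib, ← Finset.sum_add_distrib]
    exact Finset.sum_congr rfl fun s _ => by ring
  rw [h6, e3, e4] at h5
  rw [e1, e2]
  linarith

/-- If `C` has a decoder for the BSC(`p ∗ D`) with error probability at most `e`, noise words
uniform in a ball of radius `r ≤ D N`, followed by a BSC(`p`), are coset leaders up to a small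
fraction. -/
lemma ballSum_leaderFail_le {p D : ℝ} (hp0 : 0 ≤ p) (hp1 : p ≤ 1 / 2) (hD0 : 0 ≤ D)
    (hD1 : D ≤ 1 / 2) {N : ℕ} (C : Submodule (ZMod 2) (BVec N)) (dec : BVec N → BVec N) {c : ℝ}
    (hc : 0 < c)
    (htail : c ≤ ∑ z : BVec N, bern D z * (if D * N ≤ hammingNorm z then 1 else 0)) {r : ℕ}
    (hr : (r : ℝ) ≤ D * N) :
    ballSum (leaderFail p C) r ≤ bscError (bconv p D) C dec / c * ballCard N r := by
  classical
  refine ballSum_le_of_level fun j hj => ?_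
  refine (leaderFail_bitMono hp0 hp1 C).levelSum_le_of_mean
    (leaderFail_nonneg hp0 (by linarith) C) hD0 (by linarith) hc htail ?_
    (le_trans (by exact_mod_cast hj) hr)
  have h := sum_bern_conv p D (fun z : BVec N => if IsLeader C z then (0 : ℝ) else 1)
  unfold leaderFail
  rw [h]
  refine sum_bern_not_isLeader_le ?_ ?_ C dec
  · simp only [bconv]; nlinarith
  · simp only [bconv]; nlinarith

section coverings
variable {N : ℕ}

/-! ### Covering by linear codes -/

/-- `w` is within distance `r` of the code `C`. -/
def Covered {N : ℕ} (C : Submodule (ZMod 2) (BVec N)) (r : ℕ) (w : BVec N) : Prop :=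
  ∃ c ∈ C, hammingNorm (w + c) ≤ r

open Classical in
/-- Fraction of the words that are not within distance `r` of `C`. -/
def uncovered {N : ℕ} (C : Submodule (ZMod 2) (BVec N)) (r : ℕ) : ℝ :=
  (∑ w : BVec N, if Covered C r w then 0 else 1) / 2 ^ N

open Classical in
/-- Number of codewords within distance `r` of `w`. -/
def listSize {N : ℕ} (C : Submodule (ZMod 2) (BVec N)) (r : ℕ) (w : BVec N) : ℕ :=
  (Finset.univ.filter fun c => c ∈ C ∧ hammingNorm (w + c) ≤ r).card


lemma mem_sup_span_word {C : Submodule (ZMod 2) (BVec N)} {x c : BVec N} :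
    c ∈ C ⊔ Submodule.span (ZMod 2) {x} ↔ c ∈ C ∨ c + x ∈ C := by
  rw [Submodule.mem_sup]
  constructor
  · rintro ⟨a, ha, b, hb, rfl⟩
    obtain ⟨t, rfl⟩ := Submodule.mem_span_singleton.mp hb
    by_cases ht : t = 0
    · left; simpa [ht] using ha
    · right
      rw [zmod_two_eq_one ht, one_smul, add_assoc, ZModModule.add_self, add_zero]
      exact ha
  · rintro (h | h)
    · exact ⟨c, h, 0, Submodule.zero_mem _, add_zero c⟩
    · exact ⟨c + x, h, x, Submodule.mem_span_singleton_self x, by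
        rw [add_assoc, ZModModule.add_self, add_zero]⟩

lemma covered_sup_span {C : Submodule (ZMod 2) (BVec N)} {r : ℕ} {x w : BVec N} :
    Covered (C ⊔ Submodule.span (ZMod 2) {x}) r w ↔ Covered C r w ∨ Covered C r (w + x) := by
  simp only [Covered, mem_sup_span_word]
  constructor
  · rintro ⟨c, h | h, hc⟩
    · exact Or.inl ⟨c, h, hc⟩
    · refine Or.inr ⟨c + x, h, ?_⟩
      rwa [show w + x + (c + x) = w + c + (x + x) by abel, ZModModule.add_self, add_zero]
  · rintro (⟨c, h, hc⟩ | ⟨c, h, hc⟩)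
    · exact ⟨c, Or.inl h, hc⟩
    · refine ⟨c + x, Or.inr ?_, ?_⟩
      · rwa [add_assoc, ZModModule.add_self, add_zero]
      · rwa [show w + (c + x) = w + x + c by abel]

lemma uncovered_nonneg (C : Submodule (ZMod 2) (BVec N)) (r : ℕ) : 0 ≤ uncovered C r :=
  div_nonneg (Finset.sum_nonneg fun w _ => by split_ifs <;> norm_num) (by positivity)

lemma uncovered_anti {C C' : Submodule (ZMod 2) (BVec N)} (h : C ≤ C') {r r' : ℕ} (hr : r ≤ r') :
    uncovered C' r' ≤ uncovered C r := by
  unfold uncovered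
  gcongr with w
  by_cases hw : Covered C r w
  · obtain ⟨c, hc, hcw⟩ := hw
    rw [if_pos ⟨c, h hc, hcw.trans hr⟩, if_pos ⟨c, hc, hcw⟩]
  · rw [if_neg hw]; split_ifs <;> norm_num

lemma uncovered_le_one (C : Submodule (ZMod 2) (BVec N)) (r : ℕ) : uncovered C r ≤ 1 := by
  classical
  rw [uncovered, div_le_one (by positivity)]
  calc (∑ w : BVec N, if Covered C r w then (0 : ℝ) else 1) ≤ ∑ w : BVec N, (1 : ℝ) :=
        Finset.sum_le_sum fun w _ => by split_ifs <;> norm_num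
    _ = 2 ^ N := by simp

lemma sum_sum_mul_shift (f : BVec N → ℝ) :
    ∑ x : BVec N, ∑ w : BVec N, f w * f (w + x) = (∑ w : BVec N, f w) ^ 2 := by
  rw [Finset.sum_comm, sq, Finset.sum_mul]
  refine Finset.sum_congr rfl fun w _ => ?_
  rw [← Finset.mul_sum, sum_add_left]

lemma uncovered_sup_span (C : Submodule (ZMod 2) (BVec N)) (r : ℕ) (x : BVec N) :
    open Classical in
    uncovered (C ⊔ Submodule.span (ZMod 2) {x}) r =
      (∑ w : BVec N, (if Covered C r w then (0 : ℝ) else 1) *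
        (if Covered C r (w + x) then 0 else 1)) / 2 ^ N := by
  classical
  unfold uncovered
  congr 1
  refine Finset.sum_congr rfl fun w _ => ?_
  simp only [covered_sup_span]
  by_cases h1 : Covered C r w <;> by_cases h2 : Covered C r (w + x) <;> simp [h1, h2]

lemma sum_uncovered_sup_span (C : Submodule (ZMod 2) (BVec N)) (r : ℕ) :
    ∑ x : BVec N, uncovered (C ⊔ Submodule.span (ZMod 2) {x}) r =
      ∑ _x : BVec N, uncovered C r ^ 2 := by
  classical
  simp_rw [uncovered_sup_span]
  rw [← Finset.sum_div, sum_sum_mul_shift]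
  simp only [Finset.sum_const, Finset.card_univ, card_word, nsmul_eq_mul, uncovered]
  push_cast
  field_simp

lemma one_sub_uncovered_sup_span_le (C : Submodule (ZMod 2) (BVec N)) (r : ℕ) (x : BVec N) :
    1 - uncovered (C ⊔ Submodule.span (ZMod 2) {x}) r ≤ 2 * (1 - uncovered C r) := by
  classical
  set u : BVec N → ℝ := fun w => if Covered C r w then 0 else 1 with hu
  have h2 : (0 : ℝ) < 2 ^ N := by positivity
  have h1 : uncovered C r * 2 ^ N = ∑ w, u w := by
    rw [uncovered, div_mul_cancel₀ _ h2.ne']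
  have h1' : uncovered C r * 2 ^ N = ∑ w, u (w + x) := by
    rw [h1]; exact (Equiv.sum_comp (Equiv.addRight x) u).symm
  have h3 : uncovered (C ⊔ Submodule.span (ZMod 2) {x}) r * 2 ^ N = ∑ w, u w * u (w + x) := by
    rw [uncovered_sup_span, div_mul_cancel₀ _ h2.ne']
  have h4 : ∑ w, u w + ∑ w, u (w + x) - 2 ^ N ≤ ∑ w, u w * u (w + x) := by
    have : (2 : ℝ) ^ N = ∑ w : BVec N, (1 : ℝ) := by simp
    rw [this, ← Finset.sum_add_distrib, ← Finset.sum_sub_distrib]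
    refine Finset.sum_le_sum fun w _ => ?_
    simp only [hu]; split_ifs <;> norm_num
  rw [← h1, ← h1', ← h3] at h4
  nlinarith

lemma finrank_sup_span_word {C : Submodule (ZMod 2) (BVec N)} {x : BVec N} (hx : x ∉ C) :
    Module.finrank (ZMod 2) ↥(C ⊔ Submodule.span (ZMod 2) {x}) =
      Module.finrank (ZMod 2) C + 1 := by
  have h := Submodule.finrank_sup_add_finrank_inf_eq C (Submodule.span (ZMod 2) {x})
  have hne : x ≠ 0 := fun h => hx (h ▸ C.zero_mem)
  have hd : C ⊓ Submodule.span (ZMod 2) {x} = ⊥ := by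
    rw [← disjoint_iff]
    exact (Submodule.disjoint_span_singleton' hne).mpr hx
  rw [hd, finrank_bot, add_zero, finrank_span_singleton hne] at h
  exact h

lemma listSize_sup_span_le (C : Submodule (ZMod 2) (BVec N)) (r : ℕ) (x w : BVec N) :
    listSize (C ⊔ Submodule.span (ZMod 2) {x}) r w ≤ listSize C r w + listSize C r (w + x) := by
  classical
  unfold listSize
  rw [← Finset.card_image_of_injective (Finset.univ.filter fun c => c ∈ C ∧
    hammingNorm (w + x + c) ≤ r) (add_left_injective x)]
  refine le_trans (Finset.card_le_card ?_) (Finset.card_union_le _ _)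
  intro c hc
  simp only [Finset.mem_filter, Finset.mem_univ, true_and, mem_sup_span_word, Finset.mem_union,
    Finset.mem_image] at hc ⊢
  obtain ⟨h | h, hw⟩ := hc
  · exact Or.inl ⟨h, hw⟩
  · refine Or.inr ⟨c + x, ⟨h, ?_⟩, by rw [add_assoc, ZModModule.add_self, add_zero]⟩
    rwa [show w + x + (c + x) = w + c + (x + x) by abel, ZModModule.add_self, add_zero]

/-- One step of the greedy construction of covering codes. -/
lemma exists_uncovered_sq_le {C : Submodule (ZMod 2) (BVec N)} (hC : C ≠ ⊤) (r : ℕ) :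
    ∃ x ∉ C, uncovered (C ⊔ Submodule.span (ZMod 2) {x}) r ≤ uncovered C r ^ 2 := by
  obtain ⟨x, -, hx⟩ := Finset.exists_le_of_sum_le Finset.univ_nonempty
    (sum_uncovered_sup_span C r).le
  by_cases hxC : x ∈ C
  · obtain ⟨y, -, hy⟩ := SetLike.exists_of_lt hC.lt_top
    refine ⟨y, hy, le_trans (uncovered_anti le_sup_left le_rfl) ?_⟩
    rwa [sup_eq_left.mpr ((Submodule.span_singleton_le_iff_mem x C).mpr hxC)] at hx
  · exact ⟨x, hxC, hx⟩

lemma exists_greedy_extension (C : Submodule (ZMod 2) (BVec N)) (r j : ℕ)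
    (hj : Module.finrank (ZMod 2) C + j ≤ N) :
    ∃ C' : Submodule (ZMod 2) (BVec N), C ≤ C' ∧
      Module.finrank (ZMod 2) C' = Module.finrank (ZMod 2) C + j ∧
      uncovered C' r ≤ uncovered C r ^ 2 ^ j ∧
      ∀ r' M, (∀ w, listSize C r' w ≤ M) → ∀ w, listSize C' r' w ≤ 2 ^ j * M := by
  induction j with
  | zero => exact ⟨C, le_rfl, rfl, by simp, fun r' M h w => by simpa using h w⟩
  | succ j ih =>
    obtain ⟨C₁, h1, h2, h3, h4⟩ := ih (by omega)
    have hne : C₁ ≠ ⊤ := by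
      rintro rfl
      rw [finrank_top, Module.finrank_fin_fun] at h2
      omega
    obtain ⟨x, hx, hux⟩ := exists_uncovered_sq_le hne r
    refine ⟨C₁ ⊔ Submodule.span (ZMod 2) {x}, h1.trans le_sup_left, ?_, ?_, ?_⟩
    · rw [finrank_sup_span_word hx, h2, add_assoc]
    · refine hux.trans ?_
      rw [pow_succ 2 j, pow_mul]
      exact pow_le_pow_left₀ (uncovered_nonneg _ _) h3 2
    · intro r' M h w
      have e1 := listSize_sup_span_le C₁ r' x w
      have e2 := h4 r' M h w
      have e3 := h4 r' M h (w + x)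
      rw [pow_succ]
      linarith

lemma one_sub_uncovered_ge (C : Submodule (ZMod 2) (BVec N)) (r : ℕ) :
    open Classical in
    Nat.card C * ballSum (fun z => if IsLeader C z then 1 else 0) r / 2 ^ N ≤
      1 - uncovered C r := by
  classical
  have h2 : (0 : ℝ) < 2 ^ N := by positivity
  have h := sum_add_leaderDecoder C (fun z => if hammingNorm z ≤ r then 1 else 0)
  have e : ballSum (fun z => if IsLeader C z then (1 : ℝ) else 0) r =
      ∑ z : BVec N, (if hammingNorm z ≤ r then 1 else 0) * (if IsLeader C z then 1 else 0) := by
    refine Finset.sum_congr rfl fun z _ => ?_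
    split_ifs <;> simp [*]
  rw [e, ← h, div_le_iff₀ h2, sub_mul, one_mul, uncovered, div_mul_cancel₀ _ h2.ne',
    le_sub_iff_add_le, ← Finset.sum_add_distrib]
  calc _ ≤ ∑ w : BVec N, (1 : ℝ) := by
        refine Finset.sum_le_sum fun w _ => ?_
        by_cases hw : hammingNorm (w + leaderDecoder C w) ≤ r
        · rw [if_pos hw, if_pos ⟨_, leaderDecoder_mem C w, hw⟩, add_zero]
        · rw [if_neg hw]; split_ifs <;> norm_num
    _ = 2 ^ N := by simp

lemma sum_listSize_mul (C : Submodule (ZMod 2) (BVec N)) (r : ℕ) (F : BVec N → ℝ) :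
    open Classical in
    ∑ w : BVec N, ∑ c : BVec N, (if c ∈ C ∧ hammingNorm (w + c) ≤ r then F (w + c) else 0) =
      Nat.card C * ballSum F r := by
  classical
  rw [Finset.sum_comm]
  have h : ∀ c : BVec N, ∑ w : BVec N,
      (if c ∈ C ∧ hammingNorm (w + c) ≤ r then F (w + c) else 0) =
        if c ∈ C then ballSum F r else 0 := by
    intro c
    by_cases hc : c ∈ C
    · simp only [hc, true_and, if_true]
      exact Equiv.sum_comp (Equiv.addRight c) fun z => if hammingNorm z ≤ r then F z else 0
    · simp [hc]
  simp_rw [h]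
  rw [← Finset.sum_filter, Finset.sum_const, nsmul_eq_mul, Nat.card_eq_fintype_card,
    Fintype.card_subtype]

lemma sum_listSize (C : Submodule (ZMod 2) (BVec N)) (r : ℕ) :
    ∑ w : BVec N, (listSize C r w : ℝ) = Nat.card C * ballCard N r := by
  classical
  rw [ballCard, ← sum_listSize_mul]
  refine Finset.sum_congr rfl fun w _ => ?_
  rw [listSize, Finset.card_filter]
  push_cast
  rfl

lemma card_code (C : Submodule (ZMod 2) (BVec N)) :
    Nat.card C = 2 ^ Module.finrank (ZMod 2) C := by
  rw [Module.natCard_eq_pow_finrank (K := ZMod 2), Nat.card_zmod]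

lemma one_sub_uncovered_le (C : Submodule (ZMod 2) (BVec N)) (r : ℕ) :
    1 - uncovered C r ≤ Nat.card C * ballCard N r / 2 ^ N := by
  classical
  have h2 : (0 : ℝ) < 2 ^ N := by positivity
  rw [← sum_listSize, le_div_iff₀ h2, sub_mul, one_mul, uncovered, div_mul_cancel₀ _ h2.ne',
    sub_le_iff_le_add, ← Finset.sum_add_distrib]
  calc (2 : ℝ) ^ N = ∑ w : BVec N, (1 : ℝ) := by simp
    _ ≤ _ := by
      refine Finset.sum_le_sum fun w _ => ?_
      by_cases hw : Covered C r w
      · rw [if_pos hw, add_zero]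
        obtain ⟨c, hc⟩ := hw
        have : 1 ≤ listSize C r w := Finset.card_pos.mpr ⟨c, by simpa using hc⟩
        exact_mod_cast this
      · rw [if_neg hw]; simp

end coverings

section coverings
variable {N : ℕ}


/-- Exponential moment of the list size of a random word. -/
def listMoment (C : Submodule (ZMod 2) (BVec N)) (r : ℕ) : ℝ :=
  (∑ w : BVec N, (2 : ℝ) ^ listSize C r w) / 2 ^ N

lemma one_le_listMoment (C : Submodule (ZMod 2) (BVec N)) (r : ℕ) : 1 ≤ listMoment C r := by
  rw [listMoment, le_div_iff₀ (by positivity), one_mul]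
  calc (2 : ℝ) ^ N = ∑ w : BVec N, (1 : ℝ) := by simp
    _ ≤ _ := Finset.sum_le_sum fun w _ => one_le_pow₀ (by norm_num)

lemma sum_listMoment_sup_span_le (C : Submodule (ZMod 2) (BVec N)) (r : ℕ) :
    ∑ x : BVec N, listMoment (C ⊔ Submodule.span (ZMod 2) {x}) r ≤
      ∑ _x : BVec N, listMoment C r ^ 2 := by
  calc ∑ x : BVec N, listMoment (C ⊔ Submodule.span (ZMod 2) {x}) r
      ≤ ∑ x : BVec N, (∑ w : BVec N, (2 : ℝ) ^ listSize C r w * 2 ^ listSize C r (w + x)) / 2 ^ N := by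
        unfold listMoment
        gcongr with x _ w _
        rw [← pow_add]
        exact pow_le_pow_right₀ (by norm_num) (listSize_sup_span_le C r x w)
    _ = ∑ _x : BVec N, listMoment C r ^ 2 := by
        rw [← Finset.sum_div, sum_sum_mul_shift fun w => (2 : ℝ) ^ listSize C r w]
        simp only [Finset.sum_const, Finset.card_univ, card_word, nsmul_eq_mul, listMoment]
        push_cast
        field_simp

/-- One step of the greedy construction of codes that are good for covering and list decoding. -/
lemma exists_uncovered_add_listMoment_le (C : Submodule (ZMod 2) (BVec N)) (r r' : ℕ) :
    ∃ x, uncovered (C ⊔ Submodule.span (ZMod 2) {x}) r +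
        listMoment (C ⊔ Submodule.span (ZMod 2) {x}) r' ≤
      uncovered C r ^ 2 + listMoment C r' ^ 2 := by
  obtain ⟨x, -, hx⟩ := Finset.exists_le_of_sum_le (s := Finset.univ (α := BVec N))
    (f := fun x => uncovered (C ⊔ Submodule.span (ZMod 2) {x}) r +
        listMoment (C ⊔ Submodule.span (ZMod 2) {x}) r')
    (g := fun _ => uncovered C r ^ 2 + listMoment C r' ^ 2) Finset.univ_nonempty (by
      rw [Finset.sum_add_distrib, Finset.sum_add_distrib]
      exact add_le_add (sum_uncovered_sup_span C r).le (sum_listMoment_sup_span_le C r'))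
  exact ⟨x, hx⟩

lemma uncovered_bot (r : ℕ) :
    uncovered (⊥ : Submodule (ZMod 2) (BVec N)) r = 1 - ballCard N r / 2 ^ N := by
  classical
  have h2 : (0 : ℝ) < 2 ^ N := by positivity
  have e : (∑ w : BVec N, if Covered ⊥ r w then (0 : ℝ) else 1) = 2 ^ N - ballCard N r := by
    rw [eq_sub_iff_add_eq, ballCard, ballSum, ← Finset.sum_add_distrib]
    calc _ = ∑ w : BVec N, (1 : ℝ) := Finset.sum_congr rfl fun w _ => by
            simp only [Covered, Submodule.mem_bot, exists_eq_left, add_zero]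
            split_ifs <;> simp
      _ = 2 ^ N := by simp
  rw [uncovered, e]
  field_simp

lemma listMoment_bot (r : ℕ) :
    listMoment (⊥ : Submodule (ZMod 2) (BVec N)) r = 1 + ballCard N r / 2 ^ N := by
  classical
  have h2 : (0 : ℝ) < 2 ^ N := by positivity
  have e : (∑ w : BVec N, (2 : ℝ) ^ listSize ⊥ r w) = 2 ^ N + ballCard N r := by
    rw [ballCard, ballSum]
    calc _ = ∑ w : BVec N, ((1 : ℝ) + if hammingNorm w ≤ r then 1 else 0) := by
            refine Finset.sum_congr rfl fun w _ => ?_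
            have : listSize ⊥ r w = if hammingNorm w ≤ r then 1 else 0 := by
              rw [listSize]
              simp only [Submodule.mem_bot]
              split_ifs with h
              · rw [Finset.card_eq_one]
                refine ⟨0, ?_⟩
                ext c
                simp only [Finset.mem_filter, Finset.mem_univ, true_and, Finset.mem_singleton]
                exact ⟨fun h => h.1, fun hc => ⟨hc, by rwa [hc, add_zero]⟩⟩
              · rw [Finset.card_eq_zero, Finset.filter_eq_empty_iff]
                rintro c - ⟨rfl, hc⟩
                exact h (by rwa [add_zero] at hc)
            rw [this]; split_ifs <;> norm_num
      _ = _ := by rw [Finset.sum_add_distrib]; simp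
  rw [listMoment, e]
  field_simp

lemma exists_covering_listDecodable_aux {r r' : ℕ} (hr : 2 * ballCard N r' ≤ ballCard N r)
    (j : ℕ) (hj : 2 ^ j * (ballCard N r / 2 ^ N) ≤ 1 / 2) :
    ∃ C : Submodule (ZMod 2) (BVec N), Module.finrank (ZMod 2) C ≤ j ∧
      1 - uncovered C r ≤ 2 ^ j * (ballCard N r / 2 ^ N) ∧
      2 ^ j * (ballCard N r / 2 ^ N / 2 - 2 ^ j * (ballCard N r / 2 ^ N) ^ 2) ≤
        (1 - uncovered C r) - (listMoment C r' - 1) := by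
  set c₀ := ballCard N r / 2 ^ N with hc
  have hc0 : 0 ≤ c₀ := div_nonneg (ballCard_nonneg _ _) (by positivity)
  induction j with
  | zero =>
    refine ⟨⊥, by simp, ?_, ?_⟩
    · rw [uncovered_bot]; simp [hc]
    · rw [uncovered_bot, listMoment_bot, ← hc]
      have : ballCard N r' / 2 ^ N ≤ c₀ / 2 := by
        rw [hc, div_div, mul_comm ((2 : ℝ) ^ N), ← div_div]
        gcongr; linarith
      nlinarith [sq_nonneg c₀]
  | succ j ih =>
    have hj' : 2 ^ j * c₀ ≤ 1 / 4 := by rw [pow_succ] at hj; linarith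
    obtain ⟨C, h0, h1, h2⟩ := ih (by linarith)
    obtain ⟨x, hx⟩ := exists_uncovered_add_listMoment_le C r r'
    refine ⟨C ⊔ Submodule.span (ZMod 2) {x}, ?_, ?_, ?_⟩
    · by_cases hxC : x ∈ C
      · rw [sup_eq_left.mpr ((Submodule.span_singleton_le_iff_mem x C).mpr hxC)]; omega
      · rw [finrank_sup_span_word hxC]; omega
    · have := one_sub_uncovered_sup_span_le C r x
      rw [pow_succ]; linarith
    · have hS := one_le_listMoment C r'
      have hU := uncovered_le_one C r
      set c := 1 - uncovered C r with hcdef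
      set σ := listMoment C r' - 1 with hσ
      have hu : uncovered C r = 1 - c := by rw [hcdef]; ring
      have hl : listMoment C r' = 1 + σ := by rw [hσ]; ring
      rw [hu, hl] at hx
      have hσ0 : 0 ≤ σ := by linarith
      have hc1 : 0 ≤ c := by linarith
      have hp : (0 : ℝ) ≤ 2 ^ j := by positivity
      have hpos : 0 ≤ 2 ^ j * (c₀ / 2 - 2 ^ j * c₀ ^ 2) := by
        have : 2 ^ j * c₀ ^ 2 ≤ 1 / 4 * c₀ := by rw [sq, ← mul_assoc]; gcongr
        refine mul_nonneg hp ?_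
        linarith
      have hσc : σ ≤ c := by linarith
      have hsq1 : c ^ 2 ≤ (2 ^ j * c₀) ^ 2 := by gcongr
      have hsq2 : σ ^ 2 ≤ c ^ 2 := by gcongr
      have key : 2 * (2 ^ j * (c₀ / 2 - 2 ^ j * c₀ ^ 2)) - 2 * (2 ^ j * c₀) ^ 2 =
          2 ^ (j + 1) * (c₀ / 2 - 2 ^ (j + 1) * c₀ ^ 2) := by
        rw [pow_succ]; ring
      rw [← key]
      nlinarith

/-- Linear codes that cover a constant fraction of the words by balls of radius `r` and have
short lists at slightly smaller radii. -/
lemma exists_covering_listDecodable {r r' : ℕ} (hr : 2 * ballCard N r' ≤ ballCard N r)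
    (h4 : ballCard N r / 2 ^ N ≤ 1 / 4) :
    ∃ C : Submodule (ZMod 2) (BVec N), uncovered C r ≤ 31 / 32 ∧
      Nat.card C * (ballCard N r / 2 ^ N) ≤ 1 / 4 ∧ ∀ w, listSize C r' w ≤ N + 1 := by
  set c₀ := ballCard N r / 2 ^ N with hc
  have hc0 : 0 < c₀ := div_pos (by linarith [one_le_ballCard N r]) (by positivity)
  obtain ⟨j, hj1, hj2⟩ := exists_nat_pow_near (x := 1 / 4 / c₀) (y := 2)
    (by rw [le_div_iff₀ hc0]; linarith) one_lt_two
  rw [le_div_iff₀ hc0] at hj1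
  rw [div_lt_iff₀ hc0, pow_succ] at hj2
  obtain ⟨C, h0, h1, h2⟩ := exists_covering_listDecodable_aux hr j (by rw [← hc]; linarith)
  rw [← hc] at h1 h2
  have h3 : 1 / 32 ≤ (2 : ℝ) ^ j * (c₀ / 2 - 2 ^ j * c₀ ^ 2) := by
    set a : ℝ := 2 ^ j * c₀ with ha
    have : (2 : ℝ) ^ j * (c₀ / 2 - 2 ^ j * c₀ ^ 2) = a * (1 / 2 - a) := by rw [ha]; ring
    rw [this]
    have h5 : 1 / 8 ≤ a := by linarith
    nlinarith
  have hS := one_le_listMoment C r'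
  refine ⟨C, by linarith, ?_, fun w => ?_⟩
  · refine le_trans ?_ hj1
    rw [card_code]
    push_cast
    gcongr
    norm_num
  · have hS2 : listMoment C r' ≤ 2 := by linarith [uncovered_nonneg C r]
    rw [listMoment, div_le_iff₀ (by positivity)] at hS2
    have h6 : (2 : ℝ) ^ listSize C r' w ≤ 2 ^ (N + 1) := by
      rw [pow_succ, mul_comm]
      exact le_trans (Finset.single_le_sum (f := fun w => (2 : ℝ) ^ listSize C r' w)
        (fun w _ => by positivity) (Finset.mem_univ w)) hS2
    exact (pow_le_pow_iff_right₀ one_lt_two).mp h6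

end coverings

/-! ### Volume of Hamming balls and the choice of the dimension -/

lemma exp_neg_mul_binEntropy (x N : ℝ) :
    Real.exp (-(N * Real.binEntropy x)) =
      Real.exp (x * N * Real.log x + (N - x * N) * Real.log (1 - x)) := by
  congr 1
  rw [Real.binEntropy, Real.log_inv, Real.log_inv]; ring

lemma pow_mul_pow_eq_exp {x : ℝ} (h0 : 0 < x) (h1 : x < 1) {N k : ℕ} (hk : k ≤ N) :
    x ^ k * (1 - x) ^ (N - k) =
      Real.exp (k * Real.log x + ((N : ℝ) - k) * Real.log (1 - x)) := by
  rw [Real.exp_add, ← Nat.cast_sub hk, Real.exp_nat_mul, Real.exp_nat_mul, Real.exp_log h0,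
    Real.exp_log (by linarith)]

lemma ballCard_le_exp {x : ℝ} (h0 : 0 < x) (h1 : x ≤ 1 / 2) {N r : ℕ} (hr : (r : ℝ) ≤ x * N) :
    ballCard N r ≤ Real.exp (N * Real.binEntropy x) := by
  have hx1 : x < 1 := by linarith
  have h : ballCard N r * Real.exp (-(N * Real.binEntropy x)) ≤ 1 := by
    rw [← sum_bern x N, ballCard, ballSum, Finset.sum_mul]
    refine Finset.sum_le_sum fun z _ => ?_
    split_ifs with hz
    · rw [one_mul, bern_eq, pow_mul_pow_eq_exp h0 hx1 (hammingNorm_le z),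
        exp_neg_mul_binEntropy]
      refine Real.exp_le_exp.mpr ?_
      have hlog : Real.log x ≤ Real.log (1 - x) := Real.log_le_log h0 (by linarith)
      have hz' : (hammingNorm z : ℝ) ≤ x * N := le_trans (by exact_mod_cast hz) hr
      nlinarith
    · rw [zero_mul]; exact bern_nonneg h0.le hx1.le z
  rw [Real.exp_neg] at h
  rwa [← div_eq_mul_inv, div_le_one (Real.exp_pos _)] at h

lemma exp_le_levelCard {N d : ℕ} (h0 : 0 < d) (h1 : d < N) :
    Real.exp (N * Real.binEntropy (d / N)) ≤ (N + 1) * levelCard N d := by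
  have hd : (0 : ℝ) < d := by exact_mod_cast h0
  have hdN : (d : ℝ) < N := by exact_mod_cast h1
  have hN : (0 : ℝ) < N := by linarith
  set x : ℝ := d / N with hx
  have hxN : x * N = d := by rw [hx]; field_simp
  have hx0 : 0 < x := by positivity
  have hx1 : x < 1 := by rw [hx, div_lt_one hN]; exact hdN
  have hx1' : 0 < 1 - x := by linarith
  set a : ℕ → ℝ := fun k => x ^ k * (1 - x) ^ (N - k) * levelCard N k with ha
  have hann : ∀ k, 0 ≤ a k := fun k => by
    have := levelCard_nonneg N k
    simp only [ha]; positivity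
  have hrec : ∀ k < N, a (k + 1) * ((k + 1 : ℝ) * (1 - x)) = a k * (((N : ℝ) - k) * x) := by
    intro k hk
    have h := levelCard_succ N k
    push_cast at h
    simp only [ha]
    have e : (1 - x) ^ (N - k) = (1 - x) ^ (N - (k + 1)) * (1 - x) := by
      rw [← pow_succ]; congr 1; omega
    rw [e, pow_succ]
    linear_combination (x ^ k * x * (1 - x) ^ (N - (k + 1)) * (1 - x)) * h
  have hup : ∀ k, d ≤ k → k ≤ N → a k ≤ a d := by
    intro k hk
    induction k, hk using Nat.le_induction with
    | base => exact fun _ => le_rfl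
    | succ k hk ih =>
      intro hkN
      refine le_trans ?_ (ih (by omega))
      have hr := hrec k (by omega)
      have hdk : (d : ℝ) ≤ k := by exact_mod_cast hk
      have hle : ((N : ℝ) - k) * x ≤ (k + 1) * (1 - x) := by nlinarith
      have hp : (0 : ℝ) < (k + 1) * (1 - x) := by positivity
      refine le_of_mul_le_mul_right ?_ hp
      rw [hr]
      exact mul_le_mul_of_nonneg_left hle (hann k)
  have hdown : ∀ t k, k + t = d → a k ≤ a d := by
    intro t
    induction t with
    | zero => intro k hk; rw [show k = d by omega]
    | succ t ih =>
      intro k hk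
      refine le_trans ?_ (ih (k + 1) (by omega))
      have hr := hrec k (by omega)
      have hdk : (k : ℝ) + 1 ≤ d := by exact_mod_cast (by omega : k + 1 ≤ d)
      have hle : (k + 1) * (1 - x) ≤ ((N : ℝ) - k) * x := by nlinarith
      have hp : (0 : ℝ) < (k + 1) * (1 - x) := by positivity
      refine le_of_mul_le_mul_right ?_ hp
      rw [hr]
      exact mul_le_mul_of_nonneg_left hle (hann k)
  have hsum : 1 ≤ (N + 1) * a d := by
    have e : (1 : ℝ) = ∑ k ∈ Finset.range (N + 1), a k := by
      rw [← sum_bern x N]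
      have := sum_eq_sum_levelSum (N := N) (fun k => x ^ k * (1 - x) ^ (N - k)) (fun _ => 1)
      simp only [mul_one] at this
      simp_rw [bern_eq]
      exact this
    refine e.le.trans ?_
    calc ∑ k ∈ Finset.range (N + 1), a k ≤ ∑ k ∈ Finset.range (N + 1), a d := by
          refine Finset.sum_le_sum fun k hk => ?_
          have hkN := Nat.lt_succ_iff.mp (Finset.mem_range.mp hk)
          rcases le_total d k with h | h
          · exact hup k h hkN
          · exact hdown (d - k) k (by omega)
      _ = (N + 1) * a d := by simp
  have he : a d = Real.exp (-(N * Real.binEntropy x)) * levelCard N d := by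
    rw [exp_neg_mul_binEntropy, hxN, ← pow_mul_pow_eq_exp hx0 hx1 h1.le]
  rw [he, Real.exp_neg] at hsum
  have hE := Real.exp_pos (N * Real.binEntropy x)
  calc Real.exp (N * Real.binEntropy x) = Real.exp (N * Real.binEntropy x) * 1 := by ring
    _ ≤ Real.exp (N * Real.binEntropy x) *
        ((N + 1) * ((Real.exp (N * Real.binEntropy x))⁻¹ * levelCard N d)) := by gcongr
    _ = _ := by field_simp

lemma tendsto_log_add_one_div : Tendsto (fun N : ℕ => Real.log (N + 1) / N) atTop (𝓝 0) := by
  have h : Tendsto (fun x : ℝ => Real.log x / x) atTop (𝓝 0) := by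
    have := Real.isLittleO_log_id_atTop.tendsto_div_nhds_zero
    simpa using this
  have h1 : Tendsto (fun N : ℕ => (N : ℝ) + 1) atTop atTop :=
    tendsto_natCast_atTop_atTop.atTop_add tendsto_const_nhds
  have h2 := h.comp h1
  have h3 : Tendsto (fun N : ℕ => 1 + 1 / (N : ℝ)) atTop (𝓝 (1 + 0)) :=
    tendsto_const_nhds.add tendsto_one_div_atTop_nhds_zero_nat
  have h4 := h2.mul h3
  rw [zero_mul] at h4
  refine h4.congr' ?_
  filter_upwards [eventually_gt_atTop 0] with N hN
  have : (0 : ℝ) < N := by exact_mod_cast hN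
  simp only [Function.comp]
  field_simp

lemma tendsto_log_div_self : Tendsto (fun N : ℕ => Real.log N / N) atTop (𝓝 0) := by
  refine squeeze_zero' ?_ ?_ tendsto_log_add_one_div
  · exact Eventually.of_forall fun N => div_nonneg (Real.log_natCast_nonneg N) (by positivity)
  · filter_upwards [eventually_gt_atTop 0] with N hN
    have : (0 : ℝ) < N := by exact_mod_cast hN
    gcongr
    linarith

lemma tendsto_log_ballCard {D : ℝ} (h0 : 0 < D) (h1 : D < 1 / 2) :
    Tendsto (fun N : ℕ => Real.log (ballCard N ⌊D * N⌋₊) / N) atTop (𝓝 (Real.binEntropy D)) := by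
  have hfl : Tendsto (fun N : ℕ => ((⌊D * N⌋₊ : ℕ) : ℝ) / N) atTop (𝓝 D) :=
    (tendsto_nat_floor_mul_div_atTop h0.le).comp tendsto_natCast_atTop_atTop
  have hlow : Tendsto (fun N : ℕ => Real.binEntropy (((⌊D * N⌋₊ : ℕ) : ℝ) / N) -
      Real.log (N + 1) / N) atTop (𝓝 (Real.binEntropy D - 0)) :=
    ((Real.binEntropy_continuous.tendsto D).comp hfl).sub tendsto_log_add_one_div
  rw [sub_zero] at hlow
  refine tendsto_of_tendsto_of_tendsto_of_le_of_le' hlow tendsto_const_nhds ?_ ?_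
  · filter_upwards [eventually_gt_atTop 0, hfl.eventually_lt_const (by linarith : D < 1),
      hfl.eventually_const_lt h0] with N hN hlt hgt
    have hN' : (0 : ℝ) < N := by exact_mod_cast hN
    rw [div_lt_one hN'] at hlt
    have hd0 : 0 < ⌊D * N⌋₊ := by
      by_contra h
      rw [show ⌊D * N⌋₊ = 0 by omega] at hgt
      simp at hgt
    have h := exp_le_levelCard hd0 (by exact_mod_cast hlt)
    have h2 : Real.exp (N * Real.binEntropy (((⌊D * N⌋₊ : ℕ) : ℝ) / N)) ≤
        (N + 1) * ballCard N ⌊D * N⌋₊ :=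
      h.trans (mul_le_mul_of_nonneg_left (levelCard_le_ballCard _ _) (by positivity))
    have hV := one_le_ballCard N ⌊D * N⌋₊
    have h3 := Real.log_le_log (Real.exp_pos _) h2
    rw [Real.log_exp, Real.log_mul (by positivity) (by linarith)] at h3
    rw [le_div_iff₀ hN', sub_mul, div_mul_cancel₀ _ hN'.ne']
    linarith
  · filter_upwards [eventually_gt_atTop 0] with N hN
    have hN' : (0 : ℝ) < N := by exact_mod_cast hN
    have hV := one_le_ballCard N ⌊D * N⌋₊
    rw [div_le_iff₀ hN', ← Real.log_exp (Real.binEntropy D * N), mul_comm (Real.binEntropy D)]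
    exact Real.log_le_log (by linarith) (ballCard_le_exp h0 h1.le (Nat.floor_le (by positivity)))

/-- Logarithm of the number of codewords aimed at by `outerDim`. -/
def targetBits (D : ℝ) (N : ℕ) : ℝ :=
  N + Real.logb 2 N - Real.logb 2 (ballCard N ⌊D * N⌋₊)

/-- Dimension over the field with `2 ^ m` elements that makes the mean list size at least `N`. -/
def outerDim (D : ℝ) (N m : ℕ) : ℕ := ⌈targetBits D N / m⌉₊

lemma targetBits_nonneg (D : ℝ) {N : ℕ} (hN : 1 ≤ N) : 0 ≤ targetBits D N := by
  have hV := one_le_ballCard N ⌊D * N⌋₊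
  have h1 : Real.logb 2 (ballCard N ⌊D * N⌋₊) ≤ N := by
    rw [Real.logb_le_iff_le_rpow one_lt_two (by linarith), Real.rpow_natCast]
    exact ballCard_le _ _
  have h2 : 0 ≤ Real.logb 2 (N : ℝ) := Real.logb_nonneg one_lt_two (by exact_mod_cast hN)
  rw [targetBits]; linarith

lemma two_rpow_targetBits (D : ℝ) {N : ℕ} (hN : 1 ≤ N) :
    (2 : ℝ) ^ targetBits D N * (ballCard N ⌊D * N⌋₊ / 2 ^ N) = N := by
  have hV : 0 < ballCard N ⌊D * N⌋₊ := by linarith [one_le_ballCard N ⌊D * N⌋₊]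
  have hN' : (0 : ℝ) < N := by exact_mod_cast hN
  rw [targetBits, Real.rpow_sub two_pos, Real.rpow_add two_pos, Real.rpow_natCast,
    Real.rpow_logb two_pos (by norm_num) hN', Real.rpow_logb two_pos (by norm_num) hV]
  set V := ballCard N ⌊D * N⌋₊
  field_simp

lemma targetBits_le_outerDim (D : ℝ) {N m : ℕ} (hm : 1 ≤ m) :
    targetBits D N ≤ (outerDim D N m * m : ℕ) := by
  have hm' : (0 : ℝ) < m := by exact_mod_cast hm
  push_cast
  rw [← div_le_iff₀ hm']
  exact Nat.le_ceil _

lemma outerDim_le_targetBits (D : ℝ) {N m : ℕ} (hN : 1 ≤ N) (hm : 1 ≤ m) :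
    ((outerDim D N m * m : ℕ) : ℝ) ≤ targetBits D N + m := by
  have hm' : (0 : ℝ) < m := by exact_mod_cast hm
  have h := Nat.ceil_lt_add_one (div_nonneg (targetBits_nonneg D hN) hm'.le)
  push_cast
  calc ((outerDim D N m : ℕ) : ℝ) * m ≤ (targetBits D N / m + 1) * m := by
        gcongr; exact h.le
    _ = _ := by field_simp

lemma le_two_pow_outerDim (D : ℝ) {N m : ℕ} (hN : 1 ≤ N) (hm : 1 ≤ m) :
    (N : ℝ) ≤ 2 ^ (outerDim D N m * m) * (ballCard N ⌊D * N⌋₊ / 2 ^ N) := by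
  have hV := ballCard_nonneg N ⌊D * N⌋₊
  conv_lhs => rw [← two_rpow_targetBits D hN]
  rw [← Real.rpow_natCast 2 (outerDim D N m * m)]
  gcongr
  · norm_num
  · exact targetBits_le_outerDim D hm

lemma two_pow_outerDim_le (D : ℝ) {N m : ℕ} (hN : 1 ≤ N) (hm : 1 ≤ m) :
    2 ^ (outerDim D N m * m) * (ballCard N ⌊D * N⌋₊ / 2 ^ N) ≤ 2 ^ m * (N : ℝ) := by
  have hV := ballCard_nonneg N ⌊D * N⌋₊
  conv_rhs => rw [← two_rpow_targetBits D hN]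
  rw [← mul_assoc, ← Real.rpow_natCast 2 (outerDim D N m * m), ← Real.rpow_natCast 2 m,
    ← Real.rpow_add two_pos, add_comm (m : ℝ)]
  gcongr
  · norm_num
  · exact outerDim_le_targetBits D hN hm

lemma tendsto_targetBits {D : ℝ} (h0 : 0 < D) (h1 : D < 1 / 2) :
    Tendsto (fun N : ℕ => targetBits D N / N) atTop (𝓝 (1 - h2 D)) := by
  have h := (tendsto_const_nhds (x := (1 : ℝ))).add
    ((tendsto_log_div_self.div_const (Real.log 2)).sub
      ((tendsto_log_ballCard h0 h1).div_const (Real.log 2)))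
  rw [zero_div, zero_sub, ← sub_eq_add_neg] at h
  refine h.congr' ?_
  filter_upwards [eventually_gt_atTop 0] with N hN
  have : (0 : ℝ) < N := by exact_mod_cast hN
  simp only [targetBits, Real.logb]
  field_simp
  ring

lemma tendsto_outerDim {D : ℝ} (h0 : 0 < D) (h1 : D < 1 / 2) {N m : ℕ → ℕ}
    (hN : Tendsto N atTop atTop) (hm : ∀ i, 1 ≤ m i) (hmN : ∀ i, 2 ^ m i ≤ N i + 1) :
    Tendsto (fun i => ((outerDim D (N i) (m i) * m i : ℕ) : ℝ) / N i) atTop (𝓝 (1 - h2 D)) := by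
  have hlow := (tendsto_targetBits h0 h1).comp hN
  have hup := ((tendsto_targetBits h0 h1).add
    (tendsto_log_add_one_div.div_const (Real.log 2))).comp hN
  rw [zero_div, add_zero] at hup
  refine tendsto_of_tendsto_of_tendsto_of_le_of_le' hlow hup ?_ ?_
  · filter_upwards [hN.eventually_gt_atTop 0] with i hi
    have : (0 : ℝ) < N i := by exact_mod_cast hi
    simp only [Function.comp]
    gcongr
    exact targetBits_le_outerDim D (hm i)
  · filter_upwards [hN.eventually_gt_atTop 0] with i hi
    have hi' : (0 : ℝ) < N i := by exact_mod_cast hi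
    simp only [Function.comp]
    have hmi : (m i : ℝ) ≤ Real.log (N i + 1) / Real.log 2 := by
      rw [le_div_iff₀ (Real.log_pos one_lt_two), ← Real.log_pow]
      exact Real.log_le_log (by positivity) (by exact_mod_cast hmN i)
    calc ((outerDim D (N i) (m i) * m i : ℕ) : ℝ) / N i
        ≤ (targetBits D (N i) + Real.log (N i + 1) / Real.log 2) / N i := by
          gcongr
          exact (outerDim_le_targetBits D hi (hm i)).trans (by linarith)
      _ = _ := by rw [add_div, div_right_comm]

/-! ### Reed-Solomon codes -/

section vecPoly
variable {F : Type} [Field F]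

lemma vecPoly_apply (r : ℕ) (x : Fin r → F) :
    vecPoly r x = ∑ j : Fin r, Polynomial.monomial (j : ℕ) (x j) := by
  simp [vecPoly]

lemma vecPoly_coeff (r : ℕ) (x : Fin r → F) (i : Fin r) : (vecPoly r x).coeff i = x i := by
  rw [vecPoly_apply, Polynomial.finsetSum_coeff]
  rw [Finset.sum_eq_single i]
  · simp
  · intro j _ hj
    rw [Polynomial.coeff_monomial, if_neg (fun h => hj (Fin.ext h))]
  · simp

lemma vecPoly_degree_lt (r : ℕ) (x : Fin r → F) : (vecPoly r x).degree < r := by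
  rw [vecPoly_apply]
  simp_rw [← Polynomial.C_mul_X_pow_eq_monomial]
  exact Polynomial.degree_sum_fin_lt x

lemma vecPoly_coeff_self {r : ℕ} {P : Polynomial F} (h : P.degree < r) :
    vecPoly r (fun j : Fin r => P.coeff j) = P := by
  ext i
  by_cases hi : i < r
  · exact vecPoly_coeff r _ ⟨i, hi⟩
  · have hi' : (r : WithBot ℕ) ≤ i := by exact_mod_cast not_lt.mp hi
    rw [Polynomial.coeff_eq_zero_of_degree_lt ((vecPoly_degree_lt _ _).trans_le hi'),
      Polynomial.coeff_eq_zero_of_degree_lt (h.trans_le hi')]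

lemma vecPoly_injective (r : ℕ) : Function.Injective (vecPoly (F := F) r) := by
  intro x y h
  funext i
  rw [← vecPoly_coeff r x i, h, vecPoly_coeff]

end vecPoly

namespace OuterRS
variable (O : OuterRS)

lemma gen_monic (k : ℕ) : (O.gen k).Monic :=
  Polynomial.monic_prod_of_monic _ _ fun _ _ => Polynomial.monic_X_sub_C _

lemma gen_natDegree (k : ℕ) : (O.gen k).natDegree = O.n - k := by
  rw [gen, Polynomial.natDegree_prod_of_monic _ _ fun _ _ => Polynomial.monic_X_sub_C _]
  simp only [Polynomial.natDegree_X_sub_C]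
  simp

lemma gen_degree (k : ℕ) : (O.gen k).degree = (O.n - k : ℕ) := by
  rw [Polynomial.degree_eq_natDegree (O.gen_monic k).ne_zero, gen_natDegree]

lemma gen_dvd {k₂ k : ℕ} (h : k₂ ≤ k) : O.gen k ∣ O.gen k₂ :=
  Finset.prod_dvd_prod_of_subset _ _ _ (Finset.range_subset_range.mpr (by omega))

lemma mem_rsCode {k : ℕ} {v : Fin O.n → O.F} :
    v ∈ O.rsCode k ↔ O.gen k ∣ vecPoly O.n v := by
  simp [rsCode, Ideal.mem_span_singleton]

lemma rsCode_mono {k₂ k : ℕ} (h : k₂ ≤ k) : O.rsCode k₂ ≤ O.rsCode k := fun v hv => by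
  rw [mem_rsCode] at hv ⊢
  exact (O.gen_dvd h).trans hv

lemma vecPoly_message {k r : ℕ} (hk : r ≤ k) (hkn : k ≤ O.n) (x : Fin r → O.F) :
    vecPoly O.n (fun j : Fin O.n => (vecPoly r x * O.gen k).coeff j) = vecPoly r x * O.gen k := by
  refine vecPoly_coeff_self ?_
  rw [Polynomial.degree_mul, gen_degree]
  calc (vecPoly r x).degree + ((O.n - k : ℕ) : WithBot ℕ)
      < (r : WithBot ℕ) + ((O.n - k : ℕ) : WithBot ℕ) :=
        WithBot.add_lt_add_right (by simp) (vecPoly_degree_lt r x)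
    _ ≤ (O.n : WithBot ℕ) := by exact_mod_cast (by omega : r + (O.n - k) ≤ O.n)

/-- The linear encoder of the Reed-Solomon code of dimension `k`. -/
def rsEncode (k : ℕ) : (Fin k → O.F) →ₗ[O.F] (Fin O.n → O.F) where
  toFun x j := (vecPoly k x * O.gen k).coeff j
  map_add' x y := by ext j; simp [add_mul]
  map_smul' a x := by ext j; simp

lemma rsEncode_injective {k : ℕ} (hk : k ≤ O.n) : Function.Injective (O.rsEncode k) := by
  intro x y h
  have h1 : vecPoly O.n (O.rsEncode k x) = vecPoly O.n (O.rsEncode k y) := by rw [h]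
  have h2 := O.vecPoly_message le_rfl hk x
  have h3 := O.vecPoly_message le_rfl hk y
  have h4 : vecPoly k x * O.gen k = vecPoly k y * O.gen k := h2.symm.trans (h1.trans h3)
  exact vecPoly_injective k (mul_right_cancel₀ (O.gen_monic k).ne_zero h4)

lemma rsEncode_range {k : ℕ} (hk : k ≤ O.n) : LinearMap.range (O.rsEncode k) = O.rsCode k := by
  ext v
  rw [mem_rsCode, LinearMap.mem_range]
  constructor
  · rintro ⟨x, rfl⟩
    exact ⟨vecPoly k x, (O.vecPoly_message le_rfl hk x).trans (mul_comm _ _)⟩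
  · rintro ⟨a, ha⟩
    have hdeg : a.degree < k := by
      by_cases h0 : a = 0
      · rw [h0, Polynomial.degree_zero]; exact WithBot.bot_lt_coe k
      have h1 := vecPoly_degree_lt O.n v
      rw [ha, Polynomial.degree_mul, gen_degree, Polynomial.degree_eq_natDegree h0] at h1
      rw [Polynomial.degree_eq_natDegree h0]
      have h2 : O.n - k + a.natDegree < O.n := by exact_mod_cast h1
      exact_mod_cast (by omega : a.natDegree < k)
    refine ⟨fun j => a.coeff j, vecPoly_injective O.n ?_⟩
    refine (O.vecPoly_message le_rfl hk _).trans ?_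
    rw [vecPoly_coeff_self hdeg, ha, mul_comm]

lemma finrank_rsCode {k : ℕ} (hk : k ≤ O.n) (hm : O.m ≠ 0) :
    Module.finrank (ZMod 2) ((O.rsCode k).restrictScalars (ZMod 2)) = k * O.m := by
  have h1 : Module.finrank O.F (O.rsCode k) = k := by
    rw [← O.rsEncode_range hk, LinearMap.finrank_range_of_inj (O.rsEncode_injective hk),
      Module.finrank_fin_fun]
  have h2 := Module.finrank_mul_finrank (ZMod 2) O.F (O.rsCode k)
  rw [h1, GaloisField.finrank 2 hm, mul_comm] at h2
  exact h2.symm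

end OuterRS

/-! ### Concatenation -/

section inner
variable {n M N : ℕ}

lemma InnerBLBC.psiStar_apply (I : InnerBLBC n M N) (u : BVec M) (j : Fin N) :
    I.psiStar u j = Matrix.vecMul
      (fun a => u (Fin.cast I.hs (finProdFinEquiv
        ((finProdFinEquiv.symm (Fin.cast I.ht.symm j)).1, a)))) I.G
      (finProdFinEquiv.symm (Fin.cast I.ht.symm j)).2 := rfl

lemma InnerBLBC.psiStar_injective (I : InnerBLBC n M N) : Function.Injective I.psiStar := by
  intro u u' h
  have hb : ∀ b : Fin I.l, (fun a => u (Fin.cast I.hs (finProdFinEquiv (b, a)))) =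
      fun a => u' (Fin.cast I.hs (finProdFinEquiv (b, a))) := by
    intro b
    refine I.inj (funext fun e => ?_)
    have h1 := congrFun h (Fin.cast I.ht (finProdFinEquiv (b, e)))
    rw [psiStar_apply, psiStar_apply] at h1
    simpa using h1
  funext i
  have h2 := congrFun (hb (finProdFinEquiv.symm (Fin.cast I.hs.symm i)).1)
    (finProdFinEquiv.symm (Fin.cast I.hs.symm i)).2
  rw [Prod.mk.eta, Equiv.apply_symm_apply] at h2
  exact h2

/-- The inner code with a single block given by an injective linear map. -/
def InnerBLBC.ofLinear (hn : 1 ≤ n) (g : BVec M →ₗ[ZMod 2] BVec N) (hg : Function.Injective g) :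
    InnerBLBC n M N where
  l := 1
  s := M
  t := N
  one_le_l := le_rfl
  l_le := hn
  hs := one_mul M
  ht := one_mul N
  G := (LinearMap.toMatrix' g).transpose
  inj := by
    intro u u' h
    simp only [Matrix.vecMul_transpose, LinearMap.toMatrix'_mulVec] at h
    exact hg h

lemma InnerBLBC.psiStar_ofLinear (hn : 1 ≤ n) (g : BVec M →ₗ[ZMod 2] BVec N)
    (hg : Function.Injective g) : (InnerBLBC.ofLinear hn g hg).psiStar = g := by
  refine LinearMap.ext fun u => funext fun j => ?_
  have hu : ∀ b : Fin 1, (fun a => u (Fin.cast (one_mul M) (finProdFinEquiv (b, a)))) = u := by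
    intro b
    funext a
    congr 1
    ext
    simp [finProdFinEquiv]
  have he : (finProdFinEquiv.symm (Fin.cast (one_mul N).symm j)).2 = j := by
    ext
    simp [finProdFinEquiv, Nat.mod_eq_of_lt j.2]
  change Matrix.vecMul (fun a : Fin M => u (Fin.cast (one_mul M) (finProdFinEquiv
    ((finProdFinEquiv.symm (Fin.cast (one_mul N).symm j)).1, a)))) (LinearMap.toMatrix' g).transpose
      (finProdFinEquiv.symm (Fin.cast (one_mul N).symm j)).2 = g u j
  rw [hu, he, Matrix.vecMul_transpose, LinearMap.toMatrix'_mulVec]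

end inner

section extend
variable {K V W : Type*} [Field K] [AddCommGroup V] [Module K V] [AddCommGroup W] [Module K W]
  [FiniteDimensional K V] [FiniteDimensional K W]

/-- An injective linear map on a subspace extends to an equivalence with any space of the same
dimension. -/
lemma exists_linearEquiv_extend (h : Module.finrank K V = Module.finrank K W) (P : Submodule K V)
    (e : P →ₗ[K] W) (he : Function.Injective e) : ∃ σ : V ≃ₗ[K] W, ∀ p : P, σ p = e p := by
  obtain ⟨X, hX⟩ := P.exists_isCompl
  obtain ⟨Y, hY⟩ := (LinearMap.range e).exists_isCompl
  have h1 := Submodule.finrank_add_eq_of_isCompl hX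
  have h2 := Submodule.finrank_add_eq_of_isCompl hY
  rw [LinearMap.finrank_range_of_inj he] at h2
  have h3 : Module.finrank K X = Module.finrank K Y := by omega
  refine ⟨(Submodule.prodEquivOfIsCompl P X hX).symm ≪≫ₗ
    ((LinearEquiv.ofInjective e he).prodCongr (LinearEquiv.ofFinrankEq X Y h3)) ≪≫ₗ
      Submodule.prodEquivOfIsCompl _ Y hY, fun p => ?_⟩
  simp

/-- Subspaces of the same dimension that contain `P` are related by an automorphism that fixes
`P`. -/
lemma exists_linearEquiv_map_eq {P Q C : Submodule K W} (hPQ : P ≤ Q) (hPC : P ≤ C)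
    (h : Module.finrank K Q = Module.finrank K C) :
    ∃ σ : W ≃ₗ[K] W, (∀ p ∈ P, σ p = p) ∧ Q.map (σ : W →ₗ[K] W) = C := by
  obtain ⟨σ₁, h1⟩ := exists_linearEquiv_extend h (P.comap Q.subtype)
    (LinearMap.codRestrict C (Q.subtype ∘ₗ (P.comap Q.subtype).subtype) fun x => hPC x.2)
    (fun x y hxy => Subtype.ext (Subtype.ext (congrArg (fun z : C => (z : W)) hxy)))
  obtain ⟨σ, h2⟩ := exists_linearEquiv_extend (V := W) (W := W) rfl Q
    (C.subtype ∘ₗ σ₁.toLinearMap) (C.subtype_injective.comp σ₁.injective)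
  refine ⟨σ, fun p hp => ?_, ?_⟩
  · have e1 := h1 ⟨⟨p, hPQ hp⟩, hp⟩
    have e2 := h2 ⟨p, hPQ hp⟩
    simp only [LinearMap.comp_apply, LinearEquiv.coe_coe] at e2
    rw [e2]
    exact congrArg (fun z : C => (z : W)) e1
  · ext c
    rw [Submodule.mem_map]
    constructor
    · rintro ⟨q, hq, rfl⟩
      have e2 := h2 ⟨q, hq⟩
      simp only [LinearMap.comp_apply, LinearEquiv.coe_coe] at e2 ⊢
      rw [e2]
      exact (σ₁ ⟨q, hq⟩).2
    · intro hc
      have e2 := h2 (σ₁.symm ⟨c, hc⟩)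
      refine ⟨(σ₁.symm ⟨c, hc⟩ : Q), (σ₁.symm ⟨c, hc⟩).2, ?_⟩
      simp only [LinearMap.comp_apply, LinearEquiv.coe_coe] at e2 ⊢
      rw [e2]
      simp

end extend

section concat
variable (O : OuterRS) {N : ℕ}

lemma concat_injective (I : O.Inner N) : Function.Injective (concat O I) :=
  I.psiStar_injective.comp O.φ.injective

lemma length_le (I : O.Inner N) : O.n * O.m ≤ N := by
  have := LinearMap.finrank_le_finrank_of_injective I.psiStar_injective
  simpa using this

lemma concatCode_mono (I : O.Inner N) {k₂ k : ℕ} (h : k₂ ≤ k) :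
    concatCode O I k₂ ≤ concatCode O I k :=
  Submodule.map_mono (O.rsCode_mono h)

lemma finrank_concatCode (I : O.Inner N) {k : ℕ} (hk : k ≤ O.n) (hm : O.m ≠ 0) :
    Module.finrank (ZMod 2) (concatCode O I k) = k * O.m := by
  rw [concatCode, ← O.finrank_rsCode hk hm]
  exact (Submodule.equivMapOfInjective _ (concat_injective O I) _).finrank_eq.symm

/-- Every linear code of the right dimension that contains the code of dimension `k₂` is a nested
concatenated code. -/
lemma exists_inner_concatCode_eq (I₂ : O.Inner N) {k₂ k : ℕ} (hk₂ : k₂ ≤ k) (hk : k ≤ O.n)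
    (hn : 1 ≤ O.n) (hm : O.m ≠ 0) {C : Submodule (ZMod 2) (BVec N)}
    (hC : concatCode O I₂ k₂ ≤ C) (hdim : Module.finrank (ZMod 2) C = k * O.m) :
    ∃ I : O.Inner N, (∀ v ∈ O.rsCode k₂, concat O I v = concat O I₂ v) ∧ concatCode O I k = C := by
  obtain ⟨σ, h1, h2⟩ := exists_linearEquiv_map_eq (concatCode_mono O I₂ hk₂) hC
    (by rw [finrank_concatCode O I₂ hk hm, hdim])
  have hg : Function.Injective ((σ : BVec N →ₗ[ZMod 2] BVec N) ∘ₗ I₂.psiStar) :=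
    σ.injective.comp I₂.psiStar_injective
  have hcon : concat O (InnerBLBC.ofLinear hn _ hg) =
      (σ : BVec N →ₗ[ZMod 2] BVec N) ∘ₗ concat O I₂ := by
    rw [concat, InnerBLBC.psiStar_ofLinear]; rfl
  refine ⟨InnerBLBC.ofLinear hn _ hg, fun v hv => ?_, ?_⟩
  · rw [hcon]
    exact h1 _ (Submodule.mem_map_of_mem hv)
  · rw [concatCode, hcon, Submodule.map_comp]
    exact h2

/-- The stored message determines the coset of the quantized word. -/
lemma add_messageWord_mem (I : O.Inner N) {k₂ k : ℕ} (hk₂ : k₂ ≤ k) (hk : k ≤ O.n) {c : BVec N}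
    (hc : c ∈ concatCode O I k) :
    c + messageWord O I k₂ k (fun j => ((vecPoly O.n (Function.invFun (concat O I) c) %ₘ
      O.gen k₂) /ₘ O.gen k).coeff j) ∈ concatCode O I k₂ := by
  obtain ⟨v, hv, rfl⟩ := hc
  rw [Function.leftInverse_invFun (concat_injective O I) v]
  have hv' := O.mem_rsCode.mp hv
  set P := vecPoly O.n v with hP
  set R := P %ₘ O.gen k₂ with hR
  have hdiv := Polynomial.modByMonic_add_div P (O.gen k₂)
  rw [← hR] at hdiv
  have hRg : O.gen k ∣ R := by
    have h1 : R = P - O.gen k₂ * (P /ₘ O.gen k₂) := by rw [eq_sub_iff_add_eq, hdiv]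
    rw [h1]
    exact dvd_sub hv' ((O.gen_dvd hk₂).mul_right _)
  have hQ : R /ₘ O.gen k * O.gen k = R := by
    have h1 := Polynomial.modByMonic_add_div R (O.gen k)
    rw [(Polynomial.modByMonic_eq_zero_iff_dvd (O.gen_monic k)).mpr hRg, zero_add] at h1
    rw [mul_comm, h1]
  have hRdeg : R.degree < (O.n - k₂ : ℕ) := by
    rw [← O.gen_degree]; exact Polynomial.degree_modByMonic_lt P (O.gen_monic k₂)
  have hQdeg : (R /ₘ O.gen k).degree < (k - k₂ : ℕ) := by
    by_cases h0 : R /ₘ O.gen k = 0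
    · rw [h0, Polynomial.degree_zero]; exact WithBot.bot_lt_coe _
    rw [← hQ, Polynomial.degree_mul, O.gen_degree, Polynomial.degree_eq_natDegree h0] at hRdeg
    rw [Polynomial.degree_eq_natDegree h0]
    have h2 : (R /ₘ O.gen k).natDegree + (O.n - k) < O.n - k₂ := by exact_mod_cast hRdeg
    exact_mod_cast (by omega : (R /ₘ O.gen k).natDegree < k - k₂)
  rw [messageWord, vecPoly_coeff_self hQdeg, hQ, ← map_add]
  refine Submodule.mem_map_of_mem ?_
  change _ ∈ O.rsCode k₂
  rw [O.mem_rsCode, map_add, vecPoly_coeff_self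
    (hRdeg.trans_le (by exact_mod_cast Nat.sub_le _ _))]
  have h2 : vecPoly O.n v + R = O.gen k₂ * (P /ₘ O.gen k₂) := by
    have : R + R = 0 := CharTwo.add_self_eq_zero R
    calc vecPoly O.n v + R = (R + O.gen k₂ * (P /ₘ O.gen k₂)) + R := by rw [hdiv]
      _ = (R + R) + O.gen k₂ * (P /ₘ O.gen k₂) := by ring
      _ = _ := by rw [this, zero_add]
  rw [h2]
  exact dvd_mul_right _ _

end concat

/-! ### List decoding and source encoding -/

section listDecoding
variable {N : ℕ}

lemma hammingDist_word (c w : BVec N) : hammingDist c w = hammingNorm (w + c) := by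
  rw [hammingDist_comm, ← ZModModule.sub_eq_add]
  simp [hammingDist, hammingNorm, sub_ne_zero]

lemma mem_listDecode {C : Submodule (ZMod 2) (BVec N)} {D : ℝ} (hD : 0 ≤ D) {w c : BVec N} :
    c ∈ listDecode C D w ↔ c ∈ C ∧ hammingNorm (w + c) ≤ ⌊D * N⌋₊ := by
  simp only [listDecode, Finset.mem_filter, Finset.mem_univ, true_and, hammingDist_word]
  rw [Nat.le_floor_iff (by positivity)]

lemma card_listDecode (C : Submodule (ZMod 2) (BVec N)) {D : ℝ} (hD : 0 ≤ D) (w : BVec N) :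
    (listDecode C D w).card = listSize C ⌊D * N⌋₊ w := by
  classical
  rw [listSize]
  congr 1
  ext c
  rw [mem_listDecode hD]
  simp

lemma listSize_mono (C : Submodule (ZMod 2) (BVec N)) {r r' : ℕ} (h : r ≤ r') (w : BVec N) :
    listSize C r w ≤ listSize C r' w := by
  classical
  refine Finset.card_le_card fun c hc => ?_
  simp only [Finset.mem_filter, Finset.mem_univ, true_and] at hc ⊢
  exact ⟨hc.1, hc.2.trans h⟩

lemma quantize_eq_none_iff {C : Submodule (ZMod 2) (BVec N)} {D : ℝ} (hD : 0 ≤ D) {w : BVec N} :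
    quantize C D w = none ↔ ¬ Covered C ⌊D * N⌋₊ w := by
  have : (listDecode C D w).Nonempty ↔ Covered C ⌊D * N⌋₊ w := by
    simp only [Finset.Nonempty, mem_listDecode hD, Covered]
  rw [← this, quantize]
  split_ifs with h <;> simp [h]

lemma quantize_some {C : Submodule (ZMod 2) (BVec N)} {D : ℝ} (hD : 0 ≤ D) {w c : BVec N}
    (h : quantize C D w = some c) : c ∈ C ∧ hammingNorm (w + c) ≤ ⌊D * N⌋₊ ∧
      ∀ c' ∈ C, hammingNorm (w + c) ≤ hammingNorm (w + c') := by
  rw [quantize] at h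
  split_ifs at h with hne
  have hs := Classical.choose_spec
    (Finset.exists_min_image (listDecode C D w) (fun c => hammingDist c w) hne)
  rw [Option.some_inj.mp h] at hs
  obtain ⟨h1, h2⟩ := hs
  rw [mem_listDecode hD] at h1
  refine ⟨h1.1, h1.2, fun c' hc' => ?_⟩
  by_cases hle : hammingNorm (w + c') ≤ ⌊D * N⌋₊
  · have := h2 c' ((mem_listDecode hD).mpr ⟨hc', hle⟩)
    rwa [hammingDist_word, hammingDist_word] at this
  · exact h1.2.trans (by omega)

lemma encodingError_eq (C : Submodule (ZMod 2) (BVec N)) {D : ℝ} (hD : 0 ≤ D) :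
    encodingError C D = uncovered C ⌊D * N⌋₊ := by
  classical
  rw [encodingError, uncovered]
  congr 1
  refine Finset.sum_congr rfl fun w _ => ?_
  simp only [quantize_eq_none_iff hD, ite_not]

lemma meanListSize_eq (C : Submodule (ZMod 2) (BVec N)) {D : ℝ} (hD : 0 ≤ D) :
    meanListSize C D =
      2 ^ Module.finrank (ZMod 2) C * (ballCard N ⌊D * N⌋₊ / 2 ^ N) := by
  rw [meanListSize]
  simp_rw [card_listDecode C hD]
  rw [sum_listSize, card_code]
  push_cast
  ring

end listDecoding

/-! ### Existence of good codes -/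

lemma exists_outerRS {m : ℕ} (hm : m ≠ 0) : ∃ O : OuterRS, O.m = m := by
  have : Fintype (GaloisField 2 m) := Fintype.ofFinite _
  obtain ⟨g, hg⟩ := IsCyclic.exists_generator (α := (GaloisField 2 m)ˣ)
  have hord : orderOf (g : GaloisField 2 m) = 2 ^ m - 1 := by
    rw [orderOf_units, orderOf_eq_card_of_forall_mem_zpowers hg, Nat.card_units,
      GaloisField.card 2 m hm]
  refine ⟨⟨m, g, hord, 0, LinearEquiv.ofFinrankEq _ _ ?_⟩, rfl⟩
  rw [Module.finrank_pi_fintype, Module.finrank_fin_fun]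
  simp [GaloisField.finrank 2 hm]

lemma eventually_mul_exp_le {x y : ℝ} (h : x < y) :
    ∀ᶠ N : ℕ in atTop, 4 * Real.exp (N * x) ≤ Real.exp (N * y) := by
  have h1 : Tendsto (fun N : ℕ => (N : ℝ) * (y - x)) atTop atTop :=
    tendsto_natCast_atTop_atTop.atTop_mul_const (by linarith)
  filter_upwards [h1.eventually_ge_atTop (Real.log 4)] with N hN
  rw [← Real.exp_log (by norm_num : (0 : ℝ) < 4), ← Real.exp_add]
  exact Real.exp_le_exp.mpr (by linarith)

lemma eventually_exp_le_ballCard {D y : ℝ} (h0 : 0 < D) (h1 : D < 1 / 2)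
    (hy : y < Real.binEntropy D) :
    ∀ᶠ N : ℕ in atTop, Real.exp (N * y) ≤ ballCard N ⌊D * N⌋₊ := by
  filter_upwards [(tendsto_log_ballCard h0 h1).eventually_const_lt hy, eventually_gt_atTop 0]
    with N hN hN0
  have hN' : (0 : ℝ) < N := by exact_mod_cast hN0
  have hV := one_le_ballCard N ⌊D * N⌋₊
  rw [lt_div_iff₀ hN'] at hN
  rw [← Real.le_log_iff_exp_le (by linarith)]
  linarith

lemma eventually_two_mul_ballCard_le {D' D : ℝ} (h0 : 0 < D') (h1 : D' < D) (h2 : D < 1 / 2) :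
    ∀ᶠ N : ℕ in atTop, 2 * ballCard N ⌊D' * N⌋₊ ≤ ballCard N ⌊D * N⌋₊ := by
  have hlt : Real.binEntropy D' < Real.binEntropy D :=
    Real.binEntropy_strictMonoOn ⟨h0.le, by norm_num; linarith⟩ ⟨by linarith, by norm_num; linarith⟩ h1
  obtain ⟨y, hy1, hy2⟩ := exists_between hlt
  filter_upwards [eventually_exp_le_ballCard (h0.trans h1) h2 hy2, eventually_mul_exp_le hy1]
    with N hN1 hN2
  have h3 := ballCard_le_exp (N := N) h0 (by linarith : D' ≤ 1 / 2) (Nat.floor_le (by positivity))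
  linarith [Real.exp_pos (N * Real.binEntropy D')]

lemma binEntropy_lt_log_two {D : ℝ} (h2 : D < 1 / 2) :
    Real.binEntropy D < Real.log 2 :=
  Real.binEntropy_lt_log_two.mpr (by norm_num; linarith)

lemma eventually_ballCard_le {D : ℝ} (h0 : 0 < D) (h2 : D < 1 / 2) :
    ∀ᶠ N : ℕ in atTop, ballCard N ⌊D * N⌋₊ / 2 ^ N ≤ 1 / 4 := by
  filter_upwards [eventually_mul_exp_le (binEntropy_lt_log_two h2)] with N hN
  have h3 := ballCard_le_exp (N := N) h0 h2.le (Nat.floor_le (by positivity))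
  rw [Real.exp_nat_mul, Real.exp_nat_mul, Real.exp_log two_pos, ← Real.exp_nat_mul] at hN
  rw [div_le_iff₀ (by positivity)]
  linarith

/-- Linear codes of prescribed dimension that cover almost all words and have short lists. -/
lemma exists_code_list_decodable {N m K r r' : ℕ} (hN : 1 ≤ N)
    (hr : 2 * ballCard N r' ≤ ballCard N r) (h4 : ballCard N r / 2 ^ N ≤ 1 / 4) (hK : K ≤ N)
    (h1 : (N : ℝ) ≤ 2 ^ K * (ballCard N r / 2 ^ N))
    (h2 : 2 ^ K * (ballCard N r / 2 ^ N) ≤ 2 ^ m * (N : ℝ)) :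
    ∃ C : Submodule (ZMod 2) (BVec N), Module.finrank (ZMod 2) C = K ∧
      uncovered C r ≤ (31 / 32) ^ N ∧ ∀ w, listSize C r' w ≤ 32 * 2 ^ m * N * (N + 1) := by
  obtain ⟨C, hu, hcard, hlist⟩ := exists_covering_listDecodable hr h4
  set c₀ := ballCard N r / 2 ^ N with hc
  have hc0 : 0 < c₀ := div_pos (by linarith [one_le_ballCard N r]) (by positivity)
  have hN' : (1 : ℝ) ≤ N := by exact_mod_cast hN
  have hlow : 1 / 32 ≤ (Nat.card C : ℝ) * c₀ := by
    have := one_sub_uncovered_le C r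
    rw [mul_div_assoc, ← hc] at this
    linarith
  rw [card_code] at hlow hcard
  push_cast at hlow hcard
  set f := Module.finrank (ZMod 2) C with hf
  have hfK : f ≤ K := by
    by_contra h
    have : (2 : ℝ) ^ K * c₀ ≤ 2 ^ f * c₀ := by
      gcongr
      · norm_num
      · omega
    linarith
  have hpow : (2 : ℝ) ^ (K - f) * 2 ^ f = 2 ^ K := by rw [← pow_add]; congr 1; omega
  have hj1 : N ≤ 2 ^ (K - f) := by
    have e : (2 : ℝ) ^ K * c₀ = 2 ^ (K - f) * (2 ^ f * c₀) := by rw [← hpow]; ring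
    have h3 : (2 : ℝ) ^ (K - f) * (2 ^ f * c₀) ≤ 2 ^ (K - f) * (1 / 4) := by gcongr
    have h5 : (0 : ℝ) < 2 ^ (K - f) := by positivity
    have : (N : ℝ) ≤ 2 ^ (K - f) := by linarith
    exact_mod_cast this
  have hj2 : 2 ^ (K - f) ≤ 32 * 2 ^ m * N := by
    have e : (2 : ℝ) ^ K * c₀ = 2 ^ (K - f) * (2 ^ f * c₀) := by rw [← hpow]; ring
    have h3 : (2 : ℝ) ^ (K - f) * (1 / 32) ≤ 2 ^ (K - f) * (2 ^ f * c₀) := by gcongr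
    have : (2 : ℝ) ^ (K - f) ≤ 32 * 2 ^ m * N := by linarith
    exact_mod_cast this
  obtain ⟨C', -, hdim, hu', hl'⟩ := exists_greedy_extension C r (K - f) (by omega)
  refine ⟨C', by omega, hu'.trans ?_, fun w => ?_⟩
  · calc uncovered C r ^ 2 ^ (K - f) ≤ (31 / 32) ^ 2 ^ (K - f) :=
          pow_le_pow_left₀ (uncovered_nonneg _ _) hu _
      _ ≤ (31 / 32) ^ N := pow_le_pow_of_le_one (by norm_num) (by norm_num) hj1
  · exact (hl' r' (N + 1) hlist w).trans (Nat.mul_le_mul_right _ hj2)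

lemma tendsto_outer_length : Tendsto (fun m : ℕ => (2 ^ m - 1) * m) atTop atTop := by
  refine tendsto_atTop_mono' _ ?_ tendsto_id
  filter_upwards [eventually_ge_atTop 1] with m hm
  have : 2 ≤ 2 ^ m := Nat.le_self_pow (by omega) 2
  exact Nat.le_mul_of_pos_left m (by omega)

lemma two_pow_le_outer_length {m : ℕ} (hm : 1 ≤ m) : 2 ^ m ≤ (2 ^ m - 1) * m + 1 := by
  have h1 : 1 ≤ 2 ^ m := Nat.one_le_two_pow
  have h2 : (2 ^ m - 1) * 1 ≤ (2 ^ m - 1) * m := Nat.mul_le_mul_left _ hm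
  omega

lemma tendsto_outer_rate {D : ℝ} (h0 : 0 < D) (h1 : D < 1 / 2) :
    Tendsto (fun m : ℕ => ((outerDim D ((2 ^ m - 1) * m) m * m : ℕ) : ℝ) /
      (((2 ^ m - 1) * m : ℕ) : ℝ)) atTop (𝓝 (1 - h2 D)) := by
  have h := tendsto_outerDim h0 h1 (N := fun i => (2 ^ (i + 1) - 1) * (i + 1))
    (m := fun i => i + 1) ((tendsto_add_atTop_iff_nat 1).mpr tendsto_outer_length) (fun i => by omega)
    (fun i => two_pow_le_outer_length (by omega))
  exact (tendsto_add_atTop_iff_nat 1).mp h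

lemma h2_lt_one {D : ℝ} (h : D < 1 / 2) : h2 D < 1 := by
  rw [h2, div_lt_one (Real.log_pos one_lt_two)]
  exact binEntropy_lt_log_two h

lemma h2_pos {D : ℝ} (h0 : 0 < D) (h1 : D < 1) : 0 < h2 D :=
  div_pos (Real.binEntropy_pos h0 h1) (Real.log_pos one_lt_two)

/-- Good source codes exist within the class of concatenated Reed-Solomon codes. -/
theorem exists_source_codes {D : ℝ} (hD0 : 0 < D) (hD1 : D < 1 / 2) :
    ∃ (N : ℕ → ℕ) (O : ℕ → OuterRS) (I : ∀ i, (O i).Inner (N i)) (k : ℕ → ℕ),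
      Tendsto N atTop atTop ∧
      (∀ i, 1 ≤ k i ∧ k i < (O i).n) ∧
      Tendsto (fun i => ((k i * (O i).m : ℕ) : ℝ) / N i) atTop (𝓝 (1 - h2 D)) ∧
      (∀ D' : ℝ, 0 < D' → D' < D → ∃ a : ℕ, ∀ᶠ i in atTop, ∀ w : BVec (N i),
        (listDecode (concatCode (O i) (I i) (k i)) D' w).card ≤ N i ^ a) ∧
      (∃ a : ℕ, ∀ᶠ i in atTop,
        meanListSize (concatCode (O i) (I i) (k i)) D ≤ (N i : ℝ) ^ a) ∧
      Tendsto (fun i => encodingError (concatCode (O i) (I i) (k i)) D) atTop (𝓝 0) := by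
  classical
  set L : ℕ → ℕ := fun m => (2 ^ m - 1) * m with hL
  have hLt : Tendsto L atTop atTop := tendsto_outer_length
  have hrate := tendsto_outer_rate hD0 hD1
  set κ : ℕ → ℕ := fun m => outerDim D (L m) m with hκ
  set ρ : ℕ → ℕ := fun N =>
    Nat.findGreatest (fun r' => 2 * ballCard N r' ≤ ballCard N ⌊D * N⌋₊) N with hρ
  have hρle : ∀ D' : ℝ, 0 < D' → D' < D → ∀ᶠ N : ℕ in atTop,
      2 * ballCard N (ρ N) ≤ ballCard N ⌊D * N⌋₊ ∧ ⌊D' * N⌋₊ ≤ ρ N := by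
    intro D' h1 h2
    filter_upwards [eventually_two_mul_ballCard_le h1 h2 hD1] with N hN
    have hle : ⌊D' * N⌋₊ ≤ N := by
      refine Nat.floor_le_of_le ?_
      have : (0 : ℝ) ≤ N := by positivity
      nlinarith
    exact ⟨Nat.findGreatest_spec (P := fun r' => 2 * ballCard N r' ≤ ballCard N ⌊D * N⌋₊) hle hN,
      Nat.le_findGreatest hle hN⟩
  have hev : ∀ᶠ m : ℕ in atTop, 2 ≤ m ∧ 128 ≤ L m ∧ 0 < κ m ∧ κ m < 2 ^ m - 1 ∧
      2 * ballCard (L m) (ρ (L m)) ≤ ballCard (L m) ⌊D * L m⌋₊ ∧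
      ballCard (L m) ⌊D * L m⌋₊ / 2 ^ L m ≤ 1 / 4 := by
    filter_upwards [eventually_ge_atTop 2, hLt.eventually_ge_atTop 128,
      hrate.eventually_lt_const (show 1 - h2 D < 1 by linarith [h2_pos hD0 (by linarith)]),
      hrate.eventually_const_lt (show 0 < 1 - h2 D by linarith [h2_lt_one hD1]),
      hLt.eventually (hρle (D / 2) (by linarith) (by linarith)),
      hLt.eventually (eventually_ballCard_le hD0 hD1)] with m e1 e2 e3 e4 e5 e6
    have hL0 : (0 : ℝ) < ((L m : ℕ) : ℝ) := by exact_mod_cast (by omega : 0 < L m)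
    refine ⟨e1, e2, ?_, ?_, e5.1, e6⟩
    · by_contra h
      have h0 : outerDim D ((2 ^ m - 1) * m) m = 0 := by
        have : κ m = 0 := by omega
        exact this
      rw [h0] at e4
      simp at e4
    · rw [div_lt_one hL0] at e3
      have h3 : κ m * m < (2 ^ m - 1) * m := by exact_mod_cast e3
      exact Nat.lt_of_mul_lt_mul_right h3
  obtain ⟨i₀, hi₀⟩ := eventually_atTop.mp hev
  have hex : ∀ i : ℕ, ∃ (O : OuterRS) (I : O.Inner (L (i + i₀))), O.m = i + i₀ ∧
      Module.finrank (ZMod 2) (concatCode O I (κ (i + i₀))) = κ (i + i₀) * (i + i₀) ∧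
      uncovered (concatCode O I (κ (i + i₀))) ⌊D * L (i + i₀)⌋₊ ≤ (31 / 32) ^ L (i + i₀) ∧
      ∀ w, listSize (concatCode O I (κ (i + i₀))) (ρ (L (i + i₀))) w ≤
        32 * 2 ^ (i + i₀) * L (i + i₀) * (L (i + i₀) + 1) := by
    intro i
    set m := i + i₀ with hm
    obtain ⟨e1, e2, e3, e4, e5, e6⟩ := hi₀ m (by omega)
    obtain ⟨O, hO⟩ := exists_outerRS (m := m) (by omega)
    have hn : O.n = 2 ^ m - 1 := by rw [← hO]
    have hlen : O.n * O.m = L m := by rw [hO, hn]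
    have hK : κ m * m ≤ L m := Nat.mul_le_mul_right _ e4.le
    obtain ⟨C, hC1, hC2, hC3⟩ := exists_code_list_decodable (m := m) (by omega) e5 e6 hK
      (le_two_pow_outerDim D (by omega) (by omega)) (two_pow_outerDim_le D (by omega) (by omega))
    let g : BVec (O.n * O.m) ≃ₗ[ZMod 2] BVec (L m) :=
      LinearEquiv.ofFinrankEq _ _ (by rw [hlen])
    let I₀ : O.Inner (L m) := InnerBLBC.ofLinear (by omega) g.toLinearMap g.injective
    have hbot : concatCode O I₀ 0 = ⊥ := by
      rw [← Submodule.finrank_eq_zero (R := ZMod 2),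
        finrank_concatCode O I₀ (Nat.zero_le _) (by omega), zero_mul]
    obtain ⟨I, -, hI⟩ := exists_inner_concatCode_eq O I₀ (k₂ := 0) (k := κ m) (Nat.zero_le _)
      (by omega) (by omega) (by omega) (C := C) (by rw [hbot]; exact bot_le) (by rw [hC1, hO])
    exact ⟨O, I, hO, by rw [hI]; exact hC1, by rw [hI]; exact hC2, by rw [hI]; exact hC3⟩
  choose O I hOm hdim hunc hlist using hex
  have hshift : Tendsto (fun i : ℕ => i + i₀) atTop atTop := tendsto_add_atTop_nat i₀
  have hN : Tendsto (fun i => L (i + i₀)) atTop atTop := hLt.comp hshift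
  have hpoly : ∀ i, 2 ^ (i + i₀) ≤ L (i + i₀) + 1 := fun i =>
    two_pow_le_outer_length (by have := (hi₀ (i + i₀) (by omega)).1; omega)
  refine ⟨fun i => L (i + i₀), O, I, fun i => κ (i + i₀), hN, fun i => ?_, ?_, ?_, ?_, ?_⟩
  · obtain ⟨-, -, e3, e4, -⟩ := hi₀ (i + i₀) (by omega)
    have : (O i).n = 2 ^ (i + i₀) - 1 := by rw [← hOm i]
    exact ⟨e3, by rw [this]; exact e4⟩
  · simp_rw [hOm]
    exact hrate.comp hshift
  · intro D' h1 h2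
    refine ⟨4, ?_⟩
    filter_upwards [hN.eventually (hρle D' h1 h2)] with i hi w
    rw [card_listDecode _ h1.le]
    refine (listSize_mono _ hi.2 w).trans ((hlist i w).trans ?_)
    obtain ⟨-, e2, -⟩ := hi₀ (i + i₀) (by omega)
    have hp := hpoly i
    set n := L (i + i₀)
    calc 32 * 2 ^ (i + i₀) * n * (n + 1) ≤ 32 * (n + 1) * n * (n + 1) := by gcongr
      _ ≤ 32 * (2 * n) * n * (2 * n) := by gcongr <;> omega
      _ = 128 * n ^ 3 := by ring
      _ ≤ n * n ^ 3 := by gcongr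
      _ = n ^ 4 := by ring
  · refine ⟨3, Eventually.of_forall fun i => ?_⟩
    obtain ⟨e1, e2, -⟩ := hi₀ (i + i₀) (by omega)
    rw [meanListSize_eq _ hD0.le, hdim]
    refine (two_pow_outerDim_le D (by omega) (by omega)).trans ?_
    have hp := hpoly i
    set n := L (i + i₀)
    have : 2 ^ (i + i₀) * n ≤ n ^ 3 := by
      calc 2 ^ (i + i₀) * n ≤ (n + 1) * n := by gcongr
        _ ≤ (n * n) * n := by gcongr; nlinarith
        _ = n ^ 3 := by ring
    exact_mod_cast this
  · simp_rw [encodingError_eq _ hD0.le]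
    refine squeeze_zero (fun i => uncovered_nonneg _ _) hunc ?_
    exact (tendsto_pow_atTop_nhds_zero_of_lt_one (by norm_num) (by norm_num)).comp hN

/-! ### The Wyner-Ziv scheme -/

section scheme
variable {N : ℕ}

lemma bern_zero (z : BVec N) : bern 0 z = if z = 0 then 1 else 0 := by
  rw [bern_eq, sub_zero, one_pow, mul_one]
  split_ifs with h
  · simp [h]
  · exact zero_pow (hammingNorm_ne_zero_iff.mpr h)

open Classical in
lemma leaderFail_zero (C : Submodule (ZMod 2) (BVec N)) (t : BVec N) :
    leaderFail 0 C t = if IsLeader C t then 0 else 1 := by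
  rw [leaderFail, Finset.sum_eq_single 0]
  · simp [bern_zero]
  · intro s _ hs; simp [bern_zero, hs]
  · simp

/-- A code half of whose noise words of weight at most `r` are coset leaders extends to a good
covering code. -/
lemma exists_nested_cover (C₂ : Submodule (ZMod 2) (BVec N)) {r K : ℕ}
    (hlead : ballSum (leaderFail 0 C₂) r ≤ 1 / 2 * ballCard N r)
    (hK₂ : Module.finrank (ZMod 2) C₂ ≤ K) (hK : K ≤ N) :
    ∃ C : Submodule (ZMod 2) (BVec N), C₂ ≤ C ∧ Module.finrank (ZMod 2) C = K ∧
      uncovered C r ≤ Real.exp (-(2 ^ K * ballCard N r / 2 ^ N) / 2) := by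
  classical
  obtain ⟨C, h1, h2, h3, -⟩ := exists_greedy_extension C₂ r (K - Module.finrank (ZMod 2) C₂)
    (by omega)
  refine ⟨C, h1, by omega, h3.trans ?_⟩
  have hsum : ballSum (fun z => if IsLeader C₂ z then (1 : ℝ) else 0) r +
      ballSum (leaderFail 0 C₂) r = ballCard N r := by
    rw [ballCard, ballSum, ballSum, ballSum, ← Finset.sum_add_distrib]
    refine Finset.sum_congr rfl fun z _ => ?_
    rw [leaderFail_zero]
    split_ifs <;> simp
  have hu := one_sub_uncovered_ge C₂ r
  have hge : (Nat.card C₂ : ℝ) * (1 / 2 * ballCard N r) / 2 ^ N ≤ 1 - uncovered C₂ r := by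
    refine le_trans ?_ hu
    gcongr
    linarith
  set x := (Nat.card C₂ : ℝ) * (1 / 2 * ballCard N r) / 2 ^ N with hx
  have hle : uncovered C₂ r ≤ Real.exp (-x) := by
    have := Real.add_one_le_exp (-x)
    linarith
  calc uncovered C₂ r ^ 2 ^ (K - Module.finrank (ZMod 2) C₂)
      ≤ Real.exp (-x) ^ 2 ^ (K - Module.finrank (ZMod 2) C₂) :=
        pow_le_pow_left₀ (uncovered_nonneg _ _) hle _
    _ = _ := by
        rw [← Real.exp_nat_mul]
        congr 1
        have : (2 : ℝ) ^ K = 2 ^ (K - Module.finrank (ZMod 2) C₂) *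
            2 ^ Module.finrank (ZMod 2) C₂ := by
          rw [← pow_add]; congr 1; omega
        rw [hx, card_code, this]
        push_cast
        ring

lemma wzReconstruct_eq (O : OuterRS) (I : O.Inner N) {k₂ k : ℕ} (hk₂ : k₂ ≤ k) (hk : k ≤ O.n)
    {D : ℝ} (hD : 0 ≤ D) {w s c : BVec N} (hc : quantize (concatCode O I k) D w = some c)
    (hs : IsLeader (concatCode O I k₂) (w + c + s)) :
    wzReconstruct O I k₂ k D (leaderDecoder (concatCode O I k₂)) w s = c := by
  have hmem := add_messageWord_mem O I hk₂ hk (quantize_some hD hc).1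
  rw [wzReconstruct, wzDecode]
  unfold wzEncode
  rw [hc, Option.getD_some]
  set a := messageWord O I k₂ k _
  have e : a + (w + s) = (c + a) + (w + c + s) := by
    rw [show c + a + (w + c + s) = a + (w + s) + (c + c) by abel, ZModModule.add_self, add_zero]
  rw [e, (leaderDecoder_eq_iff hmem _).mpr hs, add_comm c a, ← add_assoc, ZModModule.add_self,
    zero_add]

/-- Failure probability of the scheme with the minimum distance channel decoder. -/
lemma sourceProb_ne_le (O : OuterRS) (I : O.Inner N) {k₂ k : ℕ} (hk₂ : k₂ ≤ k) (hk : k ≤ O.n)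
    {p D : ℝ} (hp0 : 0 ≤ p) (hp1 : p ≤ 1) (hD : 0 ≤ D) {r : ℕ} (hr : r ≤ ⌊D * N⌋₊) :
    sourceProb p (fun w s => quantize (concatCode O I k) D w ≠
      some (wzReconstruct O I k₂ k D (leaderDecoder (concatCode O I k₂)) w s)) ≤
      uncovered (concatCode O I k) r +
        2 ^ Module.finrank (ZMod 2) (concatCode O I k) / 2 ^ N *
          ballSum (leaderFail p (concatCode O I k₂)) r := by
  classical
  set C := concatCode O I k
  set C₂ := concatCode O I k₂
  have hpos : (0 : ℝ) < 2 ^ N := by positivity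
  have hw : ∀ w : BVec N, ∑ s : BVec N, bern p s * (if quantize C D w ≠
      some (wzReconstruct O I k₂ k D (leaderDecoder C₂) w s) then 1 else 0) ≤
      (if Covered C r w then 0 else 1) +
        ∑ c : BVec N, (if c ∈ C ∧ hammingNorm (w + c) ≤ r then leaderFail p C₂ (w + c) else 0) := by
    intro w
    have hnn : ∀ c : BVec N, 0 ≤
        (if c ∈ C ∧ hammingNorm (w + c) ≤ r then leaderFail p C₂ (w + c) else 0) := fun c => by
      split_ifs
      exacts [leaderFail_nonneg hp0 hp1 _ _, le_rfl]
    by_cases hcov : Covered C r w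
    · rw [if_pos hcov, zero_add]
      obtain ⟨c₀, hc₀, hc₀r⟩ := hcov
      have hne : quantize C D w ≠ none := by
        rw [Ne, quantize_eq_none_iff hD, not_not]
        exact ⟨c₀, hc₀, hc₀r.trans hr⟩
      obtain ⟨c, hc⟩ := Option.ne_none_iff_exists'.mp hne
      obtain ⟨hcC, -, hmin⟩ := quantize_some hD hc
      refine le_trans ?_ (Finset.single_le_sum (fun c _ => hnn c) (Finset.mem_univ c))
      rw [if_pos ⟨hcC, (hmin c₀ hc₀).trans hc₀r⟩, leaderFail]
      refine Finset.sum_le_sum fun s _ => mul_le_mul_of_nonneg_left ?_ (bern_nonneg hp0 hp1 s)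
      by_cases hs : IsLeader C₂ (w + c + s)
      · rw [if_pos hs, if_neg]
        rw [not_not, hc, wzReconstruct_eq O I hk₂ hk hD hc hs]
      · rw [if_neg hs]; split_ifs <;> norm_num
    · rw [if_neg hcov]
      have h1 : ∑ s : BVec N, bern p s * (if quantize C D w ≠
          some (wzReconstruct O I k₂ k D (leaderDecoder C₂) w s) then 1 else 0) ≤ 1 := by
        refine le_of_le_of_eq (Finset.sum_le_sum fun s _ => ?_) (sum_bern p N)
        have := bern_nonneg hp0 hp1 s
        split_ifs <;> simp [this]
      linarith [Finset.sum_nonneg fun c (_ : c ∈ Finset.univ) => hnn c]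
  have hs := Finset.sum_le_sum fun w (_ : w ∈ Finset.univ) => hw w
  rw [Finset.sum_add_distrib, sum_listSize_mul, card_code] at hs
  have he : sourceProb p (fun w s => quantize C D w ≠
      some (wzReconstruct O I k₂ k D (leaderDecoder C₂) w s)) =
      (∑ w : BVec N, ∑ s : BVec N, bern p s * (if quantize C D w ≠
      some (wzReconstruct O I k₂ k D (leaderDecoder C₂) w s) then 1 else 0)) / 2 ^ N := by
    rw [sourceProb, Finset.sum_div]
    refine Finset.sum_congr rfl fun w _ => ?_
    rw [Finset.sum_div]
    refine Finset.sum_congr rfl fun s _ => ?_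
    split_ifs <;> ring
  rw [he, uncovered, div_mul_eq_mul_div, ← add_div]
  gcongr
  push_cast at hs
  exact hs

lemma sourceProb_mono {p : ℝ} (hp0 : 0 ≤ p) (hp1 : p ≤ 1) {E E' : BVec N → BVec N → Prop}
    (h : ∀ w s, E w s → E' w s) : sourceProb p E ≤ sourceProb p E' := by
  classical
  refine Finset.sum_le_sum fun w _ => Finset.sum_le_sum fun s _ =>
    mul_le_mul_of_nonneg_left ?_ (mul_nonneg (by positivity) (bern_nonneg hp0 hp1 s))
  by_cases hE : E w s
  · rw [if_pos hE, if_pos (h w s hE)]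
  · rw [if_neg hE]; split_ifs <;> norm_num

lemma sourceProb_nonneg {p : ℝ} (hp0 : 0 ≤ p) (hp1 : p ≤ 1) (E : BVec N → BVec N → Prop) :
    0 ≤ sourceProb p E := by
  classical
  exact Finset.sum_nonneg fun w _ => Finset.sum_nonneg fun s _ =>
    mul_nonneg (mul_nonneg (by positivity) (bern_nonneg hp0 hp1 s)) (by split_ifs <;> norm_num)

lemma sourceProb_le_one {p : ℝ} (hp0 : 0 ≤ p) (hp1 : p ≤ 1) (E : BVec N → BVec N → Prop) :
    sourceProb p E ≤ 1 := by
  classical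
  calc sourceProb p E ≤ ∑ w : BVec N, ∑ s : BVec N, (1 / 2 ^ N) * bern p s := by
        refine Finset.sum_le_sum fun w _ => Finset.sum_le_sum fun s _ => ?_
        have := mul_nonneg (by positivity : (0 : ℝ) ≤ 1 / 2 ^ N) (bern_nonneg hp0 hp1 s)
        split_ifs <;> linarith
    _ = 1 := by
        simp_rw [← Finset.mul_sum, sum_bern]
        simp

/-! ### Time sharing -/

open Classical in
lemma bern_chebyshev {q : ℝ} (h0 : 0 ≤ q) (h1 : q ≤ 1) (T : ℕ) {x : ℝ} (hx : 0 < x) :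
    ∑ s : BVec T, bern q s * (if q * T + x < hammingNorm s then 1 else 0) ≤ T / x ^ 2 := by
  rw [le_div_iff₀ (by positivity), Finset.sum_mul]
  calc _ ≤ ∑ s : BVec T, bern q s * ((hammingNorm s : ℝ) - q * T) ^ 2 := by
        refine Finset.sum_le_sum fun s _ => ?_
        rw [mul_assoc]
        refine mul_le_mul_of_nonneg_left ?_ (bern_nonneg h0 h1 s)
        split_ifs with h
        · rw [one_mul]
          exact pow_le_pow_left₀ hx.le (by linarith) 2
        · rw [zero_mul]; positivity
    _ = T * (q * (1 - q)) := bern_variance q T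
    _ ≤ T := by
        have : q * (1 - q) ≤ 1 := by nlinarith
        exact mul_le_of_le_one_right (by positivity) this

lemma timeSharedExcess_le {p D δ x : ℝ} (hp0 : 0 ≤ p) (hp1 : p ≤ 1)
    (rec : BVec N → BVec N → BVec N) (T : ℕ) (hx : 0 < x)
    (hδ : D * N + p * T + x ≤ δ * ((N : ℝ) + T)) :
    timeSharedExcess p rec T δ ≤
      sourceProb p (fun w s => D * N < (hammingDist w (rec w s) : ℝ)) + T / x ^ 2 := by
  classical
  set E := sourceProb p (fun w s : BVec N => D * N < (hammingDist w (rec w s) : ℝ))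
  have h : ∀ s' : BVec T, bern p s' * sourceProb p (fun w s : BVec N =>
      δ * ((N : ℝ) + T) < (hammingDist w (rec w s) : ℝ) + (hammingNorm s' : ℝ)) ≤
      bern p s' * E + bern p s' * (if p * T + x < hammingNorm s' then 1 else 0) := by
    intro s'
    rw [← mul_add]
    refine mul_le_mul_of_nonneg_left ?_ (bern_nonneg hp0 hp1 s')
    split_ifs with hs
    · linarith [sourceProb_le_one hp0 hp1 (fun w s : BVec N =>
        δ * ((N : ℝ) + T) < (hammingDist w (rec w s) : ℝ) + (hammingNorm s' : ℝ)),
        sourceProb_nonneg hp0 hp1 (fun w s : BVec N => D * N < (hammingDist w (rec w s) : ℝ))]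
    · rw [add_zero]
      refine sourceProb_mono hp0 hp1 fun w s hE => ?_
      linarith
  calc timeSharedExcess p rec T δ ≤ _ := Finset.sum_le_sum fun s' _ => h s'
    _ = E + ∑ s' : BVec T, bern p s' * (if p * T + x < hammingNorm s' then 1 else 0) := by
        rw [Finset.sum_add_distrib, ← Finset.sum_mul, sum_bern, one_mul]
    _ ≤ _ := by gcongr; exact bern_chebyshev hp0 hp1 T hx

end scheme

lemma exists_time_fraction {N : ℕ → ℕ} (hN : Tendsto N atTop atTop) {θ : ℝ} (h0 : 0 ≤ θ)
    (h1 : θ ≤ 1) :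
    ∃ T : ℕ → ℕ, Tendsto (fun i => (N i : ℝ) / ((N i : ℝ) + T i)) atTop (𝓝 θ) := by
  have hNR : Tendsto (fun i => (N i : ℝ)) atTop atTop := tendsto_natCast_atTop_atTop.comp hN
  rcases h0.eq_or_lt with rfl | hpos
  · refine ⟨fun i => N i ^ 2, ?_⟩
    have : Tendsto (fun i => ((N i : ℝ) + 1)⁻¹) atTop (𝓝 0) :=
      tendsto_inv_atTop_zero.comp (hNR.atTop_add tendsto_const_nhds)
    refine this.congr' ?_
    filter_upwards [hN.eventually_gt_atTop 0] with i hi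
    have hi' : (0 : ℝ) < N i := by exact_mod_cast hi
    push_cast
    field_simp
    ring
  · refine ⟨fun i => ⌈(N i : ℝ) * (1 / θ - 1)⌉₊, ?_⟩
    have hθ : 0 ≤ 1 / θ - 1 := by
      rw [sub_nonneg, le_div_iff₀ hpos]; linarith
    have hinv : Tendsto (fun i => ((N i : ℝ) + ⌈(N i : ℝ) * (1 / θ - 1)⌉₊) / (N i : ℝ)) atTop
        (𝓝 (1 / θ)) := by
      have hup : Tendsto (fun i => 1 / θ + (N i : ℝ)⁻¹) atTop (𝓝 (1 / θ + 0)) :=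
        tendsto_const_nhds.add (tendsto_inv_atTop_zero.comp hNR)
      rw [add_zero] at hup
      refine tendsto_of_tendsto_of_tendsto_of_le_of_le' tendsto_const_nhds hup ?_ ?_
      · filter_upwards [hN.eventually_gt_atTop 0] with i hi
        have hi' : (0 : ℝ) < N i := by exact_mod_cast hi
        rw [le_div_iff₀ hi']
        have := Nat.le_ceil ((N i : ℝ) * (1 / θ - 1))
        linarith
      · filter_upwards [hN.eventually_gt_atTop 0] with i hi
        have hi' : (0 : ℝ) < N i := by exact_mod_cast hi
        rw [div_le_iff₀ hi', add_mul, inv_mul_cancel₀ hi'.ne']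
        have := Nat.ceil_lt_add_one (mul_nonneg hi'.le hθ)
        linarith
    have := hinv.inv₀ (by positivity)
    simpa using this

/-- Time sharing with the point `(p, 0)`. -/
lemma exists_time_sharing {p D R : ℝ} (hp0 : 0 ≤ p) (hp1 : p ≤ 1) {N K : ℕ → ℕ}
    (hN : Tendsto N atTop atTop) (hK : Tendsto (fun i => (K i : ℝ) / N i) atTop (𝓝 R))
    (rec : ∀ i, BVec (N i) → BVec (N i) → BVec (N i))
    (hrec : Tendsto (fun i => sourceProb p fun w s =>
      D * N i < (hammingDist w (rec i w s) : ℝ)) atTop (𝓝 0)) {θ : ℝ} (h0 : 0 ≤ θ) (h1 : θ ≤ 1) :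
    ∃ T : ℕ → ℕ,
      Tendsto (fun i => (K i : ℝ) / ((N i : ℝ) + T i)) atTop (𝓝 (θ * R)) ∧
      ∀ ε : ℝ, 0 < ε → Tendsto (fun i => timeSharedExcess p (rec i) (T i)
        (θ * D + (1 - θ) * p + ε)) atTop (𝓝 0) := by
  obtain ⟨T, hT⟩ := exists_time_fraction hN h0 h1
  have hNR : Tendsto (fun i => (N i : ℝ)) atTop atTop := tendsto_natCast_atTop_atTop.comp hN
  refine ⟨T, ?_, fun ε hε => ?_⟩
  · refine (hT.mul hK).congr' ?_
    filter_upwards [hN.eventually_gt_atTop 0] with i hi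
    have hi' : (0 : ℝ) < N i := by exact_mod_cast hi
    field_simp
  · have hinv : Tendsto (fun i => (4 / ε ^ 2) * (N i : ℝ)⁻¹) atTop (𝓝 ((4 / ε ^ 2) * 0)) :=
      (tendsto_inv_atTop_zero.comp hNR).const_mul _
    have hup := hrec.add hinv
    rw [mul_zero, add_zero] at hup
    have hgap : Tendsto (fun i => ε + (D - p) * (θ - (N i : ℝ) / ((N i : ℝ) + T i))) atTop
        (𝓝 (ε + (D - p) * (θ - θ))) :=
      tendsto_const_nhds.add (tendsto_const_nhds.mul (tendsto_const_nhds.sub hT))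
    rw [sub_self, mul_zero, add_zero] at hgap
    refine squeeze_zero' (Eventually.of_forall fun i => ?_) ?_ hup
    · exact Finset.sum_nonneg fun s' _ =>
        mul_nonneg (bern_nonneg hp0 hp1 s') (sourceProb_nonneg hp0 hp1 _)
    · filter_upwards [hN.eventually_gt_atTop 0,
        hgap.eventually_const_lt (show ε / 2 < ε by linarith)] with i hi hg
      have hi' : (0 : ℝ) < N i := by exact_mod_cast hi
      have hTi : (0 : ℝ) ≤ T i := by positivity
      have hS : 0 < (N i : ℝ) + T i := by linarith
      have hx : 0 < ε / 2 * ((N i : ℝ) + T i) := by positivity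
      refine (timeSharedExcess_le (D := D) hp0 hp1 (rec i) (T i) hx ?_).trans ?_
      · have h3 : ε / 2 * ((N i : ℝ) + T i) ≤
            (ε + (D - p) * (θ - (N i : ℝ) / ((N i : ℝ) + T i))) * ((N i : ℝ) + T i) := by
          gcongr
        have h4 : (N i : ℝ) / ((N i : ℝ) + T i) * ((N i : ℝ) + T i) = N i := by field_simp
        have h5 : (ε + (D - p) * (θ - (N i : ℝ) / ((N i : ℝ) + T i))) * ((N i : ℝ) + T i) =
            ε * ((N i : ℝ) + T i) + (D - p) * (θ * ((N i : ℝ) + T i) - N i) := by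
          rw [← h4]; field_simp
        linarith
      · gcongr
        rw [mul_pow, div_le_iff₀ (by positivity)]
        have h6 : (T i : ℝ) * N i ≤ ((N i : ℝ) + T i) ^ 2 := by nlinarith
        calc (T i : ℝ) = (T i : ℝ) * N i * (N i : ℝ)⁻¹ := by field_simp
          _ ≤ ((N i : ℝ) + T i) ^ 2 * (N i : ℝ)⁻¹ := by gcongr
          _ = _ := by field_simp; ring

lemma bconv_zero_left (q : ℝ) : bconv 0 q = q := by simp [bconv]

lemma lt_bconv {p D : ℝ} (hp : 0 < p) (hD : D < 1 / 2) : D < bconv p D := by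
  rw [bconv]; nlinarith

lemma bconv_lt_half {p D : ℝ} (hp : p < 1 / 2) (hD : D < 1 / 2) : bconv p D < 1 / 2 := by
  rw [bconv]; nlinarith

lemma h2_strictMono {x y : ℝ} (hx : 0 ≤ x) (hxy : x < y) (hy : y ≤ 1 / 2) : h2 x < h2 y :=
  div_lt_div_of_pos_right (Real.binEntropy_strictMonoOn ⟨hx, by norm_num; linarith⟩
    ⟨by linarith, by norm_num; linarith⟩ hxy) (Real.log_pos one_lt_two)

/-- Threshold for the mean number of codewords in a ball: it tends to infinity, but slowly compared
with `1 / η`. -/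
def listTarget (η : ℝ) (N : ℕ) : ℝ := 1 / √(η + 1 / N)

/-- The radius at which the mean number of codewords reaches the threshold. -/
def coverRadius (L : ℝ) (N K : ℕ) : ℕ := sInf {r : ℕ | L ≤ 2 ^ K * ballCard N r / 2 ^ N}

/-- The radius `coverRadius` lies below `D N`, and the mean number of codewords in the ball is of
the order of the threshold. -/
lemma coverRadius_spec {D L : ℝ} (hD : 0 < D) {N K : ℕ} (hL1 : 1 ≤ L)
    (hLN : L ≤ 2 ^ K * ballCard N ⌊D * N⌋₊ / 2 ^ N)
    (hsmall : 2 ^ K * ballCard N ⌊D / 2 * N⌋₊ / 2 ^ N < 1) :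
    coverRadius L N K ≤ ⌊D * N⌋₊ ∧
      L ≤ 2 ^ K * ballCard N (coverRadius L N K) / 2 ^ N ∧
      2 ^ K * ballCard N (coverRadius L N K) / 2 ^ N ≤ (1 + 1 / (D / 2)) * L := by
  set S := {r : ℕ | L ≤ 2 ^ K * ballCard N r / 2 ^ N} with hS
  have hmem : coverRadius L N K ∈ S := Nat.sInf_mem ⟨_, hLN⟩
  have hle : coverRadius L N K ≤ ⌊D * N⌋₊ := Nat.sInf_le hLN
  refine ⟨hle, hmem, ?_⟩
  have hlt : ⌊D / 2 * N⌋₊ < coverRadius L N K := by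
    by_contra h
    have h1 : ballCard N (coverRadius L N K) ≤ ballCard N ⌊D / 2 * N⌋₊ :=
      ballCard_mono N (not_lt.mp h)
    have h2 : 2 ^ K * ballCard N (coverRadius L N K) / 2 ^ N ≤
        2 ^ K * ballCard N ⌊D / 2 * N⌋₊ / 2 ^ N := by gcongr
    have h3 : L ≤ 2 ^ K * ballCard N (coverRadius L N K) / 2 ^ N := hmem
    linarith
  obtain ⟨r, hr⟩ : ∃ r, coverRadius L N K = r + 1 := ⟨coverRadius L N K - 1, by omega⟩
  rw [hr]
  have hnot : 2 ^ K * ballCard N r / 2 ^ N < L := by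
    by_contra h
    have : coverRadius L N K ≤ r := Nat.sInf_le (not_lt.mp h)
    omega
  have hx : D / 2 * N ≤ r + 1 := by
    have h1 := Nat.lt_floor_add_one (D / 2 * N)
    have h2 : ((⌊D / 2 * N⌋₊ : ℕ) : ℝ) ≤ r := by exact_mod_cast (by omega : ⌊D / 2 * N⌋₊ ≤ r)
    linarith
  have hb := ballCard_succ_le (by positivity : 0 < D / 2) hx
  calc 2 ^ K * ballCard N (r + 1) / 2 ^ N
      ≤ 2 ^ K * ((1 + 1 / (D / 2)) * ballCard N r) / 2 ^ N := by gcongr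
    _ = (1 + 1 / (D / 2)) * (2 ^ K * ballCard N r / 2 ^ N) := by ring
    _ ≤ _ := by gcongr

lemma bscError_nonneg {q : ℝ} (h0 : 0 ≤ q) (h1 : q ≤ 1) {N : ℕ}
    (C : Submodule (ZMod 2) (BVec N)) (dec : BVec N → BVec N) : 0 ≤ bscError q C dec := by
  classical
  refine div_nonneg (Finset.sum_nonneg fun c _ => Finset.sum_nonneg fun z _ =>
    mul_nonneg (bern_nonneg h0 h1 z) ?_) (by positivity)
  split_ifs <;> norm_num

/-- Few codewords of a code of rate close to `1 - h(D)` lie in balls of relative radius `D / 2`. -/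
lemma eventually_small_list {D : ℝ} (hD0 : 0 < D) (hD1 : D < 1 / 2) {N K : ℕ → ℕ}
    (hN : Tendsto N atTop atTop) (hK : Tendsto (fun i => (K i : ℝ) / N i) atTop (𝓝 (1 - h2 D))) :
    ∀ᶠ i in atTop, 2 ^ K i * ballCard (N i) ⌊D / 2 * N i⌋₊ / 2 ^ N i < 1 := by
  have hlt : 1 - h2 D < 1 - h2 (D / 2) := by
    linarith [h2_strictMono (x := D / 2) (y := D) (by linarith) (by linarith) hD1.le]
  filter_upwards [hK.eventually_lt_const hlt, hN.eventually_gt_atTop 0] with i h1 h2'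
  have hN' : (0 : ℝ) < N i := by exact_mod_cast h2'
  have hlog := Real.log_pos one_lt_two
  have hb := ballCard_le_exp (N := N i) (by linarith : 0 < D / 2) (by linarith)
    (Nat.floor_le (by positivity : 0 ≤ D / 2 * (N i : ℝ)))
  rw [div_lt_iff₀ hN', h2] at h1
  have h3 : (K i : ℝ) * Real.log 2 + N i * Real.binEntropy (D / 2) < N i * Real.log 2 := by
    have := mul_lt_mul_of_pos_right h1 hlog
    have e : (1 - Real.binEntropy (D / 2) / Real.log 2) * N i * Real.log 2 =
        N i * Real.log 2 - N i * Real.binEntropy (D / 2) := by field_simp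
    linarith
  have e2 : ∀ n : ℕ, (2 : ℝ) ^ n = Real.exp (n * Real.log 2) := fun n => by
    rw [Real.exp_nat_mul, Real.exp_log two_pos]
  rw [div_lt_one (by positivity)]
  calc 2 ^ K i * ballCard (N i) ⌊D / 2 * N i⌋₊
      ≤ 2 ^ K i * Real.exp (N i * Real.binEntropy (D / 2)) := by gcongr
    _ = Real.exp ((K i : ℝ) * Real.log 2 + N i * Real.binEntropy (D / 2)) := by
        rw [Real.exp_add, e2]
    _ < Real.exp (N i * Real.log 2) := Real.exp_lt_exp.mpr h3
    _ = 2 ^ N i := (e2 _).symm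

lemma tendsto_listTarget {η : ℕ → ℝ} {N : ℕ → ℕ} (hη : ∀ i, 0 ≤ η i)
    (hη0 : Tendsto η atTop (𝓝 0)) (hN : Tendsto N atTop atTop) :
    Tendsto (fun i => listTarget (η i) (N i)) atTop atTop ∧
      Tendsto (fun i => listTarget (η i) (N i) * η i) atTop (𝓝 0) ∧
      ∀ᶠ i in atTop, listTarget (η i) (N i) ≤ N i := by
  have hNR : Tendsto (fun i => (N i : ℝ)) atTop atTop := tendsto_natCast_atTop_atTop.comp hN
  have h1 : Tendsto (fun i => η i + 1 / (N i : ℝ)) atTop (𝓝 0) := by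
    have := hη0.add (tendsto_inv_atTop_zero.comp hNR)
    simpa [one_div] using this
  have h2 : Tendsto (fun i => √(η i + 1 / (N i : ℝ))) atTop (𝓝 0) := by
    have := (Real.continuous_sqrt.tendsto 0).comp h1
    rw [Real.sqrt_zero] at this
    exact this
  have hpos : ∀ᶠ i in atTop, 0 < η i + 1 / (N i : ℝ) := by
    filter_upwards [hN.eventually_gt_atTop 0] with i hi
    have : (0 : ℝ) < N i := by exact_mod_cast hi
    have := hη i
    positivity
  refine ⟨?_, ?_, ?_⟩
  · have h3 : Tendsto (fun i => √(η i + 1 / (N i : ℝ))) atTop (𝓝[>] 0) :=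
      tendsto_nhdsWithin_iff.mpr ⟨h2, hpos.mono fun i hi => Real.sqrt_pos.mpr hi⟩
    simp only [listTarget, one_div] at h3 ⊢
    exact tendsto_inv_nhdsGT_zero.comp h3
  · refine squeeze_zero' ?_ ?_ h2
    · exact Eventually.of_forall fun i => mul_nonneg (by rw [listTarget]; positivity) (hη i)
    · filter_upwards [hpos] with i hi
      have hs := Real.sqrt_pos.mpr hi
      rw [listTarget, div_mul_eq_mul_div, one_mul, div_le_iff₀ hs, Real.mul_self_sqrt hi.le]
      have : (0 : ℝ) ≤ 1 / N i := by positivity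
      linarith
  · filter_upwards [hN.eventually_gt_atTop 0] with i hi
    have hi' : (1 : ℝ) ≤ N i := by exact_mod_cast hi
    have hle : 1 / (N i : ℝ) ≤ √(η i + 1 / (N i : ℝ)) := by
      refine Real.le_sqrt_of_sq_le ?_
      have h5 : (1 / (N i : ℝ)) ^ 2 ≤ 1 / N i := by
        rw [one_div, sq]
        have : (N i : ℝ)⁻¹ ≤ 1 := inv_le_one_of_one_le₀ hi'
        exact mul_le_of_le_one_left (by positivity) this
      linarith [hη i]
    rw [listTarget, div_le_iff₀ (lt_of_lt_of_le (by positivity) hle)]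
    have := mul_le_mul_of_nonneg_left hle (by linarith : (0 : ℝ) ≤ N i)
    rwa [mul_one_div_cancel (by linarith)] at this

/-- The nested construction on top of a capacity-achieving code. -/
theorem exists_nested_codes {p D : ℝ} (hp0 : 0 < p) (hp1 : p < 1 / 2) (hD0 : 0 < D)
    (hD1 : D < 1 / 2) (N : ℕ → ℕ) (O : ℕ → OuterRS) (I₂ : ∀ i, (O i).Inner (N i)) (k₂ : ℕ → ℕ)
    (hk₂ : ∀ i, 1 ≤ k₂ i ∧ k₂ i < (O i).n)
    (hcap : AchievesCapacityBSC (bconv p D) N (fun i => concatCode (O i) (I₂ i) (k₂ i)))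
    (hroom : ∃ ρ : ℝ, 1 - h2 D < ρ ∧ ∀ᶠ i in atTop, ρ * N i ≤ (((O i).n * (O i).m : ℕ) : ℝ)) :
    ∃ (k : ℕ → ℕ) (I : ∀ i, (O i).Inner (N i)) (dec : ∀ i, BVec (N i) → BVec (N i)),
      (∀ᶠ i in atTop, k₂ i < k i ∧ k i < (O i).n) ∧
      (∀ i, ∀ v ∈ (O i).rsCode (k₂ i), concat (O i) (I i) v = concat (O i) (I₂ i) v) ∧
      Tendsto (fun i => ((k i * (O i).m : ℕ) : ℝ) / N i) atTop (𝓝 (1 - h2 D)) ∧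
      (∃ a : ℕ, ∀ᶠ i in atTop,
        meanListSize (concatCode (O i) (I i) (k i)) D ≤ (N i : ℝ) ^ a) ∧
      Tendsto (fun i => encodingError (concatCode (O i) (I i) (k i)) D) atTop (𝓝 0) ∧
      Tendsto (fun i => (((k i - k₂ i) * (O i).m : ℕ) : ℝ) / N i) atTop
        (𝓝 (h2 (bconv p D) - h2 D)) ∧
      Tendsto (fun i => sourceProb p fun w s =>
          quantize (concatCode (O i) (I i) (k i)) D w ≠
            some (wzReconstruct (O i) (I i) (k₂ i) (k i) D (dec i) w s)) atTop (𝓝 0) := by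
  classical
  obtain ⟨hN, hrate₂, dec₂, herr⟩ := hcap
  obtain ⟨ρ, hρ, hroom⟩ := hroom
  set q := bconv p D with hq
  have hDq : D < q := lt_bconv hp0 hD1
  have hq1 : q < 1 / 2 := bconv_lt_half hp1 hD1
  have hn2 : ∀ i, 2 ≤ (O i).n := fun i => by have := hk₂ i; omega
  have hm : ∀ i, 1 ≤ (O i).m := fun i => by
    by_contra h
    have h1 := hn2 i
    have h2 : (O i).m = 0 := by omega
    simp only [OuterRS.n, h2] at h1
    omega
  have hmN : ∀ i, 2 ^ (O i).m ≤ N i + 1 := fun i =>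
    (two_pow_le_outer_length (hm i)).trans (Nat.add_le_add_right (length_le (O i) (I₂ i)) 1)
  set C₂ : ∀ i, Submodule (ZMod 2) (BVec (N i)) := fun i => concatCode (O i) (I₂ i) (k₂ i)
    with hC₂
  have hdim₂ : ∀ i, Module.finrank (ZMod 2) (C₂ i) = k₂ i * (O i).m := fun i =>
    finrank_concatCode _ _ (hk₂ i).2.le (by have := hm i; omega)
  set k : ℕ → ℕ := fun i => outerDim D (N i) (O i).m with hk
  have hrate := tendsto_outerDim hD0 hD1 hN hm hmN
  simp only [hdim₂] at hrate₂
  obtain ⟨c, hc, htail⟩ := bern_tail hD0 (by linarith : D < 1)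
  obtain ⟨c', hc', htail'⟩ := bern_tail (hD0.trans hDq) (by linarith : q < 1)
  set err : ℕ → ℝ := fun i => bscError q (C₂ i) (dec₂ i) with herrdef
  have herr0 : ∀ i, 0 ≤ err i := fun i => bscError_nonneg (by linarith) (by linarith) _ _
  set η : ℕ → ℝ := fun i => err i / c with hη
  have hη0 : ∀ i, 0 ≤ η i := fun i => div_nonneg (herr0 i) hc.le
  have hηt : Tendsto η atTop (𝓝 0) := by
    have := herr.div_const c
    rwa [zero_div] at this
  obtain ⟨hL1, hL2, hL3⟩ := tendsto_listTarget hη0 hηt hN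
  set L : ℕ → ℝ := fun i => listTarget (η i) (N i) with hL
  set r : ℕ → ℕ := fun i => coverRadius (L i) (N i) (k i * (O i).m) with hr
  set lam : ℕ → ℝ := fun i => 2 ^ (k i * (O i).m) * ballCard (N i) (r i) / 2 ^ N i with hlam
  have hkk : ∀ᶠ i in atTop, k₂ i < k i ∧ k i < (O i).n := by
    have hlt : 1 - h2 q < 1 - h2 D := by
      linarith [h2_strictMono hD0.le hDq hq1.le]
    obtain ⟨y, hy1, hy2⟩ := exists_between hlt
    filter_upwards [hrate₂.eventually_lt_const hy1, hrate.eventually_const_lt hy2,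
      hrate.eventually_lt_const hρ, hroom, hN.eventually_gt_atTop 0] with i e1 e2 e3 e4 e5
    have hN' : (0 : ℝ) < N i := by exact_mod_cast e5
    constructor
    · have h1 := e1.trans e2
      rw [div_lt_div_iff_of_pos_right hN'] at h1
      have h2 : k₂ i * (O i).m < k i * (O i).m := by exact_mod_cast h1
      exact Nat.lt_of_mul_lt_mul_right h2
    · rw [div_lt_iff₀ hN'] at e3
      have h1 := e3.trans_le e4
      have h2 : k i * (O i).m < (O i).n * (O i).m := by exact_mod_cast h1
      exact Nat.lt_of_mul_lt_mul_right h2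
  have hspec : ∀ᶠ i in atTop, r i ≤ ⌊D * N i⌋₊ ∧ L i ≤ lam i ∧
      lam i ≤ (1 + 1 / (D / 2)) * L i := by
    filter_upwards [hL1.eventually_ge_atTop 1, hL3, hN.eventually_ge_atTop 1,
      eventually_small_list hD0 hD1 hN hrate] with i e1 e2 e3 e4
    refine coverRadius_spec hD0 e1 (e2.trans ?_) e4
    rw [mul_div_assoc]
    exact le_two_pow_outerDim D e3 (hm i)
  have hhalf : ∀ᶠ i in atTop, ballSum (leaderFail 0 (C₂ i)) (r i) ≤
      1 / 2 * ballCard (N i) (r i) := by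
    have ht : Tendsto (fun i => err i / c') atTop (𝓝 0) := by
      have := herr.div_const c'
      rwa [zero_div] at this
    filter_upwards [ht.eventually_le_const (show (0 : ℝ) < 1 / 2 by norm_num), hspec,
      hN.eventually_ge_atTop 1] with i e1 e2 e3
    have hri : (r i : ℝ) ≤ q * N i := by
      have h1 : (r i : ℝ) ≤ D * N i := (Nat.le_floor_iff (by positivity)).mp e2.1
      have h2 : D * (N i : ℝ) ≤ q * N i := by gcongr
      linarith
    have h := ballSum_leaderFail_le (p := 0) (D := q) le_rfl (by norm_num) (by linarith) hq1.le
      (C₂ i) (dec₂ i) hc' (htail' (N i) e3) hri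
    rw [bconv_zero_left] at h
    exact h.trans (mul_le_mul_of_nonneg_right e1 (ballCard_nonneg _ _))
  have hex : ∀ i, ∃ I : (O i).Inner (N i),
      (∀ v ∈ (O i).rsCode (k₂ i), concat (O i) I v = concat (O i) (I₂ i) v) ∧
      (k₂ i < k i ∧ k i < (O i).n →
        ballSum (leaderFail 0 (C₂ i)) (r i) ≤ 1 / 2 * ballCard (N i) (r i) →
        uncovered (concatCode (O i) I (k i)) (r i) ≤ Real.exp (-lam i / 2)) := by
    intro i
    by_cases hcond : (k₂ i < k i ∧ k i < (O i).n) ∧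
        ballSum (leaderFail 0 (C₂ i)) (r i) ≤ 1 / 2 * ballCard (N i) (r i)
    · obtain ⟨⟨h1, h2⟩, h3⟩ := hcond
      obtain ⟨C, hC1, hC2, hC3⟩ := exists_nested_cover (C₂ i) (K := k i * (O i).m) h3
        (by rw [hdim₂]; exact Nat.mul_le_mul_right _ h1.le)
        ((Nat.mul_le_mul_right _ h2.le).trans (length_le (O i) (I₂ i)))
      obtain ⟨I, hI1, hI2⟩ := exists_inner_concatCode_eq (O i) (I₂ i) h1.le h2.le
        (by have := hn2 i; omega) (by have := hm i; omega) hC1 hC2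
      exact ⟨I, hI1, fun _ _ => by rw [hI2]; exact hC3⟩
    · exact ⟨I₂ i, fun _ _ => rfl, fun h1 h2 => absurd ⟨h1, h2⟩ hcond⟩
  choose I hI1 hI2 using hex
  have hsame : ∀ i, concatCode (O i) (I i) (k₂ i) = C₂ i := by
    intro i
    ext x
    simp only [hC₂, concatCode, Submodule.mem_map]
    constructor
    · rintro ⟨v, hv, rfl⟩; exact ⟨v, hv, (hI1 i v hv).symm⟩
    · rintro ⟨v, hv, rfl⟩; exact ⟨v, hv, hI1 i v hv⟩
  have hexp : Tendsto (fun i => Real.exp (-L i / 2)) atTop (𝓝 0) := by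
    refine Real.tendsto_exp_atBot.comp ?_
    have := (tendsto_neg_atTop_atBot.comp hL1).atBot_div_const (two_pos : (0 : ℝ) < 2)
    exact this
  have hunc : ∀ᶠ i in atTop, uncovered (concatCode (O i) (I i) (k i)) (r i) ≤
      Real.exp (-L i / 2) := by
    filter_upwards [hkk, hhalf, hspec] with i e1 e2 e3
    refine (hI2 i e1 e2).trans (Real.exp_le_exp.mpr ?_)
    linarith [e3.2.1]
  refine ⟨k, I, fun i => leaderDecoder (concatCode (O i) (I i) (k₂ i)), hkk, hI1, hrate, ?_, ?_,
    ?_, ?_⟩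
  · refine ⟨3, ?_⟩
    filter_upwards [hkk, hN.eventually_ge_atTop 2] with i e1 e2
    rw [meanListSize_eq _ hD0.le, finrank_concatCode _ _ e1.2.le (by have := hm i; omega)]
    refine (two_pow_outerDim_le D (by omega) (hm i)).trans ?_
    have h : 2 ^ (O i).m * N i ≤ N i ^ 3 := by
      calc 2 ^ (O i).m * N i ≤ (N i + 1) * N i := Nat.mul_le_mul_right _ (hmN i)
        _ ≤ (N i * N i) * N i := by gcongr; nlinarith
        _ = N i ^ 3 := by ring
    exact_mod_cast h
  · refine squeeze_zero' ?_ ?_ hexp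
    · refine Eventually.of_forall fun i => ?_
      rw [encodingError_eq _ hD0.le]; exact uncovered_nonneg _ _
    · filter_upwards [hunc, hspec] with i e1 e2
      rw [encodingError_eq _ hD0.le]
      exact (uncovered_anti le_rfl e2.1).trans e1
  · have h := hrate.sub hrate₂
    rw [show 1 - h2 D - (1 - h2 q) = h2 q - h2 D by ring] at h
    refine h.congr' ?_
    filter_upwards [hkk] with i e1
    rw [← sub_div]
    congr 1
    push_cast [Nat.cast_sub e1.1.le]
    simp only [hk]
    ring
  · have hlim : Tendsto (fun i => Real.exp (-L i / 2) + (1 + 1 / (D / 2)) * (L i * η i)) atTop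
        (𝓝 (0 + (1 + 1 / (D / 2)) * 0)) := hexp.add (hL2.const_mul _)
    rw [mul_zero, add_zero] at hlim
    refine squeeze_zero' (Eventually.of_forall fun i =>
      sourceProb_nonneg hp0.le (by linarith) _) ?_ hlim
    filter_upwards [hkk, hunc, hspec, hN.eventually_ge_atTop 1] with i e1 e2 e3 e4
    refine (sourceProb_ne_le (O i) (I i) e1.1.le e1.2.le hp0.le (by linarith) hD0.le e3.1).trans
      (add_le_add e2 ?_)
    rw [finrank_concatCode _ _ e1.2.le (by have := hm i; omega), hsame]
    have hri : (r i : ℝ) ≤ D * N i := (Nat.le_floor_iff (by positivity)).mp e3.1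
    have h := ballSum_leaderFail_le hp0.le hp1.le hD0.le hD1.le (C₂ i) (dec₂ i) hc
      (htail (N i) e4) hri
    calc 2 ^ (k i * (O i).m) / 2 ^ N i * ballSum (leaderFail p (C₂ i)) (r i)
        ≤ 2 ^ (k i * (O i).m) / 2 ^ N i * (η i * ballCard (N i) (r i)) := by gcongr
      _ = lam i * η i := by simp only [hlam]; ring
      _ ≤ ((1 + 1 / (D / 2)) * L i) * η i := mul_le_mul_of_nonneg_right e3.2.2 (hη0 i)
      _ = _ := by ring

/-! ### The rate-distortion bound -/

/-- The rate `h(p ∗ D) - h(D)`. -/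
def wzCurve (p D : ℝ) : ℝ := h2 (bconv p D) - h2 D

lemma hasDerivAt_bconv (p D : ℝ) : HasDerivAt (bconv p) (1 - 2 * p) D := by
  have h : HasDerivAt (fun D => p + (1 - 2 * p) * D) ((1 - 2 * p) * 1) D :=
    ((hasDerivAt_id D).const_mul _).const_add p
  rw [mul_one] at h
  refine h.congr_of_eventuallyEq (Eventually.of_forall fun x => ?_)
  simp only [bconv]; ring

lemma continuous_h2 : Continuous h2 := Real.binEntropy_continuous.div_const _

lemma continuous_wzCurve (p : ℝ) : Continuous (wzCurve p) :=
  (continuous_h2.comp (continuous_iff_continuousAt.mpr fun D =>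
    (hasDerivAt_bconv p D).continuousAt)).sub continuous_h2

lemma wzCurve_convexOn {p : ℝ} (h0 : 0 < p) (h1 : p < 1 / 2) :
    ConvexOn ℝ (Set.Icc 0 p) (wzCurve p) := by
  have hG : ConvexOn ℝ (Set.Icc 0 p)
      (fun D => Real.binEntropy (bconv p D) - Real.binEntropy D) := by
    have hmem : ∀ D ∈ interior (Set.Icc 0 p), 0 < D ∧ D < 1 / 2 ∧ 0 < bconv p D ∧
        bconv p D < 1 := by
      intro D hD
      rw [interior_Icc] at hD
      have hb1 := lt_bconv (D := D) h0 (by linarith [hD.2])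
      have hb2 := bconv_lt_half (D := D) h1 (by linarith [hD.2])
      exact ⟨hD.1, by linarith [hD.2], by linarith [hD.1], by linarith⟩
    refine convexOn_of_hasDerivWithinAt2_nonneg (convex_Icc 0 p)
      (f' := fun D => (Real.log (1 - bconv p D) - Real.log (bconv p D)) * (1 - 2 * p) -
        (Real.log (1 - D) - Real.log D))
      (f'' := fun D => (-(1 - 2 * p) / (1 - bconv p D) - (1 - 2 * p) / bconv p D) * (1 - 2 * p) -
        (-1 / (1 - D) - 1 / D)) ?_ ?_ ?_ ?_
    · exact ((Real.binEntropy_continuous.comp (continuous_iff_continuousAt.mpr fun D =>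
        (hasDerivAt_bconv p D).continuousAt)).sub Real.binEntropy_continuous).continuousOn
    · intro D hD
      obtain ⟨a1, a2, a3, a4⟩ := hmem D hD
      exact (((Real.hasDerivAt_binEntropy a3.ne' a4.ne).comp D (hasDerivAt_bconv p D)).sub
        (Real.hasDerivAt_binEntropy a1.ne' (by linarith))).hasDerivWithinAt
    · intro D hD
      obtain ⟨a1, a2, a3, a4⟩ := hmem D hD
      have hb := hasDerivAt_bconv p D
      have e1 := (hb.const_sub 1).log (by linarith : 1 - bconv p D ≠ 0)
      have e2 := hb.log a3.ne'
      have e3 := ((hasDerivAt_id D).const_sub 1).log (by simp only [id]; linarith : 1 - id D ≠ 0)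
      have e4 := (hasDerivAt_id D).log a1.ne'
      exact (((e1.sub e2).mul_const (1 - 2 * p)).sub (e3.sub e4)).hasDerivWithinAt
    · intro D hD
      obtain ⟨a1, a2, a3, a4⟩ := hmem D hD
      set b := bconv p D with hb
      have hbb : 0 < b * (1 - b) := mul_pos a3 (by linarith)
      have hDD : 0 < D * (1 - D) := mul_pos a1 (by linarith)
      have key : b * (1 - b) = (1 - 2 * p) ^ 2 * (D * (1 - D)) + p * (1 - p) := by
        rw [hb, bconv]; ring
      have hp : 0 < p * (1 - p) := mul_pos h0 (by linarith)
      have hb1 : 1 - b ≠ 0 := by linarith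
      have hD1 : 1 - D ≠ 0 := by linarith
      have e : (-(1 - 2 * p) / (1 - b) - (1 - 2 * p) / b) * (1 - 2 * p) -
          (-1 / (1 - D) - 1 / D) = 1 / (D * (1 - D)) - (1 - 2 * p) ^ 2 / (b * (1 - b)) := by
        have := a3.ne'
        have := a1.ne'
        field_simp
        ring
      rw [e, sub_nonneg, div_le_div_iff₀ hbb hDD]
      linarith
  have h := hG.smul (inv_nonneg.mpr (Real.log_pos one_lt_two).le)
  refine h.congr fun D _ => ?_
  simp only [wzCurve, h2, smul_eq_mul]
  ring

lemma wzCurve_nonneg {p D : ℝ} (hp0 : 0 < p) (hp1 : p < 1 / 2) (hD0 : 0 ≤ D) (hDp : D ≤ p) :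
    0 ≤ wzCurve p D := by
  have h := h2_strictMono hD0 (lt_bconv (D := D) hp0 (by linarith))
    (bconv_lt_half (D := D) hp1 (by linarith)).le
  rw [wzCurve]; linarith

/-- The points of the lower convex envelope lie above segments from `(p, 0)` to the curve. -/
lemma exists_of_mem_convexHull {p d r : ℝ} (hp0 : 0 < p) (hp1 : p < 1 / 2)
    (h : (d, r) ∈ convexHull ℝ ((fun D : ℝ => (D, h2 (bconv p D) - h2 D)) '' Set.Icc 0 p ∪
      {((p, 0) : ℝ × ℝ)})) :
    ∃ D θ : ℝ, 0 ≤ D ∧ D ≤ p ∧ 0 ≤ θ ∧ θ ≤ 1 ∧ d = θ * D + (1 - θ) * p ∧ θ * wzCurve p D ≤ r := by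
  set E := {x : ℝ × ℝ | x.1 ∈ Set.Icc 0 p ∧ wzCurve p x.1 ≤ x.2} with hE
  have hconv : Convex ℝ E := (wzCurve_convexOn hp0 hp1).convex_epigraph
  have hsub : (fun D : ℝ => (D, h2 (bconv p D) - h2 D)) '' Set.Icc 0 p ∪ {((p, 0) : ℝ × ℝ)} ⊆
      insert (p, 0) E := by
    rintro x (⟨D, hD, rfl⟩ | hx)
    · exact Or.inr ⟨hD, le_rfl⟩
    · exact Or.inl hx
  have hne : E.Nonempty := ⟨(p, wzCurve p p), ⟨hp0.le, le_rfl⟩, le_rfl⟩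
  have h1 := convexHull_mono hsub h
  rw [convexHull_insert hne, hconv.convexHull_eq, mem_convexJoin] at h1
  obtain ⟨x, hx, y, ⟨hy1, hy2⟩, a, b, ha, hb, hab, hseg⟩ := h1
  rw [Set.mem_singleton_iff] at hx
  subst hx
  have e1 : a * p + b * y.1 = d := congrArg Prod.fst hseg
  have e2 : a * 0 + b * y.2 = r := congrArg Prod.snd hseg
  refine ⟨y.1, b, hy1.1, hy1.2, hb, by linarith, ?_, ?_⟩
  · rw [← e1, ← hab]; ring
  · rw [← e2, mul_zero, zero_add]
    exact mul_le_mul_of_nonneg_left hy2 hb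

lemma mem_convexHull_of_curve {p D θ : ℝ} (hD0 : 0 ≤ D) (hDp : D ≤ p) (h0 : 0 ≤ θ) (h1 : θ ≤ 1) :
    (θ * D + (1 - θ) * p, θ * wzCurve p D) ∈
      convexHull ℝ ((fun D : ℝ => (D, h2 (bconv p D) - h2 D)) '' Set.Icc 0 p ∪
        {((p, 0) : ℝ × ℝ)}) := by
  have hx := subset_convexHull ℝ ((fun D : ℝ => (D, h2 (bconv p D) - h2 D)) '' Set.Icc 0 p ∪
    {((p, 0) : ℝ × ℝ)}) (Or.inl ⟨D, ⟨hD0, hDp⟩, rfl⟩)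
  have hy := subset_convexHull ℝ ((fun D : ℝ => (D, h2 (bconv p D) - h2 D)) '' Set.Icc 0 p ∪
    {((p, 0) : ℝ × ℝ)}) (Or.inr rfl)
  have h := (convex_convexHull ℝ _) hx hy h0 (by linarith : 0 ≤ 1 - θ) (by ring)
  have e : (θ * D + (1 - θ) * p, θ * wzCurve p D) =
      θ • (D, h2 (bconv p D) - h2 D) + (1 - θ) • ((p, 0) : ℝ × ℝ) := by
    simp [wzCurve]
  rw [e]
  exact h

/-- The rate-distortion curve has slope `-∞` at zero distortion. -/
lemma exists_wzCurve_lt {p d : ℝ} (hp0 : 0 < p) (hp1 : p < 1 / 2) (hd : 0 < d) :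
    ∃ D, 0 < D ∧ D < d ∧ wzCurve p D < (p - D) * (wzCurve p 0 / p) := by
  have hb0 : bconv p 0 = p := by simp [bconv]
  have hder : HasDerivAt (fun D => Real.binEntropy (bconv p D))
      ((Real.log (1 - p) - Real.log p) * (1 - 2 * p)) 0 := by
    have h1 : HasDerivAt Real.binEntropy (Real.log (1 - p) - Real.log p) (bconv p 0) := by
      rw [hb0]; exact Real.hasDerivAt_binEntropy hp0.ne' (by linarith)
    exact h1.comp 0 (hasDerivAt_bconv p 0)
  set c := (Real.log (1 - p) - Real.log p) * (1 - 2 * p) with hc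
  have hslope := hder.tendsto_slope_zero_right.eventually_lt_const (show c < c + 1 by linarith)
  have hlog : ∀ᶠ D : ℝ in 𝓝[>] 0, Real.log D < -(c + 1 + Real.binEntropy p / p) :=
    Real.tendsto_log_nhdsGT_zero.eventually_lt_atBot _
  have hmin : ∀ᶠ D : ℝ in 𝓝[>] 0, D ∈ Set.Ioo 0 (min d p) :=
    Ioo_mem_nhdsGT (lt_min hd hp0)
  obtain ⟨D, h1, h2', h3⟩ := (hslope.and (hlog.and hmin)).exists
  have hD0 : 0 < D := h3.1
  have hDd : D < d := h3.2.trans_le (min_le_left _ _)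
  have hDp : D < p := h3.2.trans_le (min_le_right _ _)
  refine ⟨D, hD0, hDd, ?_⟩
  simp only [zero_add, hb0, smul_eq_mul] at h1
  rw [inv_mul_lt_iff₀ hD0] at h1
  have h4 : D * (c + 1 + Real.binEntropy p / p) < Real.binEntropy D := by
    have e : Real.binEntropy D = D * -Real.log D + (1 - D) * -Real.log (1 - D) := by
      rw [Real.binEntropy, Real.log_inv, Real.log_inv]
    rw [e]
    have h5 : Real.log (1 - D) ≤ 0 := Real.log_nonpos (by linarith) (by linarith)
    have h6 : D * (c + 1 + Real.binEntropy p / p) < D * -Real.log D :=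
      mul_lt_mul_of_pos_left (by linarith) hD0
    nlinarith
  have hlog2 := Real.log_pos one_lt_two
  have key : Real.binEntropy (bconv p D) - Real.binEntropy D <
      (p - D) * (Real.binEntropy p / p) := by
    have e : (p - D) * (Real.binEntropy p / p) =
        Real.binEntropy p - D * (Real.binEntropy p / p) := by field_simp
    rw [e]; linarith
  have hz : wzCurve p 0 = Real.binEntropy p / Real.log 2 := by
    simp [wzCurve, hb0, h2]
  rw [hz, wzCurve, h2, h2, ← sub_div, div_lt_iff₀ hlog2]
  calc _ < (p - D) * (Real.binEntropy p / p) := key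
    _ = _ := by field_simp

/-- The lower convex envelope consists of segments between the curve and the point `(p, 0)`. -/
theorem exists_rateWZ_eq {p d : ℝ} (hp0 : 0 < p) (hp1 : p < 1 / 2) (hd0 : 0 < d) (hdp : d ≤ p) :
    ∃ D θ : ℝ, 0 < D ∧ D < p ∧ 0 ≤ θ ∧ θ ≤ 1 ∧
      d = θ * D + (1 - θ) * p ∧ rateWZ p d = θ * (h2 (bconv p D) - h2 D) := by
  rcases hdp.eq_or_lt with rfl | hdp
  · refine ⟨d / 2, 0, by linarith, by linarith, le_rfl, zero_le_one, by ring, ?_⟩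
    rw [zero_mul]
    refine IsLeast.csInf_eq ⟨?_, ?_⟩
    · have := mem_convexHull_of_curve (p := d) (D := d) (θ := 0) hd0.le le_rfl le_rfl zero_le_one
      simpa using this
    · intro r hr
      obtain ⟨D, θ, h1, h2', h3, -, -, h5⟩ := exists_of_mem_convexHull hp0 hp1 hr
      exact (mul_nonneg h3 (wzCurve_nonneg hp0 hp1 h1 h2')).trans h5
  · have hcont : ContinuousOn (fun D => wzCurve p D / (p - D)) (Set.Icc 0 d) := by
      refine (continuous_wzCurve p).continuousOn.div (continuous_const.sub continuous_id).continuousOn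
        fun D hD => ?_
      exact sub_ne_zero.mpr (lt_of_le_of_lt hD.2 hdp).ne'
    obtain ⟨D, hD, hmin⟩ := isCompact_Icc.exists_isMinOn ⟨0, le_rfl, hd0.le⟩ hcont
    have hDp : D < p := lt_of_le_of_lt hD.2 hdp
    have hpD : 0 < p - D := by linarith
    have hle : ∀ x, 0 ≤ x → x ≤ d → wzCurve p D / (p - D) ≤ wzCurve p x / (p - x) :=
      fun x h1 h2' => hmin ⟨h1, h2'⟩
    have hDpos : 0 < D := by
      refine lt_of_le_of_ne hD.1 fun h => ?_
      obtain ⟨x, hx0, hxd, hx⟩ := exists_wzCurve_lt hp0 hp1 hd0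
      have h1 := hle x hx0.le hxd.le
      rw [← h, sub_zero, le_div_iff₀ (by linarith)] at h1
      linarith
    have hθ1 : (p - d) / (p - D) ≤ 1 := by
      rw [div_le_one hpD]; linarith [hD.2]
    have hθ0 : 0 ≤ (p - d) / (p - D) := div_nonneg (by linarith) hpD.le
    have hdist : d = (p - d) / (p - D) * D + (1 - (p - d) / (p - D)) * p := by
      field_simp; ring
    refine ⟨D, (p - d) / (p - D), hDpos, hDp, hθ0, hθ1, hdist, ?_⟩
    refine IsLeast.csInf_eq ⟨?_, ?_⟩
    · have := mem_convexHull_of_curve (p := p) hD.1 hDp.le hθ0 hθ1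
      rw [← hdist] at this
      exact this
    · intro r hr
      obtain ⟨x, θ, h1, h2', h3, hθle, h4, h5⟩ := exists_of_mem_convexHull hp0 hp1 hr
      have hxp : x < p := by
        refine lt_of_le_of_ne h2' fun h => ?_
        rw [h] at h4
        linarith
      have hθ : θ = (p - d) / (p - x) := by
        rw [eq_div_iff (by linarith), h4]; ring
      have hxd : x ≤ d := by nlinarith
      have h6 := hle x h1 hxd
      calc (p - d) / (p - D) * (h2 (bconv p D) - h2 D)
          = (p - d) * (wzCurve p D / (p - D)) := by rw [wzCurve]; ring
        _ ≤ (p - d) * (wzCurve p x / (p - x)) :=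
            mul_le_mul_of_nonneg_left h6 (by linarith)
        _ = θ * wzCurve p x := by rw [hθ]; ring
        _ ≤ r := h5

end

theorem proposition5 :
    -- Source encoding by list decoding of concatenated RS/BLBC codes.
    (∀ D : ℝ, 0 < D → D < 1 / 2 →
      ∃ (N : ℕ → ℕ) (O : ℕ → OuterRS) (I : ∀ i, (O i).Inner (N i)) (k : ℕ → ℕ),
        Tendsto N atTop atTop ∧
        (∀ i, 1 ≤ k i ∧ k i < (O i).n) ∧
        Tendsto (fun i => ((k i * (O i).m : ℕ) : ℝ) / N i) atTop (𝓝 (1 - h2 D)) ∧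
        (∀ D' : ℝ, 0 < D' → D' < D → ∃ a : ℕ, ∀ᶠ i in atTop, ∀ w : BVec (N i),
          (listDecode (concatCode (O i) (I i) (k i)) D' w).card ≤ N i ^ a) ∧
        (∃ a : ℕ, ∀ᶠ i in atTop,
          meanListSize (concatCode (O i) (I i) (k i)) D ≤ (N i : ℝ) ^ a) ∧
        Tendsto (fun i => encodingError (concatCode (O i) (I i) (k i)) D) atTop (𝓝 0)) ∧
    -- The scheme obtained from a capacity-achieving code for the BSC(p ∗ D).
    (∀ p D : ℝ, 0 < p → p < 1 / 2 → 0 < D → D < 1 / 2 →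
      ∀ (N : ℕ → ℕ) (O : ℕ → OuterRS) (I₂ : ∀ i, (O i).Inner (N i)) (k₂ : ℕ → ℕ),
        (∀ i, 1 ≤ k₂ i ∧ k₂ i < (O i).n) →
        AchievesCapacityBSC (bconv p D) N (fun i => concatCode (O i) (I₂ i) (k₂ i)) →
        (∃ ρ : ℝ, 1 - h2 D < ρ ∧ ∀ᶠ i in atTop, ρ * N i ≤ (((O i).n * (O i).m : ℕ) : ℝ)) →
        ∃ (k : ℕ → ℕ) (I : ∀ i, (O i).Inner (N i)) (dec : ∀ i, BVec (N i) → BVec (N i)),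
          (∀ᶠ i in atTop, k₂ i < k i ∧ k i < (O i).n) ∧
          (∀ i, ∀ v ∈ (O i).rsCode (k₂ i), concat (O i) (I i) v = concat (O i) (I₂ i) v) ∧
          Tendsto (fun i => ((k i * (O i).m : ℕ) : ℝ) / N i) atTop (𝓝 (1 - h2 D)) ∧
          (∃ a : ℕ, ∀ᶠ i in atTop,
            meanListSize (concatCode (O i) (I i) (k i)) D ≤ (N i : ℝ) ^ a) ∧
          Tendsto (fun i => encodingError (concatCode (O i) (I i) (k i)) D) atTop (𝓝 0) ∧
          Tendsto (fun i => (((k i - k₂ i) * (O i).m : ℕ) : ℝ) / N i) atTop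
            (𝓝 (h2 (bconv p D) - h2 D)) ∧
          Tendsto (fun i => sourceProb p fun w s =>
              quantize (concatCode (O i) (I i) (k i)) D w ≠
                some (wzReconstruct (O i) (I i) (k₂ i) (k i) D (dec i) w s)) atTop (𝓝 0) ∧
          Tendsto (fun i => sourceProb p fun w s =>
              D * N i <
                (hammingDist w (wzReconstruct (O i) (I i) (k₂ i) (k i) D (dec i) w s) : ℝ))
            atTop (𝓝 0) ∧
          (∀ θ : ℝ, 0 ≤ θ → θ ≤ 1 → ∃ T : ℕ → ℕ,
            Tendsto (fun i => (((k i - k₂ i) * (O i).m : ℕ) : ℝ) / ((N i : ℝ) + T i)) atTop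
              (𝓝 (θ * (h2 (bconv p D) - h2 D))) ∧
            ∀ ε : ℝ, 0 < ε →
              Tendsto (fun i => timeSharedExcess p
                (wzReconstruct (O i) (I i) (k₂ i) (k i) D (dec i)) (T i)
                (θ * D + (1 - θ) * p + ε)) atTop (𝓝 0))) ∧
    -- These points exhaust the rate-distortion bound.
    (∀ p d : ℝ, 0 < p → p < 1 / 2 → 0 < d → d ≤ p →
      ∃ D θ : ℝ, 0 < D ∧ D < p ∧ 0 ≤ θ ∧ θ ≤ 1 ∧
        d = θ * D + (1 - θ) * p ∧ rateWZ p d = θ * (h2 (bconv p D) - h2 D)) := by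
  refine ⟨fun D h0 h1 => exists_source_codes h0 h1, fun p D hp0 hp1 hD0 hD1 N O I₂ k₂ hk₂ hcap
    hroom => ?_, fun p d hp0 hp1 hd0 hdp => exists_rateWZ_eq hp0 hp1 hd0 hdp⟩
  obtain ⟨k, I, dec, e1, e2, e3, e4, e5, e6, e7⟩ :=
    exists_nested_codes hp0 hp1 hD0 hD1 N O I₂ k₂ hk₂ hcap hroom
  have e8 : Tendsto (fun i => sourceProb p fun w s => D * N i <
      (hammingDist w (wzReconstruct (O i) (I i) (k₂ i) (k i) D (dec i) w s) : ℝ)) atTop (𝓝 0) := by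
    refine squeeze_zero (fun i => sourceProb_nonneg hp0.le (by linarith) _)
      (fun i => sourceProb_mono hp0.le (by linarith) fun w s hlt heq => ?_) e7
    have h := (quantize_some hD0.le heq).2.1
    rw [← hammingDist_word, hammingDist_comm, Nat.le_floor_iff (by positivity)] at h
    linarith
  exact ⟨k, I, dec, e1, e2, e3, e4, e5, e6, e7, e8, fun θ h0 h1 =>
    exists_time_sharing hp0.le (by linarith) hcap.1 e6 _ e8 h0 h1⟩
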